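/- **Setting.** Let $N\ge 1$, $M\ge 2$ be integers, $\omega=e^{2\pi i/N}$, $\omega^{1/2}=e^{i\pi/N}$. On $\mathbb C^N$ with basis $|\alpha\rangle$, $\alpha\in\mathbb Z/N$, put $\mathbf x|\alpha\rangle=\omega^\alpha|\alpha\rangle$, $\mathbf z|\alpha\rangle=|\alpha+1\rangle$; $\mathbf x_m,\mathbf z_m$ act on the $m$-th factor of $(\mathbb C^N)^{\otimes M}$. For $\kappa\in\mathbb C$ and numbers $u_m,w_m\neq0$ put $\mathbf u_m=u_m\mathbf x_m$, $\mathbf w_m=w_m\mathbf z_m$, $$\ell_m(\lambda)=\ell(\lambda;\mathbf u_m,\mathbf w_m)=\begin{pmatrix}1+\frac{\kappa}{\lambda}\mathbf u_m\mathbf w_m&-\frac{\omega^{1/2}}{\lambda}\mathbf u_m\\ \mathbf w_m&0\end{pmatrix},\qquad \ell_1(\lambda)\cdots\ell_M(\lambda)=\begin{pmatrix}\mathbf a(\lambda)&\mathbf b(\lambda)\\ \mathbf c(\lambda)&\mathbf d(\lambda)\end{pmatrix}.$$ Let $\mathbf b(\lambda)$ be the upper right entry for the homogeneous chain $u_m=-\omega^{-1/2}$,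 $w_m=-1$. Let $K=\kappa^N$ and assume $\kappa\ne0$ and $\cos^2(p\pi/M)+K\neq0$ for $p=0,\dots,M-1$ (this is what makes the functions below well defined on the wave numbers used). With the principal square root put $$\Delta(\phi)=e^{i\phi}\bigl(\sqrt{\cos^2\phi+K}+\cos\phi\bigr),\quad \Delta^*(\phi)=e^{-i\phi}\bigl(\sqrt{\cos^2\phi+K}+\cos\phi\bigr),\quad \Lambda(\phi)=\Delta(\phi)\Delta^*(\phi),$$ $$d(\phi,\phi')=\frac{(\Delta(\phi)-\Delta(\phi'))(\Delta^*(\phi)-\Delta^*(\phi'))}{(\Delta(\phi)-\Delta^*(\phi'))(\Delta^*(\phi)-\Delta(\phi'))},\quad c(\phi)=\frac{\Delta^*(\phi)}{\Delta(\phi)}\frac{1-\Delta(\phi)}{1-\Delta^*(\phi)},\quad s(\phi,\phi')=\frac{\Delta^*(\phi)}{\Delta(\phi)}\frac{\Delta^*(\phi')-\Delta(\phi)}{\Delta^*(\phi')-\Delta^*(\phi)}.$$ Let $\phi_1,\dots,\phi_{M-1}$ be the numbers $\pi/M,2\pi/M,\dots,(M-1)\pi/M$ in any order, and let $\lambda_{\phi_k}$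 be any numbers with $\lambda_{\phi_k}^N=\Lambda(\phi_k)$. **Solitonic states.** Put $\tau^{(0)}_m=1$ and $\tau_m^{(n)}(\{f_k\}_{k\le n})=\tau_m^{(n-1)}(\{f_k\}_{k<n})+f_ne^{2im\phi_n}\tau_m^{(n-1)}(\{d(\phi_k,\phi_n)f_k\}_{k<n})$, and $\Theta^{(n)}_m(\{f_k\})=\tau^{(n)}_m(\{c(\phi_k)f_k\})$. A state $\{u_m,w_m\}_{m=1}^M$ is $n$-solitonic with amplitudes $f_1,\dots,f_n$ if $u_m=-\omega^{-1/2}t_{m-1}/t_m$ and $w_m=-\theta_m/\theta_{m-1}$ for some non-zero $t_m,\theta_m$ ($m\in\mathbb Z/M$) with $t_m^N=\tau_m^{(n)}$, $\theta_m^N=\Theta_m^{(n)}$. **Modified $Q$-operators.** On an auxiliary space $\mathbb C^N$, with $\mathbf u=u\mathbf x$, $\mathbf w=w\mathbf z$, let $$\tilde\ell_\phi(\lambda;u,w)=\begin{pmatrix}1-\omega^{1/2}\kappa_\phi\frac{\lambda_\phi}{\lambda}\mathbf w&-\frac{\omega^{1/2}}{\lambda}(1-\omega^{1/2}\kappa_\phi\mathbf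 w)\mathbf u\\-\omega^{1/2}\lambda_\phi\mathbf u^{-1}\mathbf w&\mathbf w\end{pmatrix},\qquad \kappa_\phi^N=K/\Delta(\phi),$$ and let $L$, $\tilde L_\phi$ be the classical matrices $\begin{pmatrix}1+\frac{K}{\Lambda}UW&\frac U\Lambda\\W&0\end{pmatrix}$, $\begin{pmatrix}1+\kappa_\phi^N\frac{\lambda_\phi^N}{\Lambda}W&\frac U\Lambda(1+\kappa_\phi^NW)\\ \lambda_\phi^N\frac WU&W\end{pmatrix}$, taken at the $N$-th powers $U=u^N$, $W=w^N$ of the arguments. An operator $\mathbf Q_\phi$ maps the state $\{u_m,w_m\}$ to $\{u'_m,w'_m\}$ if $\mathbf Q_\phi=\mathrm{tr}_\phi(\mathbf R_1\cdots\mathbf R_M)$ (trace over the auxiliary space), where for some choice of $\kappa_\phi$ and of non-zero numbers $u_{\phi,m},w_{\phi,m}$ with $u_{\phi,M+1}=u_{\phi,1}$, $w_{\phi,M+1}=w_{\phi,1}$ one has, for every $m$ and identically in the spectral parameter, the classical relation $\tilde L_\phi(u_{\phi,m},w_{\phi,m})L(u_m,w_m)=L(u'_m,w'_m)\tilde L_\phi(u_{\phi,m+1},w_{\phi,m+1})$,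 and $\mathbf R_m\neq0$ acts on (site $m$)$\,\otimes\,$(auxiliary space) with $$\tilde\ell_\phi(u_{\phi,m},w_{\phi,m})\,\ell_m(u_m,w_m)\,\mathbf R_m=\mathbf R_m\,\ell_m(u'_m,w'_m)\,\tilde\ell_\phi(u_{\phi,m+1},w_{\phi,m+1}).$$ **The operator $\mathfrak S$.** For amplitudes $f_1,\dots,f_{M-1}$ let $\mathfrak S(\{f_k\})=\mathbf Q_{\phi_1}\mathbf Q_{\phi_2}\cdots\mathbf Q_{\phi_{M-1}}$, where $\mathbf Q_{\phi_n}$ (with parameter $\lambda_{\phi_n}$) maps $\mathfrak s_{n-1}$ to $\mathfrak s_n$, $\mathfrak s_0$ is the homogeneous chain, and $\mathfrak s_n$ is an $n$-solitonic state with amplitudes $f_k\prod_{j\le n,\,j\ne k}s(\phi_k,\phi_j)$, $k\le n$ (so soliton $n$ is created with amplitude $g_n=f_n\prod_{j<n}s(\phi_n,\phi_j)$). The operator $\mathfrak S$ depends on the choices made in its definition and is considered up to scalar multipliers. At $f_k=-1$ the states degenerate, and a *value* $\mathfrak S(\{f_k=-1\})$ means any limit $\lim_j c_j\,\mathfrak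 S(\{f^{(j)}_k\})$ with $c_j\in\mathbb C$, $f^{(j)}_k\to-1$ for all $k$, where $\mathfrak S(\{f_k^{(j)}\})$ denotes any operator as above for the amplitudes $f^{(j)}$ (in particular $f^{(j)}$ is such that all the states are defined). **Theorem.** Every value $\mathfrak S=\mathfrak S(\{f_k=-1\}_{k=1}^{M-1})$ satisfies $$\mathbf b(\lambda_{\phi_n})\,\mathfrak S=0\qquad\text{for all } n=1,\dots,M-1 .$$ Consequently $\mathfrak S$ projects onto eigenvectors of $\mathbf b(\lambda)$ with zeros $\lambda_{\phi_k}$: if $P_a$ is the projection onto the eigenspace $\mathbf x_M=\omega^a$ ($a\in\mathbb Z/N$), then for all $\lambda\ne0$ $$\mathbf b(\lambda)\,P_a\mathfrak S=\frac{\omega^a}{\lambda}\prod_{k=1}^{M-1}\Bigl(1-\frac{\lambda_{\phi_k}}{\lambda}\Bigr)\,P_a\mathfrak S .$$ -/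

import Mathlib

open scoped Kronecker Topology
open Filter

noncomputable section

namespace RelToda

/-! ### Weyl matrices -/

/-- `ω = e^{2πi/N}`. -/
def omega (N : ℕ) : ℂ := Complex.exp (2 * Real.pi * Complex.I / N)

/-- `ω^{1/2} = e^{πi/N}`. -/
def omegaHalf (N : ℕ) : ℂ := Complex.exp (Real.pi * Complex.I / N)

/-- `x |α⟩ = ω^α |α⟩` on `ℂ^N`, with basis labelled by `ℤ/N`. -/
def weylX (N : ℕ) [NeZero N] : Matrix (ZMod N) (ZMod N) ℂ :=
  Matrix.diagonal fun α => omega N ^ α.val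

/-- `z |α⟩ = |α + 1⟩` on `ℂ^N`. -/
def weylZ (N : ℕ) [NeZero N] : Matrix (ZMod N) (ZMod N) ℂ :=
  Matrix.of fun α β => if α = β + 1 then 1 else 0

/-- Basis labels `|α_1, …, α_M⟩` of the state space `(ℂ^N)^{⊗ M}`.
Site number `m = 1, …, M` is the element `m - 1` of `Fin M`. -/
abbrev Conf (N M : ℕ) : Type := Fin M → ZMod N

/-- Operators on the state space of the chain. -/
abbrev Op (N M : ℕ) : Type := Matrix (Conf N M) (Conf N M) ℂ

/-- A one-site operator acting on the factor `i` of the tensor product. -/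
def atSite {N M : ℕ} (i : Fin M) (A : Matrix (ZMod N) (ZMod N) ℂ) : Op N M :=
  Matrix.of fun α β => if ∀ j, j ≠ i → α j = β j then A (α i) (β i) else 0

/-- The projection onto the span of the `|α_1, …, α_M⟩` with `α_i = a`,
the eigenspace of `x_i` with eigenvalue `ω^a`. -/
def siteProj {N M : ℕ} (i : Fin M) (a : ZMod N) : Op N M :=
  Matrix.diagonal fun α => if α i = a then 1 else 0

/-! ### Lax matrices -/

/-- The quantum Lax matrix of a site with Weyl pair `u`, `w`; here `h = ω^{1/2}`. -/
def lax {I : Type} [Fintype I] [DecidableEq I] (h κ l : ℂ) (u w : Matrix I I ℂ) :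
    Matrix (Fin 2) (Fin 2) (Matrix I I ℂ) :=
  !![1 + (κ / l) • (u * w), -((h / l) • u);
     w, 0]

/-- The quantum auxiliary ("dimer self-trapping") Lax matrix with Weyl pair `u`, `w`,
parameters `κφ`, `lφ` and spectral parameter `l`; here `h = ω^{1/2}`. -/
def auxLax {I : Type} [Fintype I] [DecidableEq I] (h κφ lφ l : ℂ) (u w : Matrix I I ℂ) :
    Matrix (Fin 2) (Fin 2) (Matrix I I ℂ) :=
  !![1 - (h * κφ * lφ / l) • w, -((h / l) • ((1 - (h * κφ) • w) * u));
     -((h * lφ) • (u⁻¹ * w)), w]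

/-- The classical Lax matrix of a site (all arguments are `N`-th powers). -/
def classLax (K L U W : ℂ) : Matrix (Fin 2) (Fin 2) ℂ :=
  !![1 + K / L * U * W, U / L;
     W, 0]

/-- The classical auxiliary Lax matrix (all arguments are `N`-th powers). -/
def classAuxLax (Kφ Lφ L U W : ℂ) : Matrix (Fin 2) (Fin 2) ℂ :=
  !![1 + Kφ * (Lφ / L) * W, U / L * (1 + Kφ * W);
     Lφ * W / U, W]

/-- The quantum monodromy matrix `ℓ_1(l) ℓ_2(l) ⋯ ℓ_M(l)` of the chain with
`𝐮_m = u_m x_m`, `𝐰_m = w_m z_m`. -/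
def monodromy (N M : ℕ) [NeZero N] (κ l : ℂ) (u w : Fin M → ℂ) :
    Matrix (Fin 2) (Fin 2) (Op N M) :=
  (List.ofFn fun i : Fin M =>
    lax (omegaHalf N) κ l (u i • atSite i (weylX N)) (w i • atSite i (weylZ N))).prod

/-- `u_m` for the homogeneous chain. -/
def uHom (N : ℕ) {M : ℕ} : Fin M → ℂ := fun _ => -(omegaHalf N)⁻¹

/-- `w_m` for the homogeneous chain. -/
def wHom {M : ℕ} : Fin M → ℂ := fun _ => -1

/-- The entry `b(l)` of the monodromy matrix of the homogeneous chain. -/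
def bHom (N M : ℕ) [NeZero N] (κ l : ℂ) : Op N M :=
  monodromy N M κ l (uHom N) wHom 0 1

/-! ### Solitonic tau-functions, in terms of `K = κ^N` -/

/-- `Δ(φ) = e^{iφ} (√(cos²φ + K) + cos φ)`, with the principal square root. -/
def Delta (K : ℂ) (φ : ℝ) : ℂ :=
  Complex.exp (φ * Complex.I) *
    (((Real.cos φ : ℂ) ^ 2 + K) ^ (1 / 2 : ℂ) + (Real.cos φ : ℂ))

/-- `Δ*(φ) = e^{-iφ} (√(cos²φ + K) + cos φ)`, with the principal square root. -/
def DeltaStar (K : ℂ) (φ : ℝ) : ℂ :=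
  Complex.exp (-(φ * Complex.I)) *
    (((Real.cos φ : ℂ) ^ 2 + K) ^ (1 / 2 : ℂ) + (Real.cos φ : ℂ))

/-- `Λ(φ) = Δ(φ) Δ*(φ)`. -/
def Lam (K : ℂ) (φ : ℝ) : ℂ := Delta K φ * DeltaStar K φ

/-- The phase shift `d(φ, φ')`. -/
def dShift (K : ℂ) (φ φ' : ℝ) : ℂ :=
  ((Delta K φ - Delta K φ') * (DeltaStar K φ - DeltaStar K φ')) /
    ((Delta K φ - DeltaStar K φ') * (DeltaStar K φ - Delta K φ'))

/-- The function `c(φ)`. -/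
def cFun (K : ℂ) (φ : ℝ) : ℂ :=
  DeltaStar K φ / Delta K φ * ((1 - Delta K φ) / (1 - DeltaStar K φ))

/-- The function `s(φ, φ')`. -/
def sFun (K : ℂ) (φ φ' : ℝ) : ℂ :=
  DeltaStar K φ / Delta K φ *
    ((DeltaStar K φ' - Delta K φ) / (DeltaStar K φ' - DeltaStar K φ))

/-- The `n`-solitonic tau-function `τ_m^{(n)}` with amplitudes `f 0, …, f (n-1)` and
wave numbers `φ 0, …, φ (n-1)` (solitons are numbered from `0`). -/
def tau (K : ℂ) (φ : ℕ → ℝ) (m : ℕ) : ℕ → (ℕ → ℂ) → ℂ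
  | 0, _ => 1
  | n + 1, f => tau K φ m n f +
      f n * Complex.exp (2 * Complex.I * m * φ n) *
        tau K φ m n (fun k => dShift K (φ k) (φ n) * f k)

/-- `Θ_m^{(n)}`: the tau-function with amplitudes `c(φ_k) f_k`. -/
def Theta (K : ℂ) (φ : ℕ → ℝ) (m n : ℕ) (f : ℕ → ℂ) : ℂ :=
  tau K φ m n fun k => cFun K (φ k) * f k

/-- `u_m`, `w_m` (`m = 1, …, M`) is an `n`-solitonic state with amplitudes `f`: it is obtained
from some choice of non-zero `N`-th roots `t_m` of `τ_m` and `θ_m` of `Θ_m`, `m ∈ ℤ/M`. -/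
def IsSolitonState (N M : ℕ) (K : ℂ) (φ : ℕ → ℝ) (n : ℕ) (f : ℕ → ℂ)
    (u w : Fin M → ℂ) : Prop :=
  ∃ t θ : ℕ → ℂ,
    (∀ m, t (m + M) = t m ∧ θ (m + M) = θ m) ∧
    (∀ m, t m ≠ 0 ∧ θ m ≠ 0) ∧
    (∀ m, t m ^ N = tau K φ m n f ∧ θ m ^ N = Theta K φ m n f) ∧
    ∀ i : Fin M,
      u i = -(omegaHalf N)⁻¹ * (t i.val / t (i.val + 1)) ∧
      w i = -(θ (i.val + 1) / θ i.val)

/-! ### Modified Q-operators -/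

/-- The quantum Darboux relation (for all values `l ≠ 0` of the spectral parameter) at one site:
`R` acts on (site) ⊗ (auxiliary space), and
`ℓ̃(uφ, wφ) ℓ(u, w) R = R ℓ(u', w') ℓ̃(uφ', wφ')`. -/
def QuantumDarboux (N : ℕ) [NeZero N] (κ κφ lφ u w uφ wφ u' w' uφ' wφ' : ℂ)
    (R : Matrix (ZMod N × ZMod N) (ZMod N × ZMod N) ℂ) : Prop :=
  ∀ l : ℂ, l ≠ 0 → ∀ p q : Fin 2,
    (auxLax (omegaHalf N) κφ lφ l
        (uφ • ((1 : Matrix (ZMod N) (ZMod N) ℂ) ⊗ₖ weylX N))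
        (wφ • ((1 : Matrix (ZMod N) (ZMod N) ℂ) ⊗ₖ weylZ N)) *
      lax (omegaHalf N) κ l
        (u • (weylX N ⊗ₖ (1 : Matrix (ZMod N) (ZMod N) ℂ)))
        (w • (weylZ N ⊗ₖ (1 : Matrix (ZMod N) (ZMod N) ℂ)))) p q * R =
    R * (lax (omegaHalf N) κ l
        (u' • (weylX N ⊗ₖ (1 : Matrix (ZMod N) (ZMod N) ℂ)))
        (w' • (weylZ N ⊗ₖ (1 : Matrix (ZMod N) (ZMod N) ℂ))) *
      auxLax (omegaHalf N) κφ lφ l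
        (uφ' • ((1 : Matrix (ZMod N) (ZMod N) ℂ) ⊗ₖ weylX N))
        (wφ' • ((1 : Matrix (ZMod N) (ZMod N) ℂ) ⊗ₖ weylZ N))) p q

/-- The classical Darboux relation at one site, as an identity in the spectral parameter. -/
def ClassicalDarboux (K Kφ Lφ U W Uφ Wφ U' W' Uφ' Wφ' : ℂ) : Prop :=
  ∀ L : ℂ, L ≠ 0 →
    classAuxLax Kφ Lφ L Uφ Wφ * classLax K L U W =
      classLax K L U' W' * classAuxLax Kφ Lφ L Uφ' Wφ'

/-- An operator on (site `i`) ⊗ (auxiliary space), acting on (chain) ⊗ (auxiliary space). -/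
def atSiteAux {N M : ℕ} (i : Fin M) (R : Matrix (ZMod N × ZMod N) (ZMod N × ZMod N) ℂ) :
    Matrix (Conf N M × ZMod N) (Conf N M × ZMod N) ℂ :=
  Matrix.of fun p q =>
    if ∀ j, j ≠ i → p.1 j = q.1 j then R (p.1 i, p.2) (q.1 i, q.2) else 0

/-- The trace over the auxiliary space. -/
def auxTrace {N M : ℕ} [NeZero N] (Q : Matrix (Conf N M × ZMod N) (Conf N M × ZMod N) ℂ) :
    Op N M :=
  Matrix.of fun α β => ∑ a : ZMod N, Q (α, a) (β, a)

/-- `Q` is a modified Q-operator with spectral parameter `φ`, `lφ`, mapping the state `(u, w)` to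
the state `(u', w')`: there are non-zero auxiliary parameters `uφ m`, `wφ m`, periodic along the
chain, and `κφ` with `κφ^N = κ^N / Δ(φ)`, which together with the two states solve the classical
Darboux relation (for the `N`-th powers), and non-zero solutions `R_m` of the quantum Darboux
relation, such that `Q` is the auxiliary trace of `R_1 R_2 ⋯ R_M`. (The `R_m` are determined up to
non-zero factors, and so is `Q`.) -/
def IsModifiedQ (N M : ℕ) [NeZero N] (κ : ℂ) (φ : ℝ) (lφ : ℂ)
    (u w u' w' : Fin M → ℂ) (Q : Op N M) : Prop :=
  ∃ (κφ : ℂ) (uφ wφ : ℕ → ℂ)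
    (R : Fin M → Matrix (ZMod N × ZMod N) (ZMod N × ZMod N) ℂ),
    κφ ^ N = κ ^ N / Delta (κ ^ N) φ ∧
    (∀ m, uφ m ≠ 0 ∧ wφ m ≠ 0) ∧
    (uφ M = uφ 0 ∧ wφ M = wφ 0) ∧
    (∀ i : Fin M, ClassicalDarboux (κ ^ N) (κφ ^ N) (lφ ^ N)
      (u i ^ N) (w i ^ N) (uφ i.val ^ N) (wφ i.val ^ N)
      (u' i ^ N) (w' i ^ N) (uφ (i.val + 1) ^ N) (wφ (i.val + 1) ^ N)) ∧
    (∀ i : Fin M, R i ≠ 0 ∧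
      QuantumDarboux N κ κφ lφ (u i) (w i) (uφ i.val) (wφ i.val)
        (u' i) (w' i) (uφ (i.val + 1)) (wφ (i.val + 1)) (R i)) ∧
    Q = auxTrace (List.ofFn fun i : Fin M => atSiteAux i (R i)).prod

/-! ### The operator creating the complete solitonic state -/

/-- The amplitude of soliton `k` after `n` solitons have been created, `k < n`:
soliton `k` is created with amplitude `g_k = f_k ∏_{j<k} s(φ_k, φ_j)`, and the creation of every
later soliton `j` multiplies it by `s(φ_k, φ_j)`. -/
def amp (K : ℂ) (φ : ℕ → ℝ) (f : ℕ → ℂ) (n k : ℕ) : ℂ :=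
  f k * ∏ j ∈ (Finset.range n).erase k, sFun K (φ k) (φ j)

/-- `S` is (a representative of) the operator `𝔖(f)`: the ordered product
`Q_{φ_1}(g_1) Q_{φ_2}(g_2) ⋯ Q_{φ_{M-1}}(g_{M-1})` of modified Q-operators that create the solitons
one after the other, starting from the homogeneous chain. -/
def IsSolitonOperator (N M : ℕ) [NeZero N] (κ : ℂ) (φ : ℕ → ℝ) (lam : ℕ → ℂ) (f : ℕ → ℂ)
    (S : Op N M) : Prop :=
  ∃ (u w : ℕ → Fin M → ℂ) (Q : ℕ → Op N M),
    u 0 = uHom N ∧ w 0 = wHom ∧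
    (∀ n < M - 1, IsSolitonState N M (κ ^ N) φ (n + 1) (amp (κ ^ N) φ f (n + 1))
      (u (n + 1)) (w (n + 1))) ∧
    (∀ n < M - 1, IsModifiedQ N M κ (φ n) (lam n) (u n) (w n) (u (n + 1)) (w (n + 1)) (Q n)) ∧
    S = (List.ofFn fun n : Fin (M - 1) => Q n.val).prod

/-- `S` is a value of `𝔖` at the point `f^*`: a limit of operators `c_j 𝔖(f^{(j)})`, where
`f^{(j)} → f^*` and the `c_j` are scalars (`𝔖(f)` is only defined up to such multipliers). -/
def IsSolitonOperatorAt (N M : ℕ) [NeZero N] (κ : ℂ) (φ : ℕ → ℝ) (lam : ℕ → ℂ) (fStar : ℕ → ℂ)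
    (S : Op N M) : Prop :=
  ∃ (f : ℕ → ℕ → ℂ) (c : ℕ → ℂ) (T : ℕ → Op N M),
    (∀ k < M - 1, Tendsto (fun j => f j k) atTop (𝓝 (fStar k))) ∧
    (∀ j, IsSolitonOperator N M κ φ lam (f j) (T j)) ∧
    Tendsto (fun j => c j • T j) atTop (𝓝 S)

end RelToda

end

/-!
The product of the Lax matrices, rotated so that the last site comes first, is a matrix of
polynomials in `x = 1 / λ`, called `rotMono`. For the homogeneous chain its lower left entry is
`w_M` times the upper left entry `a₀` of `ℓ_1 ⋯ ℓ_{M-1}`, and `b(λ)` is `λ⁻¹ x_M a₀` (`bHom_eq`). So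
`b(λ_k) 𝔖 = 0` means that this lower left entry annihilates `𝔖` at `x = 1 / λ_k`. As `a₀` has
degree `M - 1` in `x` and constant term `1`, the eigenvalue equation follows by interpolation
(`evalAt_mul_eq_prod_smul`).

*Exchange relations.* Insert a power `𝐮^{-e}` of the auxiliary Weyl pair between the last two factors
of the trace that defines `Q_j`, the `j`-th factor of `𝔖`. The local Darboux relations turn this
insertion into `Q_j V_j^e`, up to a scalar, where `V_j` is the inverse of the last `𝐮` of the new
state; they express an inserted `𝐰⁻¹` in the same terms and the inverse `π_j` of the last but one
`𝐰` of the old state; and they carry an auxiliary Lax matrix around the chain. The outcome is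
`StepRel`, a set of relations between the monodromy matrices `M_j` and `M_{j+1}` before and after
`Q_j` (`modifiedQ_stepRel`). In particular
`(M_j)₂₁ Q_j = (1 - λ_j x) R (M_{j+1})₂₁ + (terms that contain Q_j V_j)`,
so that the lower left entry at `x = 1 / λ_j` would annihilate `Q_j` if `V_j` were zero
(`StepRel.lower_left`).

*Smallness of `V_j`.* The `N`-th power of `V_j` is, up to sign, the ratio `τ_0 / τ_{M-1}` of
`(j+1)`-solitonic tau-functions. The tau-functions are determinants (`tau_mul_eq_det`). At `f = -1`
the determinants of `τ_0, …, τ_j` have a zero column (`tau_amp_eq_zero`), whereas those of the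
`τ_{M-1}` and of the functions `Θ` that occur in denominators are, up to factors of the rows,
determinants of values of triangular systems of polynomials at the distinct points `1 / Λ(φ_k)`,
and do not vanish (`tau_amp_ne_zero`, `Theta_amp_ne_zero`, `Theta_amp_full_ne_zero`).

*Passing to the limit.* The parameters of the states are not bounded near `f = -1`, and the product
of the `Q_j` may be much smaller than the product of their norms, so that the limit cannot be taken
factor by factor. Instead the operators are treated as sequences, over the ring of bounded scalar
sequences. Call a sequence regular at level `j` if right multiplication by it preserves the span of
the products `B Q_0 V_0^{i_0} ⋯ Q_{j-1} V_{j-1}^{i_{j-1}}` with bounded `B`. The coefficients of `M_0`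
are regular, and regularity passes from `M_j` to `M_{j+1}`: because the `N`-th powers of `V_j` and
`π_j` are scalars, the exchange relations can be solved for `Q_j V_j^e M_{j+1}`, with a determinant
that tends to the non-zero limit `K / Δ(φ_j)` (`StepRel.regular`, `tendsto_solvDet`). Here `π_j` and
`V_j` are themselves polynomials in the extreme coefficients of `M_j` and of `M_{j+1}`.

At the last level all the coefficients of the lower left entry, except for the constant one, are
combinations with regular coefficients of products of inverse `𝐮`'s, whose `N`-th powers are the
ratios `τ_p / τ_{M-1}` of the complete state up to sign (`IsChain.lower_coeff_mem`); these tend to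
zero. Descending along the exchange relations, the `j` highest coefficients of `(M_j)₂₁` are
negligible at level `j` (`Ladder.negligible`), hence so is `V_{j-1}`, and hence so is the value of
`(M_0)₂₁` at each `1 / λ_k` (`Ladder.eval_negligible`). Negligible means: of smaller order than the
sum of the norms of all the products of the `Q_i V_i^{e_i}` with `e_i < N`. As each of these but
`𝔖` contains some `V_i` and is negligible itself, this sum is dominated by `𝔖`
(`isBigO_sum_norm_of_eq_or_littleO`), and the limit of `c_j 𝔖(f^{(j)})` is annihilated
(`Ladder.eval_mul_prodQ_isLittleO`, `lower_left_mul_limit_eq_zero`).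
-/


noncomputable section

namespace RelToda

/-! ### Operators on the chain and on the auxiliary space -/

section Kron
variable {I J : Type} [Fintype I] [DecidableEq I] [Fintype J] [DecidableEq J]

/-- `A ↦ A ⊗ 1` as a homomorphism of algebras. -/
def kronLeft (I J : Type) [Fintype I] [DecidableEq I] [Fintype J] [DecidableEq J] :
    Matrix I I ℂ →ₐ[ℂ] Matrix (I × J) (I × J) ℂ :=
  AlgHom.ofLinearMap
    { toFun := fun A => A ⊗ₖ (1 : Matrix J J ℂ)
      map_add' := fun A B => Matrix.add_kronecker A B 1
      map_smul' := fun c A => Matrix.smul_kronecker c A 1 }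
    (Matrix.one_kronecker_one)
    (fun A B => by
      change (A * B) ⊗ₖ (1 : Matrix J J ℂ) = (A ⊗ₖ (1 : Matrix J J ℂ)) * (B ⊗ₖ (1 : Matrix J J ℂ))
      rw [← Matrix.mul_kronecker_mul, one_mul])

/-- `B ↦ 1 ⊗ B` as a homomorphism of algebras. -/
def kronRight (I J : Type) [Fintype I] [DecidableEq I] [Fintype J] [DecidableEq J] :
    Matrix J J ℂ →ₐ[ℂ] Matrix (I × J) (I × J) ℂ :=
  AlgHom.ofLinearMap
    { toFun := fun A => (1 : Matrix I I ℂ) ⊗ₖ A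
      map_add' := fun A B => Matrix.kronecker_add 1 A B
      map_smul' := fun c A => Matrix.kronecker_smul c 1 A }
    (Matrix.one_kronecker_one)
    (fun A B => by
      change (1 : Matrix I I ℂ) ⊗ₖ (A * B) = ((1 : Matrix I I ℂ) ⊗ₖ A) * ((1 : Matrix I I ℂ) ⊗ₖ B)
      rw [← Matrix.mul_kronecker_mul, one_mul])

theorem kronLeft_apply (A : Matrix I I ℂ) : kronLeft I J A = A ⊗ₖ (1 : Matrix J J ℂ) := rfl

theorem kronRight_apply (A : Matrix J J ℂ) : kronRight I J A = (1 : Matrix I I ℂ) ⊗ₖ A := rfl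

theorem commute_kronLeft_kronRight (A : Matrix I I ℂ) (B : Matrix J J ℂ) :
    Commute (kronLeft I J A) (kronRight I J B) := by
  simp only [Commute, SemiconjBy, kronLeft_apply, kronRight_apply, ← Matrix.mul_kronecker_mul,
    one_mul, mul_one]

end Kron

variable {N M : ℕ} [NeZero N]

/-- Operators on (chain) ⊗ (auxiliary space). -/
abbrev BigOp (N M : ℕ) : Type := Matrix (Conf N M × ZMod N) (Conf N M × ZMod N) ℂ

/-- An operator on the chain, acting on (chain) ⊗ (auxiliary space). -/
abbrev chainOp : Op N M →ₐ[ℂ] BigOp N M := kronLeft (Conf N M) (ZMod N)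

/-- An operator on the auxiliary space, acting on (chain) ⊗ (auxiliary space). -/
abbrev auxOp : Matrix (ZMod N) (ZMod N) ℂ →ₐ[ℂ] BigOp N M := kronRight (Conf N M) (ZMod N)

/-- The index equivalence that singles out the site `i` and the auxiliary space. -/
def siteEquiv (i : Fin M) :
    (ZMod N × ZMod N) × ({j : Fin M // j ≠ i} → ZMod N) ≃ Conf N M × ZMod N where
  toFun p := ((Equiv.funSplitAt i (ZMod N)).symm (p.1.1, p.2), p.1.2)
  invFun q := ((q.1 i, q.2), fun j => q.1 j)
  left_inv p := by
    rcases p with ⟨⟨a, b⟩, c⟩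
    simp [Equiv.funSplitAt]
    funext j
    simp [j.2]
  right_inv q := by
    rcases q with ⟨a, b⟩
    simp [Equiv.funSplitAt]
    funext j
    by_cases h : j = i
    · subst h; simp
    · simp [h]

/-- `atSiteAux i` as a homomorphism of algebras. -/
def siteHom (i : Fin M) :
    Matrix (ZMod N × ZMod N) (ZMod N × ZMod N) ℂ →ₐ[ℂ] BigOp N M :=
  (Matrix.reindexAlgEquiv ℂ ℂ (siteEquiv i)).toAlgHom.comp (kronLeft _ _)

theorem siteHom_apply (i : Fin M) (R : Matrix (ZMod N × ZMod N) (ZMod N × ZMod N) ℂ) :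
    siteHom i R = atSiteAux i R := by
  ext p q
  rcases p with ⟨α, a⟩
  rcases q with ⟨β, b⟩
  simp only [siteHom, siteEquiv, AlgHom.comp_apply, kronLeft_apply, atSiteAux, Matrix.of_apply]
  change (Matrix.reindex _ _ _) _ _ = _
  simp only [Matrix.reindex_apply, Matrix.submatrix_apply, Equiv.coe_fn_symm_mk,
    Matrix.kroneckerMap_apply, Matrix.one_apply, mul_ite, mul_one, mul_zero, funext_iff,
    Subtype.forall]

theorem siteHom_kronLeft (i : Fin M) (A : Matrix (ZMod N) (ZMod N) ℂ) :
    siteHom i (A ⊗ₖ (1 : Matrix (ZMod N) (ZMod N) ℂ)) = chainOp (M := M) (atSite i A) := by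
  rw [siteHom_apply, kronLeft_apply]
  ext p q
  simp only [atSiteAux, atSite, Matrix.of_apply, Matrix.kroneckerMap_apply, Matrix.one_apply]
  split_ifs <;> simp

theorem siteHom_kronRight (i : Fin M) (A : Matrix (ZMod N) (ZMod N) ℂ) :
    siteHom i ((1 : Matrix (ZMod N) (ZMod N) ℂ) ⊗ₖ A) = auxOp (M := M) A := by
  rw [siteHom_apply, kronRight_apply]
  ext p q
  simp only [atSiteAux, Matrix.of_apply, Matrix.kroneckerMap_apply, Matrix.one_apply]
  by_cases h : p.1 = q.1
  · simp [h]
  · have h' : ¬ ((∀ j, j ≠ i → p.1 j = q.1 j) ∧ p.1 i = q.1 i) := by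
      rintro ⟨h1, h2⟩
      exact h (funext fun j => by by_cases hj : j = i; · rw [hj, h2]
                                  · exact h1 j hj)
    simp only [h, if_false, zero_mul]
    split_ifs with h1 h2
    · exact absurd ⟨h1, h2⟩ h'
    · simp
    · rfl

theorem chainOp_injective : Function.Injective (chainOp (N := N) (M := M)) := by
  intro A B h
  ext α β
  have := congrFun (congrFun h (α, 0)) (β, 0)
  simpa [kronLeft_apply, Matrix.kroneckerMap_apply] using this

/-- `atSite i` as a homomorphism of algebras. -/
def atSiteHom (i : Fin M) : Matrix (ZMod N) (ZMod N) ℂ →ₐ[ℂ] Op N M :=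
  AlgHom.ofLinearMap
    { toFun := fun A => atSite i A
      map_add' := fun A B => by
        ext α β; simp only [atSite, Matrix.of_apply, Matrix.add_apply]; split_ifs <;> simp
      map_smul' := fun c A => by
        ext α β; simp only [atSite, Matrix.of_apply, Matrix.smul_apply]; split_ifs <;> simp }
    (by
      apply chainOp_injective
      change chainOp (atSite i 1) = _
      rw [← siteHom_kronLeft, Matrix.one_kronecker_one, map_one, map_one])
    (fun A B => by
      apply chainOp_injective
      change chainOp (atSite i (A * B)) = chainOp (atSite i A * atSite i B)
      rw [map_mul, ← siteHom_kronLeft, ← siteHom_kronLeft, ← siteHom_kronLeft, ← map_mul,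
        ← Matrix.mul_kronecker_mul, one_mul])

theorem atSiteHom_apply (i : Fin M) (A : Matrix (ZMod N) (ZMod N) ℂ) :
    atSiteHom i A = atSite i A := rfl

theorem commute_atSiteAux_chainOp {i k : Fin M} (hik : i ≠ k)
    (R : Matrix (ZMod N × ZMod N) (ZMod N × ZMod N) ℂ) (B : Matrix (ZMod N) (ZMod N) ℂ) :
    Commute (atSiteAux i R) (chainOp (atSite k B)) := by
  have key1 : ∀ p q : Conf N M × ZMod N, (atSiteAux i R * chainOp (atSite k B)) p q =
      if ∀ j, j ≠ i → j ≠ k → p.1 j = q.1 j then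
        R (p.1 i, p.2) (q.1 i, q.2) * B (p.1 k) (q.1 k) else 0 := by
    rintro ⟨α, a⟩ ⟨β, b⟩
    rw [Matrix.mul_apply, Finset.sum_eq_single (Function.update α i (β i), b)]
    · have h1 : ∀ j, j ≠ i → α j = Function.update α i (β i) j := fun j hj => by simp [hj]
      simp only [atSiteAux, atSite, kronLeft_apply, Matrix.of_apply, Matrix.kroneckerMap_apply,
        Matrix.one_apply_eq, mul_one, Function.update_self]
      rw [if_pos h1, Function.update_of_ne hik.symm]
      by_cases h : ∀ j, j ≠ i → j ≠ k → α j = β j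
      · rw [if_pos h, if_pos]
        intro j hj
        by_cases hji : j = i
        · subst hji; simp
        · rw [Function.update_of_ne hji]; exact h j hji hj
      · rw [if_neg h, if_neg, mul_zero]
        intro h'
        exact h fun j hj hjk => by have := h' j hjk; rwa [Function.update_of_ne hj] at this
    · rintro ⟨γ, c⟩ - hne
      simp only [atSiteAux, atSite, kronLeft_apply, Matrix.of_apply, Matrix.kroneckerMap_apply]
      by_cases hc : c = b
      · subst hc
        by_cases h1 : ∀ j, j ≠ i → α j = γ j
        · by_cases h2 : ∀ j, j ≠ k → γ j = β j
          · exfalso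
            apply hne
            congr 1
            funext j
            by_cases hji : j = i
            · subst hji; simp [h2 j hik]
            · rw [Function.update_of_ne hji, h1 j hji]
          · rw [if_neg h2]; simp
        · rw [if_neg h1]; simp
      · simp [hc]
    · simp
  have key2 : ∀ p q : Conf N M × ZMod N, (chainOp (atSite k B) * atSiteAux i R) p q =
      if ∀ j, j ≠ i → j ≠ k → p.1 j = q.1 j then
        R (p.1 i, p.2) (q.1 i, q.2) * B (p.1 k) (q.1 k) else 0 := by
    rintro ⟨α, a⟩ ⟨β, b⟩
    rw [Matrix.mul_apply, Finset.sum_eq_single (Function.update α k (β k), a)]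
    · have h1 : ∀ j, j ≠ k → α j = Function.update α k (β k) j := fun j hj => by simp [hj]
      simp only [atSiteAux, atSite, kronLeft_apply, Matrix.of_apply, Matrix.kroneckerMap_apply,
        Matrix.one_apply_eq, mul_one, Function.update_self]
      rw [if_pos h1, Function.update_of_ne hik]
      by_cases h : ∀ j, j ≠ i → j ≠ k → α j = β j
      · rw [if_pos h, if_pos, mul_comm]
        intro j hj
        by_cases hji : j = k
        · subst hji; simp
        · rw [Function.update_of_ne hji]; exact h j hj hji
      · rw [if_neg h, if_neg, mul_zero]
        intro h'
        exact h fun j hj hjk => by have := h' j hj; rwa [Function.update_of_ne hjk] at this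
    · rintro ⟨γ, c⟩ - hne
      simp only [atSiteAux, atSite, kronLeft_apply, Matrix.of_apply, Matrix.kroneckerMap_apply]
      by_cases hc : a = c
      · subst hc
        by_cases h1 : ∀ j, j ≠ k → α j = γ j
        · by_cases h2 : ∀ j, j ≠ i → γ j = β j
          · exfalso
            apply hne
            congr 1
            funext j
            by_cases hji : j = k
            · subst hji; simp [h2 j hik.symm]
            · rw [Function.update_of_ne hji, h1 j hji]
          · rw [if_neg h2]; simp
        · rw [if_neg h1]; simp
      · simp [hc]
    · simp
  ext p q
  rw [key1, key2]

theorem commute_atSite {i k : Fin M} (hik : i ≠ k) (A B : Matrix (ZMod N) (ZMod N) ℂ) :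
    Commute (atSite i A) (atSite k B : Op N M) := by
  have h := commute_atSiteAux_chainOp hik (A ⊗ₖ (1 : Matrix (ZMod N) (ZMod N) ℂ)) B
  rw [← siteHom_apply, siteHom_kronLeft] at h
  apply chainOp_injective
  rw [map_mul, map_mul, h.eq]

theorem auxTrace_add (Y Y' : BigOp N M) : auxTrace (Y + Y') = auxTrace Y + auxTrace Y' := by
  ext; simp [auxTrace, Finset.sum_add_distrib]

theorem auxTrace_smul (c : ℂ) (Y : BigOp N M) : auxTrace (c • Y) = c • auxTrace Y := by
  ext; simp [auxTrace, Finset.mul_sum]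

theorem auxTrace_chainOp_mul (A : Op N M) (Y : BigOp N M) :
    auxTrace (chainOp A * Y) = A * auxTrace Y := by
  ext α β
  simp only [auxTrace, Matrix.of_apply, Matrix.mul_apply, Fintype.sum_prod_type, kronLeft_apply,
    Matrix.kroneckerMap_apply, Matrix.one_apply, mul_ite, mul_one, mul_zero, ite_mul, zero_mul,
    Finset.sum_ite_eq, Finset.mem_univ, if_true, Finset.mul_sum]
  rw [Finset.sum_comm]

theorem auxTrace_mul_chainOp (A : Op N M) (Y : BigOp N M) :
    auxTrace (Y * chainOp A) = auxTrace Y * A := by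
  ext α β
  simp only [auxTrace, Matrix.of_apply, Matrix.mul_apply, Fintype.sum_prod_type, kronLeft_apply,
    Matrix.kroneckerMap_apply, Matrix.one_apply, mul_ite, mul_one, mul_zero,
    Finset.sum_ite_eq', Finset.mem_univ, if_true, Finset.sum_mul]
  rw [Finset.sum_comm]

theorem auxTrace_auxOp_mul (p : Matrix (ZMod N) (ZMod N) ℂ) (Y : BigOp N M) :
    auxTrace (auxOp p * Y) = auxTrace (Y * auxOp p) := by
  ext α β
  simp only [auxTrace, Matrix.of_apply, Matrix.mul_apply, Fintype.sum_prod_type, kronRight_apply,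
    Matrix.kroneckerMap_apply, Matrix.one_apply, mul_ite, mul_zero, ite_mul, zero_mul,
    one_mul]
  have h1 : ∀ x, (∑ x_1 : Conf N M, ∑ x_2 : ZMod N,
      if α = x_1 then p x x_2 * Y (x_1, x_2) (β, x) else 0) =
        ∑ x_2, p x x_2 * Y (α, x_2) (β, x) := by
    intro x
    rw [Finset.sum_eq_single α] <;> simp +contextual [eq_comm]
  have h2 : ∀ x, (∑ x_1 : Conf N M, ∑ x_2 : ZMod N,
      if x_1 = β then Y (α, x) (x_1, x_2) * p x_2 x else 0) =
        ∑ x_2, Y (α, x) (β, x_2) * p x_2 x := by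
    intro x
    rw [Finset.sum_eq_single β] <;> simp +contextual
  simp only [h1, h2]
  rw [Finset.sum_comm]
  simp only [mul_comm]

/-! ### The Weyl algebra -/

theorem omegaHalf_ne_zero (N : ℕ) : omegaHalf N ≠ 0 := Complex.exp_ne_zero _

theorem omega_eq_sq (N : ℕ) : omega N = omegaHalf N ^ 2 := by
  rw [omega, omegaHalf, ← Complex.exp_nat_mul]; congr 1; push_cast; ring

theorem omegaHalf_pow (N : ℕ) [NeZero N] : omegaHalf N ^ N = -1 := by
  have : (N : ℂ) ≠ 0 := Nat.cast_ne_zero.mpr (NeZero.ne N)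
  rw [omegaHalf, ← Complex.exp_nat_mul, mul_div_cancel₀ _ this, Complex.exp_pi_mul_I]

theorem omega_pow (N : ℕ) [NeZero N] : omega N ^ N = 1 := by
  rw [omega_eq_sq, ← pow_mul, mul_comm, pow_mul, omegaHalf_pow]; norm_num

theorem omega_ne_zero (N : ℕ) : omega N ≠ 0 := Complex.exp_ne_zero _

theorem omega_pow_mod (k : ℕ) : omega N ^ (k % N) = omega N ^ k := by
  conv_rhs => rw [← Nat.mod_add_div k N, pow_add, pow_mul, omega_pow, one_pow, mul_one]

theorem weylX_mul_weylZ : weylX N * weylZ N = omega N • (weylZ N * weylX N) := by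
  ext α β
  rw [weylX, Matrix.diagonal_mul, Matrix.smul_apply, Matrix.mul_diagonal]
  simp only [weylZ, Matrix.of_apply]
  split_ifs with h
  · subst h
    rw [ZMod.val_add, omega_pow_mod, pow_add, ZMod.val_one_eq_one_mod, omega_pow_mod]
    simp [mul_comm]
  · simp

theorem weylX_pow : weylX N ^ N = 1 := by
  rw [weylX, Matrix.diagonal_pow, ← Matrix.diagonal_one]
  congr 1
  funext α
  simp only [Pi.pow_apply]
  rw [← pow_mul, mul_comm, pow_mul, omega_pow, one_pow]

theorem weylZ_pow : weylZ N ^ N = 1 := by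
  have h : ∀ k : ℕ, weylZ N ^ k = Matrix.of fun α β => if α = β + (k : ZMod N) then 1 else 0 := by
    intro k
    induction k with
    | zero => ext α β; simp [Matrix.one_apply]
    | succ k ih =>
      ext α β
      rw [pow_succ, ih, Matrix.mul_apply, Finset.sum_eq_single (β + 1)]
      · simp [weylZ, add_comm, add_left_comm]
      · intro b _ hb; simp [weylZ, hb]
      · simp
  rw [h]
  ext α β
  simp [Matrix.one_apply]

/-! ### Consequences of the quantum Darboux relation at one site -/

section Local
variable {I : Type} [Fintype I] [DecidableEq I]

/-- The `1/l`-coefficient of the lower left entry, the lower right entry, and the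
`1/l²`-coefficient of the upper right entry of the Darboux relation. -/
theorem darboux_components {h κ k lam : ℂ} (hh : h ≠ 0) (hlam : lam ≠ 0)
    {u w ua wa u' w' ub wb R : Matrix I I ℂ}
    (H : ∀ l : ℂ, l ≠ 0 → ∀ p q : Fin 2,
      (auxLax h k lam l ua wa * lax h κ l u w) p q * R =
        R * (lax h κ l u' w' * auxLax h k lam l ub wb) p q) :
    κ • (ua⁻¹ * wa * u * w * R) = k • (R * w' * wb) ∧
    (h * lam) • (ua⁻¹ * wa * u * R) = -(R * w' * ((1 - (h * k) • wb) * ub)) ∧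
    (h * k * lam) • (wa * u * R) = -(κ • (R * u' * w' * ((1 - (h * k) • wb) * ub))) := by
  have e21 := H 1 one_ne_zero 1 0
  have e21' := H (-1) (by norm_num) 1 0
  have e22 := H 1 one_ne_zero 1 1
  have e12 := H 1 one_ne_zero 0 1
  have e12' := H (-1) (by norm_num) 0 1
  simp only [auxLax, lax, Matrix.mul_apply, Fin.sum_univ_two, Matrix.of_apply, Matrix.cons_val',
    Matrix.cons_val_zero, Matrix.cons_val_one, Matrix.cons_val_fin_one, div_one, div_neg,
    mul_zero, zero_mul, add_zero] at e21 e21' e22 e12 e12'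
  refine ⟨?_, ?_, ?_⟩
  · have h2 : (2 * h * lam) • (κ • (ua⁻¹ * wa * u * w * R)) =
        (2 * h * lam) • (k • (R * w' * wb)) := by
      have := congrArg₂ (· - ·) e21' e21
      simp only [neg_smul, mul_add, mul_sub, add_mul, mul_one, smul_mul_assoc,
        mul_smul_comm, neg_mul, mul_neg, mul_assoc, sub_neg_eq_add] at this ⊢
      linear_combination (norm := module) this
    exact smul_right_injective _ (by simp [hh, hlam]) h2
  · have h2 : h • ((h * lam) • (ua⁻¹ * wa * u * R)) =
        h • (-(R * w' * ((1 - (h * k) • wb) * ub))) := by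
      simp only [neg_mul, mul_neg, smul_mul_assoc, mul_smul_comm, mul_assoc] at e22 ⊢
      linear_combination (norm := module) e22
    exact smul_right_injective _ hh h2
  · have h2 : (2 * h) • ((h * k * lam) • (wa * u * R)) =
        (2 * h) • (-(κ • (R * u' * w' * ((1 - (h * k) • wb) * ub)))) := by
      have := congrArg₂ (· + ·) e12 e12'
      set o := (1 - (h * k) • wb) * ub
      simp only [neg_smul, mul_add, add_mul, sub_mul, one_mul, smul_mul_assoc,
        mul_smul_comm, neg_mul, mul_neg, mul_assoc, sub_neg_eq_add, neg_neg] at this ⊢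
      linear_combination (norm := module) this
    exact smul_right_injective _ (by simp [hh]) h2

/-- Transport of the auxiliary `u` through `R`: it becomes the `u` of the new site. -/
theorem aux_u_mul_intertwiner {h κ k lam : ℂ} (hh : h ≠ 0) (hlam : lam ≠ 0)
    {u w ua wa u' w' ub wb R : Matrix I I ℂ} {y : Matrix I I ℂ}
    (H : ∀ l : ℂ, l ≠ 0 → ∀ p q : Fin 2,
      (auxLax h k lam l ua wa * lax h κ l u w) p q * R =
        R * (lax h κ l u' w' * auxLax h k lam l ub wb) p q)
    (hua : IsUnit ua) (hy : w' * ((1 - (h * k) • wb) * ub) * y = 1) :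
    k • (ua * R) = κ • (R * u') := by
  obtain ⟨-, h22, h12⟩ := darboux_components hh hlam H
  have hinv : ua * ua⁻¹ = 1 := Matrix.mul_nonsing_inv _ ((Matrix.isUnit_iff_isUnit_det _).1 hua)
  set z := w' * ((1 - (h * k) • wb) * ub) with hz
  have h22' : (h * lam) • (wa * u * R) = -(ua * R * z) := by
    have := congrArg (fun t => ua * t) h22
    simp only [mul_smul_comm, mul_neg, ← mul_assoc, hinv, one_mul] at this
    rw [this]; simp only [hz, mul_assoc]
  have e1 : k • (ua * R * z) = κ • (R * u' * z) := by
    have : k • ((h * lam) • (wa * u * R)) = (h * k * lam) • (wa * u * R) := by module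
    rw [h22', h12] at this
    rw [smul_neg, neg_inj] at this
    rw [this, hz]; simp only [mul_assoc]
  have := congrArg (fun t => t * y) e1
  simpa only [smul_mul_assoc, mul_assoc, hy, mul_one] using this

/-- Exchange relation for the auxiliary `w`: its inverse, placed to the right of `R`,
is expressed through the inverses of the old `w` and of the auxiliary `u`. -/
theorem intertwiner_mul_aux_w_inv {h κ k lam : ℂ} (hh : h ≠ 0) (hlam : lam ≠ 0) (hκ : κ ≠ 0)
    {u w ua wa u' w' ub wb R wi wi' ubi wbi : Matrix I I ℂ}
    (H : ∀ l : ℂ, l ≠ 0 → ∀ p q : Fin 2,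
      (auxLax h k lam l ua wa * lax h κ l u w) p q * R =
        R * (lax h κ l u' w' * auxLax h k lam l ub wb) p q)
    (huw : u * w = h ^ 2 • (w * u)) (hb : ub * wb = h ^ 2 • (wb * ub))
    (hua : IsUnit ua) (hc1 : Commute w ua) (hc2 : Commute w wa)
    (hc3 : Commute w' ub) (hc4 : Commute w' wb)
    (hwi : wi * w = 1) (hwi' : w' * wi' = 1) (hubi : ub * ubi = 1) (hubi' : ubi * ub = 1)
    (hwbi : wb * wbi = 1) :
    R * wbi = (h * k) • R + (-(h * lam * k / κ)) • (wi * R * ubi) := by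
  obtain ⟨h21, h22, -⟩ := darboux_components hh hlam H
  have hinv : ua * ua⁻¹ = 1 := Matrix.mul_nonsing_inv _ ((Matrix.isUnit_iff_isUnit_det _).1 hua)
  have hinv' : ua⁻¹ * ua = 1 := Matrix.nonsing_inv_mul _ ((Matrix.isUnit_iff_isUnit_det _).1 hua)
  have hc1' : w * ua⁻¹ = ua⁻¹ * w := by
    calc w * ua⁻¹ = ua⁻¹ * ua * (w * ua⁻¹) := by rw [hinv', one_mul]
      _ = ua⁻¹ * (ua * w) * ua⁻¹ := by simp only [mul_assoc]
      _ = ua⁻¹ * w * (ua * ua⁻¹) := by rw [← hc1.eq]; simp only [mul_assoc]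
      _ = ua⁻¹ * w := by rw [hinv, mul_one]
  have hmove : ua⁻¹ * wa * u * w * R = h ^ 2 • (w * (ua⁻¹ * wa * u * R)) := by
    calc ua⁻¹ * wa * u * w * R = ua⁻¹ * wa * (u * w) * R := by simp only [mul_assoc]
      _ = h ^ 2 • (ua⁻¹ * (wa * w) * u * R) := by
        rw [huw]; simp only [mul_smul_comm, smul_mul_assoc, mul_assoc]
      _ = h ^ 2 • (ua⁻¹ * w * wa * u * R) := by rw [← hc2.eq]; simp only [mul_assoc]
      _ = h ^ 2 • (w * (ua⁻¹ * wa * u * R)) := by rw [← hc1']; simp only [mul_assoc]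
  -- `κ h² w R w' (1 - h k ŵ) û = - h λ k R w' ŵ`
  have e1 : (κ * h ^ 2) • (w * R * ((1 - (h * k) • wb) * ub) * w') =
      (-(h * lam * k)) • (R * wb * w') := by
    have e := congrArg (fun t => (h * lam) • t) h21
    simp only [hmove] at e
    have e' : (h * lam) • κ • h ^ 2 • (w * (ua⁻¹ * wa * u * R)) =
        (κ * h ^ 2) • (w * ((h * lam) • (ua⁻¹ * wa * u * R))) := by
      rw [mul_smul_comm]; module
    rw [e', h22] at e
    have c1 : R * w' * ((1 - (h * k) • wb) * ub) = R * ((1 - (h * k) • wb) * ub) * w' := by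
      have : Commute w' ((1 - (h * k) • wb) * ub) :=
        ((Commute.one_right _).sub_right (hc4.smul_right _)).mul_right hc3
      rw [mul_assoc, this.eq, ← mul_assoc]
    have c2 : R * w' * wb = R * wb * w' := by rw [mul_assoc, hc4.eq, ← mul_assoc]
    rw [c1, c2] at e
    simp only [mul_neg, smul_neg, smul_smul, neg_smul, ← mul_assoc] at e ⊢
    rw [eq_neg_iff_add_eq_zero, ← e]
    simp
  have e2 : (κ * h ^ 2) • (w * R * ((1 - (h * k) • wb) * ub)) = (-(h * lam * k)) • (R * wb) := by
    have := congrArg (fun t => t * wi') e1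
    simpa only [smul_mul_assoc, mul_assoc, hwi', mul_one] using this
  have e3 : wb * ubi = h ^ 2 • (ubi * wb) := by
    calc wb * ubi = ubi * (ub * wb) * ubi := by rw [← mul_assoc, hubi', one_mul]
      _ = h ^ 2 • (ubi * wb * (ub * ubi)) := by
        rw [hb]; simp only [mul_smul_comm, smul_mul_assoc, mul_assoc]
      _ = h ^ 2 • (ubi * wb) := by rw [hubi, mul_one]
  have e4 : (κ * h ^ 2) • (R * (wbi - (h * k) • (1 : Matrix I I ℂ))) =
      (-(h * lam * k * h ^ 2)) • (wi * R * ubi) := by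
    have := congrArg (fun t => wi * t * (ubi * wbi)) e2
    have l1 : wi * (w * R * ((1 - (h * k) • wb) * ub)) * (ubi * wbi) =
        R * (wbi - (h * k) • (1 : Matrix I I ℂ)) := by
      calc wi * (w * R * ((1 - (h * k) • wb) * ub)) * (ubi * wbi) =
          (wi * w) * R * ((1 - (h * k) • wb) * (ub * ubi) * wbi) := by simp only [mul_assoc]
        _ = _ := by
          rw [hwi, hubi, one_mul, mul_one, sub_mul, one_mul, smul_mul_assoc, hwbi]
    have l2 : wi * (R * wb) * (ubi * wbi) = h ^ 2 • (wi * R * ubi) := by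
      calc wi * (R * wb) * (ubi * wbi) = wi * R * (wb * ubi) * wbi := by simp only [mul_assoc]
        _ = h ^ 2 • (wi * R * ubi * (wb * wbi)) := by
          rw [e3]; simp only [mul_smul_comm, smul_mul_assoc, mul_assoc]
        _ = _ := by rw [hwbi, mul_one]
    simp only [mul_smul_comm, smul_mul_assoc, l1, l2] at this
    rw [this]; module
  have e5 : R * wbi - (h * k) • R = (-(h * lam * k / κ)) • (wi * R * ubi) := by
    apply smul_right_injective _ (mul_ne_zero hκ (pow_ne_zero 2 hh))
    simp only
    rw [mul_sub, mul_smul_comm, mul_one] at e4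
    rw [e4, smul_smul]
    congr 1
    field_simp
  rw [← e5]; abel

end Local

/-! ### Darboux relations along the chain -/

theorem prod_ofFn_succ_last {G : Type*} [Monoid G] {n : ℕ} (f : Fin (n + 1) → G) :
    (List.ofFn f).prod = (List.ofFn fun i : Fin n => f i.castSucc).prod * f (Fin.last n) := by
  rw [List.ofFn_succ', List.concat_eq_append, List.prod_append, List.prod_singleton]

/-- Local Darboux relations multiply along the chain. -/
theorem darboux_prod {G : Type*} [Monoid G] : ∀ {n : ℕ} (T : ℕ → G) (E E' R : Fin n → G),
    (∀ i : Fin n, T i * E i * R i = R i * E' i * T (i + 1)) →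
    (∀ i j, i ≠ j → Commute (R i) (E j)) → (∀ i j, i ≠ j → Commute (R i) (E' j)) →
    T 0 * (List.ofFn E).prod * (List.ofFn R).prod =
      (List.ofFn R).prod * (List.ofFn E').prod * T n
  | 0, T, E, E', R, _, _, _ => by simp
  | n + 1, T, E, E', R, hD, hc, hc' => by
    have ih := darboux_prod T (fun i : Fin n => E i.castSucc) (fun i => E' i.castSucc)
      (fun i => R i.castSucc) (fun i => by simpa using hD i.castSucc)
      (fun i j hij => hc _ _ (by simpa using hij)) (fun i j hij => hc' _ _ (by simpa using hij))
    have hl := hD (Fin.last n)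
    simp only [Fin.val_last] at hl
    rw [prod_ofFn_succ_last, prod_ofFn_succ_last, prod_ofFn_succ_last]
    set RR := (List.ofFn fun i : Fin n => R i.castSucc).prod
    set EE := (List.ofFn fun i : Fin n => E i.castSucc).prod
    set EE' := (List.ofFn fun i : Fin n => E' i.castSucc).prod
    have c1 : Commute RR (E (Fin.last n)) := by
      apply Commute.list_prod_left
      intro x hx
      obtain ⟨i, rfl⟩ := (List.mem_ofFn' _ _).1 hx
      exact hc _ _ (Fin.castSucc_lt_last i).ne
    have c2 : Commute (R (Fin.last n)) EE' := by
      apply Commute.list_prod_right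
      intro x hx
      obtain ⟨i, rfl⟩ := (List.mem_ofFn' _ _).1 hx
      exact hc' _ _ (Fin.castSucc_lt_last i).ne'
    calc T 0 * (EE * E (Fin.last n)) * (RR * R (Fin.last n))
        = T 0 * EE * (E (Fin.last n) * RR) * R (Fin.last n) := by simp only [mul_assoc]
      _ = (T 0 * EE * RR) * (E (Fin.last n) * R (Fin.last n)) := by
        rw [← c1.eq]; simp only [mul_assoc]
      _ = RR * EE' * (T n * E (Fin.last n) * R (Fin.last n)) := by
        rw [ih]; simp only [mul_assoc]
      _ = RR * (EE' * R (Fin.last n)) * E' (Fin.last n) * T (n + 1) := by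
        rw [hl]; simp only [mul_assoc]
      _ = _ := by rw [← c2.eq]; simp only [mul_assoc]

/-- The global Darboux relation for a partial trace `tr`: an auxiliary Lax matrix inserted at the
last link is carried once around the chain. `E` and `N` are the Lax matrix of the last site and
the product of the others. -/
theorem trace_darboux {O A B : Type*} [Ring O] [Ring A] [Ring B] (ch : O →+* B) (ax : A →+* B)
    (tr : B →+ O) (htl : ∀ x y, tr (ch x * y) = x * tr y) (htr : ∀ x y, tr (y * ch x) = tr y * x)
    (hta : ∀ p y, tr (ax p * y) = tr (y * ax p)) (hcomm : ∀ x p, Commute (ch x) (ax p))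
    {E N E' N' : Matrix (Fin 2) (Fin 2) O} {T T0 : Matrix (Fin 2) (Fin 2) A} {RR Rl : B}
    (hEN : ∀ i j k l, Commute (E i j) (N k l)) (hEN' : ∀ i j k l, Commute (E' i j) (N' k l))
    (hER : ∀ i j, Commute (ch (E i j)) RR) (hNR : ∀ i j, Commute (ch (N' i j)) Rl)
    (hlast : T.map ax * E.map ch * Matrix.scalar (Fin 2) Rl =
      Matrix.scalar (Fin 2) Rl * E'.map ch * T0.map ax)
    (hbulk : T0.map ax * N.map ch * Matrix.scalar (Fin 2) RR =
      Matrix.scalar (Fin 2) RR * N'.map ch * T.map ax) (p : A) (i j : Fin 2) :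
    ∑ k, (E * N) k j * tr (RR * ax (p * T i k) * Rl) =
      ∑ k, tr (RR * ax (T k j * p) * Rl) * (E' * N') i k := by
  have hlast' : ∀ a, ∑ k, ax (T i k) * ch (E k a) * Rl = ∑ b, Rl * ch (E' i b) * ax (T0 b a) := by
    intro a
    have := congrFun (congrFun hlast i) a
    rw [Matrix.scalar_apply, Matrix.mul_diagonal, mul_assoc, Matrix.diagonal_mul, Matrix.mul_apply,
      Matrix.mul_apply, Finset.sum_mul, Finset.mul_sum] at this
    simpa only [Matrix.map_apply, mul_assoc] using this
  have hbulk' : ∀ b, ∑ a, ax (T0 b a) * ch (N a j) * RR = ∑ k, RR * ch (N' b k) * ax (T k j) := by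
    intro b
    have := congrFun (congrFun hbulk b) j
    rw [Matrix.scalar_apply, Matrix.mul_diagonal, mul_assoc, Matrix.diagonal_mul, Matrix.mul_apply,
      Matrix.mul_apply, Finset.sum_mul, Finset.mul_sum] at this
    simpa only [Matrix.map_apply, mul_assoc] using this
  calc ∑ k, (E * N) k j * tr (RR * ax (p * T i k) * Rl)
      = ∑ k, ∑ a, tr (ch (N a j) * (RR * ax p * (ax (T i k) * ch (E k a) * Rl))) := by
        refine Finset.sum_congr rfl fun k _ => ?_
        rw [Matrix.mul_apply, Finset.sum_mul]
        refine Finset.sum_congr rfl fun a _ => ?_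
        rw [(hEN k a a j).eq, mul_assoc, ← htl, ← htl]
        congr 2
        calc ch (E k a) * (RR * ax (p * T i k) * Rl)
            = (ch (E k a) * RR) * ax p * ax (T i k) * Rl := by
              rw [map_mul]; simp only [mul_assoc]
          _ = RR * ((ch (E k a) * ax p) * ax (T i k)) * Rl := by
              rw [(hER k a).eq]; simp only [mul_assoc]
          _ = RR * ax p * (ch (E k a) * ax (T i k)) * Rl := by
              rw [(hcomm _ p).eq]; simp only [mul_assoc]
          _ = _ := by rw [(hcomm _ _).eq]; simp only [mul_assoc]
    _ = ∑ a, tr (ch (N a j) * (RR * ax p * ∑ k, ax (T i k) * ch (E k a) * Rl)) := by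
        rw [Finset.sum_comm]
        simp only [Finset.mul_sum, map_sum]
    _ = ∑ a, ∑ b, tr ((ch (N a j) * (RR * ax p * (Rl * ch (E' i b)))) * ax (T0 b a)) := by
        refine Finset.sum_congr rfl fun a _ => ?_
        rw [hlast' a, Finset.mul_sum, Finset.mul_sum, map_sum]
        simp only [mul_assoc]
    _ = ∑ b, tr ((∑ a, ax (T0 b a) * ch (N a j) * RR) * (ax p * (Rl * ch (E' i b)))) := by
        rw [Finset.sum_comm]
        refine Finset.sum_congr rfl fun b _ => ?_
        rw [Finset.sum_mul, map_sum]
        refine Finset.sum_congr rfl fun a _ => ?_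
        rw [← hta]
        simp only [mul_assoc]
    _ = ∑ b, ∑ k, tr (RR * ax (T k j * p) * Rl) * (E' i b * N' b k) := by
        refine Finset.sum_congr rfl fun b _ => ?_
        rw [hbulk', Finset.sum_mul, map_sum]
        refine Finset.sum_congr rfl fun k _ => ?_
        rw [(hEN' i b b k).eq, ← mul_assoc (tr _), ← htr, ← htr]
        congr 1
        calc RR * ch (N' b k) * ax (T k j) * (ax p * (Rl * ch (E' i b)))
            = RR * (ch (N' b k) * ax (T k j * p)) * Rl * ch (E' i b) := by
              rw [map_mul]; simp only [mul_assoc]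
          _ = RR * ax (T k j * p) * (ch (N' b k) * Rl) * ch (E' i b) := by
              rw [(hcomm _ _).eq]; simp only [mul_assoc]
          _ = _ := by rw [(hNR b k).eq]; simp only [mul_assoc]
    _ = _ := by
        rw [Finset.sum_comm]
        simp only [Matrix.mul_apply, Finset.mul_sum]

/-! ### Exchange relations derived from the trace identities -/

/-- The auxiliary Lax matrix with an inverse `Ui` of the first letter given explicitly and
`x = 1 / l`. -/
def auxLaxInv {A : Type*} [Ring A] [Algebra ℂ A] (h k lam x : ℂ) (U Ui W : A) :
    Matrix (Fin 2) (Fin 2) A :=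
  !![1 - (h * k * lam * x) • W, -((h * x) • ((1 - (h * k) • W) * U)); -((h * lam) • (Ui * W)), W]

section Exchange

/-- The elements `Q(u^{-e} w^{-1})` in terms of `q e = Q(u^{-e})`. -/
def exchangeR {S O : Type*} [CommRing S] [Ring O] [Algebra S O] (h k ct : S) (π : O) (q : ℕ → O)
    (e : ℕ) : O :=
  (h ^ 2) ^ e • ((h * k) • q e + ct • (π * q (e + 1)))

/-- The elements `Q(u^{-e} (w^{-1} - h k) u)` in terms of `q e = Q(u^{-e})`. -/
def exchangeS {S O : Type*} [CommRing S] [Ring O] [Algebra S O] (h k ct : S) (π : O) (q : ℕ → O) :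
    ℕ → O
  | 0 => ct • (π * q 0)
  | e + 1 => h ^ 2 • exchangeR h k ct π q e - (h * k) • q e

variable {O A : Type*} [Ring O] [Ring A] [Algebra ℂ O] [Algebra ℂ A]

/-- The matrix `Q(u^{-e} w^{-1} ℓ̃)` at `l = 1 / x`. -/
def exchangeL (h k lam ct x : ℂ) (π : O) (q : ℕ → O) (e : ℕ) : Matrix (Fin 2) (Fin 2) O :=
  !![exchangeR h k ct π q e - (h * k * lam * x) • q e, -((h * x) • exchangeS h k ct π q e);
     -((lam / h) • q (e + 1)), q e]

/-- The exchange relations between two monodromy matrices `M`, `M'` at one value `x` of the inverse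
spectral parameter, for a functional `Qf` on the auxiliary algebra. They are the combinations of
the relations `hB3` in which only one entry of `M'` survives on the right. -/
theorem exchange_relations {h k lam ct x : ℂ} (hh : h ≠ 0) {U Ui W Wi : A} {π : O} (Qf : A →ₗ[ℂ] O)
    (hUW : U * W = h ^ 2 • (W * U)) (hU : U * Ui = 1) (hU' : Ui * U = 1)
    (hW : W * Wi = 1) (hW' : Wi * W = 1)
    (hB2 : ∀ p, Qf (Wi * p) = (h * k) • Qf p + ct • (π * Qf (Ui * p)))
    {M M' : Matrix (Fin 2) (Fin 2) O}
    (hB3 : ∀ p i j, ∑ r, M r j * Qf (p * auxLaxInv h k lam x U Ui W i r) =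
      ∑ r, Qf (auxLaxInv h k lam x U Ui W r j * p) * M' i r) (e : ℕ) (i : Fin 2) :
    ((1 - lam * x) • (exchangeR h k ct π (fun e => Qf (Ui ^ e)) e * M' i 0) =
      ∑ r, (M r 0 * exchangeL h k lam ct x π (fun e => Qf (Ui ^ e)) e i r +
        (lam / h) • (M r 1 * exchangeL h k lam ct x π (fun e => Qf (Ui ^ e)) (e + 1) i r))) ∧
    ((1 - lam * x) • (exchangeR h k ct π (fun e => Qf (Ui ^ e)) e * M' i 1) =
      ∑ r, ((x / h * ct) • (M r 0 * (π * exchangeL h k lam ct x π (fun e => Qf (Ui ^ e)) e i r)) +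
        ((h * k - lam * k / h * x) •
            (M r 1 * exchangeL h k lam ct x π (fun e => Qf (Ui ^ e)) e i r) +
          ct • (M r 1 * (π * exchangeL h k lam ct x π (fun e => Qf (Ui ^ e)) (e + 1) i r))))) := by
  set q : ℕ → O := fun e => Qf (Ui ^ e) with hq
  set T := auxLaxInv h k lam x U Ui W with hT
  have hh2 : h ^ 2 ≠ 0 := pow_ne_zero 2 hh
  have r1 : W * Ui = h ^ 2 • (Ui * W) := by
    calc W * Ui = Ui * (U * W) * Ui := by rw [← mul_assoc, hU', one_mul]
      _ = h ^ 2 • (Ui * W * (U * Ui)) := by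
        rw [hUW]; simp only [mul_smul_comm, smul_mul_assoc, mul_assoc]
      _ = _ := by rw [hU, mul_one]
  have r2 : Wi * U = h ^ 2 • (U * Wi) := by
    calc Wi * U = Wi * (U * W) * Wi := by rw [mul_assoc, mul_assoc, hW, mul_one]
      _ = h ^ 2 • ((Wi * W) * U * Wi) := by
        rw [hUW]; simp only [mul_smul_comm, smul_mul_assoc, mul_assoc]
      _ = _ := by rw [hW', one_mul]
  have r3 : Ui * Wi = h ^ 2 • (Wi * Ui) := by
    calc Ui * Wi = Wi * (W * Ui) * Wi := by rw [← mul_assoc, hW', one_mul]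
      _ = h ^ 2 • (Wi * Ui * (W * Wi)) := by
        rw [r1]; simp only [mul_smul_comm, smul_mul_assoc, mul_assoc]
      _ = _ := by rw [hW, mul_one]
  have r3e : ∀ e, Ui ^ e * Wi = (h ^ 2) ^ e • (Wi * Ui ^ e) := by
    intro e
    induction e with
    | zero => simp
    | succ e ih =>
      rw [pow_succ', mul_assoc, ih, mul_smul_comm, ← mul_assoc, r3, smul_mul_assoc, smul_smul,
        mul_assoc, ← pow_succ]
  have hR : ∀ e, Qf (Ui ^ e * Wi) = exchangeR h k ct π q e := by
    intro e
    rw [r3e, map_smul, hB2, exchangeR, ← pow_succ']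
  have hS : ∀ e, Qf (Ui ^ e * ((Wi - (h * k) • 1) * U)) = exchangeS h k ct π q e := by
    intro e
    cases e with
    | zero =>
      rw [pow_zero, one_mul, sub_mul, map_sub, hB2, hU', smul_mul_assoc, one_mul, map_smul]
      simp [exchangeS, hq]
    | succ e =>
      have : Ui ^ (e + 1) * ((Wi - (h * k) • 1) * U) =
          h ^ 2 • (Ui ^ e * Wi) - (h * k) • Ui ^ e := by
        rw [pow_succ, mul_assoc, sub_mul, r2, smul_mul_assoc, one_mul, mul_sub, mul_smul_comm,
          mul_smul_comm, ← mul_assoc, hU', one_mul, mul_sub, mul_smul_comm, mul_smul_comm, mul_one]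
      rw [this, map_sub, map_smul, map_smul, hR, exchangeS]
  have hL : ∀ e (i r : Fin 2), Qf (Ui ^ e * Wi * T i r) = exchangeL h k lam ct x π q e i r := by
    intro e i r
    have w1 : Wi * (1 - (h * k) • W) = Wi - (h * k) • 1 := by
      rw [mul_sub, mul_one, mul_smul_comm, hW']
    have t00 : Ui ^ e * Wi * (1 - (h * k * lam * x) • W) =
        Ui ^ e * Wi - (h * k * lam * x) • Ui ^ e := by
      rw [mul_sub, mul_one, mul_smul_comm, mul_assoc (Ui ^ e), hW', mul_one]
    have t01 : Ui ^ e * Wi * ((1 - (h * k) • W) * U) = Ui ^ e * ((Wi - (h * k) • 1) * U) := by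
      rw [← w1]; simp only [mul_assoc]
    have t10 : h ^ 2 • (Ui ^ e * Wi * (Ui * W)) = Ui ^ (e + 1) := by
      rw [mul_assoc, ← mul_smul_comm, ← mul_smul_comm, ← r1, ← mul_assoc Wi, hW', one_mul, pow_succ]
    have t10' : Ui ^ e * Wi * (Ui * W) = (h ^ 2)⁻¹ • Ui ^ (e + 1) := by
      rw [← t10, smul_smul, inv_mul_cancel₀ hh2, one_smul]
    fin_cases i <;> fin_cases r
    · simp only [hT, auxLaxInv, exchangeL, Fin.zero_eta, Matrix.of_apply, Matrix.cons_val',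
      Matrix.cons_val_zero, Matrix.cons_val_fin_one]
      rw [t00, map_sub, map_smul, hR]
    · simp only [hT, auxLaxInv, exchangeL, Fin.zero_eta, Fin.mk_one, Matrix.of_apply,
      Matrix.cons_val', Matrix.cons_val_zero, Matrix.cons_val_one, Matrix.cons_val_fin_one]
      rw [mul_neg, mul_smul_comm, t01, map_neg, map_smul, hS]
    · simp only [hT, auxLaxInv, exchangeL, Fin.zero_eta, Fin.mk_one, Matrix.of_apply,
      Matrix.cons_val', Matrix.cons_val_zero, Matrix.cons_val_one, Matrix.cons_val_fin_one]
      rw [mul_neg, mul_smul_comm, t10', map_neg, map_smul, map_smul, smul_smul]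
      congr 2
      field_simp
    · simp only [hT, auxLaxInv, exchangeL, Fin.mk_one, Matrix.of_apply, Matrix.cons_val',
      Matrix.cons_val_one, Matrix.cons_val_fin_one]
      rw [mul_assoc, hW', mul_one]
  have hUL : ∀ e (i r : Fin 2), Qf (Ui * (Ui ^ e * Wi) * T i r) =
      exchangeL h k lam ct x π q (e + 1) i r := by
    intro e i r
    rw [← hL, pow_succ']
    simp only [mul_assoc]
  have hRp := hR e
  have hLp := hL e
  have hUp := hUL e
  generalize Ui ^ e * Wi = p at hRp hLp hUp
  constructor
  · have c1 := hB3 p i 0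
    have c2 := hB3 ((lam / h) • (Ui * p)) i 1
    have s0 : T 0 0 * p + T 0 1 * ((lam / h) • (Ui * p)) = (1 - lam * x) • p := by
      simp only [hT, auxLaxInv, Matrix.of_apply, Matrix.cons_val', Matrix.cons_val_zero,
        Matrix.cons_val_one, Matrix.cons_val_fin_one]
      have : (1 - (h * k) • W) * U * (Ui * p) = (1 - (h * k) • W) * p := by
        rw [mul_assoc, ← mul_assoc U, hU, one_mul]
      rw [mul_smul_comm, neg_mul, smul_mul_assoc, this, sub_mul, sub_mul, one_mul, smul_mul_assoc,
        smul_mul_assoc]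
      have e : (lam / h) • -((h * x) • (p - (h * k) • (W * p))) =
          -((lam * x) • p) + (h * k * lam * x) • (W * p) := by
        match_scalars <;> field_simp
      rw [e]; module
    have s1 : T 1 0 * p + T 1 1 * ((lam / h) • (Ui * p)) = 0 := by
      simp only [hT, auxLaxInv, Matrix.of_apply, Matrix.cons_val', Matrix.cons_val_zero,
        Matrix.cons_val_one, Matrix.cons_val_fin_one]
      rw [mul_smul_comm, ← mul_assoc W, r1, neg_mul, smul_mul_assoc, smul_mul_assoc]
      match_scalars
      field_simp
      ring
    have c := congrArg₂ (· + ·) c1 c2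
    simp only [Fin.sum_univ_two] at c ⊢
    have : Qf (T 0 0 * p) * M' i 0 + Qf (T 1 0 * p) * M' i 1 +
        (Qf ((T 0 1) * ((lam / h) • (Ui * p))) * M' i 0 +
          Qf (T 1 1 * ((lam / h) • (Ui * p))) * M' i 1) =
        (1 - lam * x) • (exchangeR h k ct π q e * M' i 0) := by
      rw [← hRp, ← smul_mul_assoc (1 - lam * x), ← map_smul Qf (1 - lam * x), ← s0]
      have z : Qf (T 1 0 * p) * M' i 1 + Qf (T 1 1 * ((lam / h) • (Ui * p))) * M' i 1 = 0 := by
        rw [← add_mul, ← map_add, s1, map_zero, zero_mul]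
      rw [map_add, add_mul]
      linear_combination (norm := abel) z
    rw [this] at c
    rw [← c]
    simp only [smul_mul_assoc, map_smul, hLp, hUp, mul_smul_comm]
    abel
  · have c1 := hB3 ((x / h) • ((Wi - (h * k) • 1) * (U * p))) i 0
    have c2 := hB3 ((Wi - (lam * k / h * x) • 1) * p) i 1
    have hcomm : ∀ y : ℂ, (1 - y • W) * Wi = Wi * (1 - y • W) := by
      intro y; rw [sub_mul, mul_sub, one_mul, mul_one, smul_mul_assoc, mul_smul_comm, hW, hW']
    have u1 : U * (Wi - (lam * k / h * x) • 1) =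
        (h ^ 2)⁻¹ • (Wi * (1 - (h * k * lam * x) • W) * U) := by
      rw [mul_sub, mul_sub, mul_one, mul_smul_comm, mul_smul_comm, mul_one, hW', sub_mul, r2,
        smul_mul_assoc, one_mul, smul_sub, smul_smul, smul_smul,
        inv_mul_cancel₀ hh2, one_smul]
      congr 2
      field_simp
    have s0 : T 0 0 * ((x / h) • ((Wi - (h * k) • 1) * (U * p))) +
        T 0 1 * ((Wi - (lam * k / h * x) • 1) * p) = 0 := by
      simp only [hT, auxLaxInv, Matrix.of_apply, Matrix.cons_val', Matrix.cons_val_zero,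
        Matrix.cons_val_one, Matrix.cons_val_fin_one]
      have a1 : (1 - (h * k * lam * x) • W) * ((Wi - (h * k) • 1) * (U * p)) =
          Wi * (1 - (h * k) • W) * (1 - (h * k * lam * x) • W) * (U * p) := by
        have : Wi - (h * k) • 1 = Wi * (1 - (h * k) • W) := by
          rw [mul_sub, mul_one, mul_smul_comm, hW']
        have sw : (1 - (h * k * lam * x) • W) * (1 - (h * k) • W) =
            (1 - (h * k) • W) * (1 - (h * k * lam * x) • W) := by
          simp only [mul_sub, sub_mul, mul_one, one_mul, smul_mul_assoc, mul_smul_comm]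
          module
        rw [this, ← mul_assoc, ← mul_assoc _ Wi, hcomm, mul_assoc Wi, sw, ← mul_assoc Wi]
      have a2 : (1 - (h * k) • W) * U * ((Wi - (lam * k / h * x) • 1) * p) =
          (h ^ 2)⁻¹ • (Wi * (1 - (h * k) • W) * (1 - (h * k * lam * x) • W) * (U * p)) := by
        rw [mul_assoc, ← mul_assoc U, u1, smul_mul_assoc, mul_smul_comm, ← hcomm (h * k)]
        simp only [mul_assoc]
      rw [mul_smul_comm, a1, neg_mul, smul_mul_assoc, a2]
      match_scalars
      field_simp
      ring
    have s1 : T 1 0 * ((x / h) • ((Wi - (h * k) • 1) * (U * p))) +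
        T 1 1 * ((Wi - (lam * k / h * x) • 1) * p) = (1 - lam * x) • p := by
      simp only [hT, auxLaxInv, Matrix.of_apply, Matrix.cons_val', Matrix.cons_val_zero,
        Matrix.cons_val_one, Matrix.cons_val_fin_one]
      have a1 : Ui * W * ((Wi - (h * k) • 1) * (U * p)) = p - (h * k / h ^ 2) • (W * p) := by
        have b1 : Ui * W * ((Wi - (h * k) • 1) * (U * p)) = p - (h * k) • (Ui * (W * U) * p) := by
          have : Ui * W * ((Wi - (h * k) • 1) * (U * p)) =
              Ui * (W * (Wi - (h * k) • 1)) * (U * p) := by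
            simp only [mul_assoc]
          rw [this, mul_sub, hW, mul_smul_comm, mul_one, mul_sub, sub_mul, mul_one,
            ← mul_assoc Ui U, hU', one_mul, mul_smul_comm, smul_mul_assoc]
          simp only [mul_assoc]
        have b2 : W * U = (h ^ 2)⁻¹ • (U * W) := by
          rw [hUW, smul_smul, inv_mul_cancel₀ hh2, one_smul]
        rw [b1, b2, mul_smul_comm, ← mul_assoc, hU', one_mul, smul_mul_assoc, smul_smul,
          div_eq_mul_inv]
      have a2 : W * ((Wi - (lam * k / h * x) • 1) * p) = p - (lam * k / h * x) • (W * p) := by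
        rw [← mul_assoc, mul_sub, hW, mul_smul_comm, mul_one, sub_mul, one_mul, smul_mul_assoc]
      rw [mul_smul_comm, neg_mul, smul_mul_assoc, a1, a2]
      match_scalars <;> field_simp <;> ring
    have c := congrArg₂ (· + ·) c1 c2
    simp only [Fin.sum_univ_two] at c ⊢
    set p1 := (x / h) • ((Wi - (h * k) • 1) * (U * p))
    set p2 := (Wi - (lam * k / h * x) • 1) * p
    have : Qf (T 0 0 * p1) * M' i 0 + Qf (T 1 0 * p1) * M' i 1 +
        (Qf (T 0 1 * p2) * M' i 0 + Qf (T 1 1 * p2) * M' i 1) =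
        (1 - lam * x) • (exchangeR h k ct π q e * M' i 1) := by
      rw [← hRp, ← smul_mul_assoc (1 - lam * x), ← map_smul Qf (1 - lam * x), ← s1]
      have z : Qf (T 0 0 * p1) * M' i 0 + Qf (T 0 1 * p2) * M' i 0 = 0 := by
        rw [← add_mul, ← map_add, s0, map_zero, zero_mul]
      rw [map_add, add_mul]
      linear_combination (norm := abel) z
    rw [this] at c
    rw [← c]
    have f1 : ∀ r, Qf (p1 * T i r) = (x / h * ct) • (π * exchangeL h k lam ct x π q e i r) := by
      intro r
      have : p1 * T i r = (x / h) • (Wi * (U * p * T i r) - (h * k) • (U * p * T i r)) := by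
        simp only [p1, smul_mul_assoc, sub_mul, one_mul, mul_assoc]
      rw [this, map_smul, map_sub, hB2, map_smul]
      have : Ui * (U * p * T i r) = p * T i r := by
        rw [mul_assoc U, ← mul_assoc Ui, hU', one_mul]
      rw [this, hLp]
      simp only [smul_smul, add_sub_cancel_left]
    have f2 : ∀ r, Qf (p2 * T i r) = (h * k - lam * k / h * x) • exchangeL h k lam ct x π q e i r +
        ct • (π * exchangeL h k lam ct x π q (e + 1) i r) := by
      intro r
      have : p2 * T i r = Wi * (p * T i r) - (lam * k / h * x) • (p * T i r) := by
        simp only [p2, smul_mul_assoc, sub_mul, one_mul, mul_assoc]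
      rw [this, map_sub, hB2, map_smul, ← mul_assoc, hUp, hLp]
      module
    simp only [f1, f2, mul_smul_comm, mul_add]
    abel

end Exchange

/-! ### Lax matrices as polynomials in the inverse spectral parameter -/

open Polynomial in
/-- Evaluation of a polynomial with non-commuting coefficients at a scalar. -/
def evalAt {S O : Type*} [CommRing S] [Ring O] [Algebra S O] (x : S) : O[X] →+* O :=
  Polynomial.eval₂RingHom' (RingHom.id O) (algebraMap S O x) (fun a => (Algebra.commutes x a).symm)

section Poly
open Polynomial
variable {S O : Type*} [CommRing S] [Ring O] [Algebra S O]

theorem evalAt_C (x : S) (a : O) : evalAt x (C a) = a := by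
  simp [evalAt, eval₂RingHom']

theorem evalAt_X (x : S) : evalAt x (X : O[X]) = algebraMap S O x := by
  simp [evalAt, eval₂RingHom']

theorem evalAt_smul (x c : S) (P : O[X]) : evalAt x (c • P) = c • evalAt x P := by
  rw [Algebra.smul_def, Polynomial.algebraMap_apply, map_mul, evalAt_C, ← Algebra.smul_def]

theorem evalAt_mul_X (x : S) (P : O[X]) : evalAt x (P * X) = x • evalAt x P := by
  rw [map_mul, evalAt_X, ← Algebra.commutes, ← Algebra.smul_def]

theorem evalAt_eq_sum (x : S) (P : O[X]) {n : ℕ} (hn : P.natDegree < n) :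
    evalAt x P = ∑ l ∈ Finset.range n, x ^ l • P.coeff l := by
  change P.eval₂ (RingHom.id O) (algebraMap S O x) = _
  rw [Polynomial.eval₂_eq_sum_range' _ hn]
  refine Finset.sum_congr rfl fun l _ => ?_
  rw [RingHom.id_apply, ← map_pow, ← Algebra.commutes, ← Algebra.smul_def]

/-- A polynomial with matrix coefficients vanishes if it vanishes at all non-zero scalars. -/
theorem polynomial_eq_zero_of_evalAt {I : Type} [Fintype I] [DecidableEq I]
    {P : (Matrix I I ℂ)[X]} (h : ∀ x : ℂ, x ≠ 0 → evalAt x P = 0) : P = 0 := by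
  ext l i j
  set p : ℂ[X] := ∑ r ∈ Finset.range (P.natDegree + 1), monomial r (P.coeff r i j) with hp
  have hev : ∀ x, p.eval x = evalAt x P i j := by
    intro x
    rw [evalAt_eq_sum x P (Nat.lt_succ_self _), hp, eval_finsetSum, Matrix.sum_apply]
    refine Finset.sum_congr rfl fun r _ => ?_
    rw [eval_monomial, Matrix.smul_apply, smul_eq_mul, mul_comm]
  have hp0 : p = 0 := by
    apply Polynomial.eq_zero_of_infinite_isRoot
    apply Set.Infinite.mono (s := {x : ℂ | x ≠ 0})
    · intro x hx
      simp only [Set.mem_ofPred_eq, IsRoot, hev, h x hx, Matrix.zero_apply]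
    · exact Set.infinite_of_finite_compl (by
        have : {x : ℂ | x ≠ 0}ᶜ = {0} := by ext; simp
        rw [this]; exact Set.finite_singleton 0)
  have hc : p.coeff l = P.coeff l i j := by
    rw [hp, finsetSum_coeff]
    simp only [coeff_monomial]
    rw [Finset.sum_ite_eq' ]
    split_ifs with hl
    · rfl
    · rw [coeff_eq_zero_of_natDegree_lt (by simpa using hl)]; rfl
  rw [← hc, hp0]; simp

theorem polynomial_eq_of_evalAt {I : Type} [Fintype I] [DecidableEq I]
    {P P' : (Matrix I I ℂ)[X]} (h : ∀ x : ℂ, x ≠ 0 → evalAt x P = evalAt x P') : P = P' :=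
  sub_eq_zero.1 (polynomial_eq_zero_of_evalAt fun x hx => by rw [map_sub, h x hx, sub_self])

/-- The Lax matrix of a site as a polynomial in `x = 1 / l`. -/
def laxPoly (h κ : S) (u w : O) : Matrix (Fin 2) (Fin 2) O[X] :=
  !![1 + C (κ • (u * w)) * X, -(C (h • u) * X); C w, 0]

/-- The matrix of the `Q(u^{-e} w^{-1} ℓ̃)` as a polynomial in `x = 1 / l`; here `hi = 1 / h`. -/
def exchangeLPoly (h hi k lam ct : S) (π : O) (q : ℕ → O) (e : ℕ) : Matrix (Fin 2) (Fin 2) O[X] :=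
  !![C (exchangeR h k ct π q e) - C ((h * k * lam) • q e) * X,
      -(C (h • exchangeS h k ct π q e) * X);
     -C ((lam * hi) • q (e + 1)), C (q e)]

/-- The exchange relations between the monodromy matrices `M`, `M'` before and after one step. -/
def StepRel (h hi k lam ct : S) (π : O) (q : ℕ → O) (M M' : Matrix (Fin 2) (Fin 2) O[X]) : Prop :=
  ∀ (e : ℕ) (i : Fin 2),
    ((1 - C (algebraMap S O lam) * X) * (C (exchangeR h k ct π q e) * M' i 0) =
      ∑ r, (M r 0 * exchangeLPoly h hi k lam ct π q e i r +
        (lam * hi) • (M r 1 * exchangeLPoly h hi k lam ct π q (e + 1) i r))) ∧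
    ((1 - C (algebraMap S O lam) * X) * (C (exchangeR h k ct π q e) * M' i 1) =
      ∑ r, ((hi * ct) • (M r 0 * (C π * exchangeLPoly h hi k lam ct π q e i r) * X) +
        ((h * k) • (M r 1 * exchangeLPoly h hi k lam ct π q e i r) -
            (lam * k * hi) • (M r 1 * exchangeLPoly h hi k lam ct π q e i r * X) +
          ct • (M r 1 * (C π * exchangeLPoly h hi k lam ct π q (e + 1) i r)))))

end Poly

section Lift
variable {I J : Type} [Fintype I] [DecidableEq I] [Fintype J] [DecidableEq J]

theorem map_inv_of_isUnit (f : Matrix I I ℂ →ₐ[ℂ] Matrix J J ℂ) {A : Matrix I I ℂ} (hA : IsUnit A) :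
    f A⁻¹ = (f A)⁻¹ := by
  symm
  apply Matrix.inv_eq_right_inv
  rw [← map_mul, Matrix.mul_nonsing_inv _ ((Matrix.isUnit_iff_isUnit_det _).1 hA), map_one]

theorem auxLax_map (f : Matrix I I ℂ →ₐ[ℂ] Matrix J J ℂ) (h k lam l : ℂ) {u w : Matrix I I ℂ}
    (hu : IsUnit u) (p q : Fin 2) :
    f (auxLax h k lam l u w p q) = auxLax h k lam l (f u) (f w) p q := by
  fin_cases p <;> fin_cases q <;> simp [auxLax, map_inv_of_isUnit f hu]

theorem lax_map (f : Matrix I I ℂ →ₐ[ℂ] Matrix J J ℂ) (h κ l : ℂ) (u w : Matrix I I ℂ)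
    (p q : Fin 2) : f (lax h κ l u w p q) = lax h κ l (f u) (f w) p q := by
  fin_cases p <;> fin_cases q <;> simp [lax]

theorem auxLax_eq_auxLaxInv {h k lam x : ℂ} {u ui w : Matrix I I ℂ} (hu : u * ui = 1) :
    auxLax h k lam x⁻¹ u w = auxLaxInv h k lam x u ui w := by
  rw [auxLax, auxLaxInv, Matrix.inv_eq_right_inv hu, div_inv_eq_mul, div_inv_eq_mul]

open Polynomial in
theorem laxPoly_evalAt (h κ x : ℂ) (u w : Matrix I I ℂ) :
    (laxPoly h κ u w).map (evalAt x) = lax h κ x⁻¹ u w := by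
  ext p q : 2
  fin_cases p <;> fin_cases q <;>
    simp [laxPoly, lax, evalAt_C, evalAt_mul_X, -map_mul, smul_smul, mul_comm]

end Lift

variable {N : ℕ} [NeZero N]

theorem weyl_mul_pow_pred {A : Matrix (ZMod N) (ZMod N) ℂ} (hA : A ^ N = 1) :
    A * A ^ (N - 1) = 1 := by
  rw [← pow_succ', Nat.sub_add_cancel (Nat.one_le_iff_ne_zero.2 (NeZero.ne N)), hA]

theorem weyl_pow_pred_mul {A : Matrix (ZMod N) (ZMod N) ℂ} (hA : A ^ N = 1) :
    A ^ (N - 1) * A = 1 := by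
  rw [← pow_succ, Nat.sub_add_cancel (Nat.one_le_iff_ne_zero.2 (NeZero.ne N)), hA]

section Site
variable {M : ℕ}

/-- `u_i = c x_i`. -/
def siteU (i : Fin M) (c : ℂ) : Op N M := c • atSite i (weylX N)

/-- `w_i = c z_i`. -/
def siteW (i : Fin M) (c : ℂ) : Op N M := c • atSite i (weylZ N)

/-- The inverse of `siteU i c`. -/
def siteUInv (i : Fin M) (c : ℂ) : Op N M := c⁻¹ • atSite i (weylX N ^ (N - 1))

/-- The inverse of `siteW i c`. -/
def siteWInv (i : Fin M) (c : ℂ) : Op N M := c⁻¹ • atSite i (weylZ N ^ (N - 1))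

theorem siteU_mul_inv (i : Fin M) {c : ℂ} (hc : c ≠ 0) :
    (siteU i c : Op N M) * siteUInv i c = 1 := by
  rw [siteU, siteUInv, smul_mul_smul_comm, mul_inv_cancel₀ hc, one_smul, ← atSiteHom_apply,
    ← atSiteHom_apply, ← map_mul, weyl_mul_pow_pred weylX_pow, map_one]

theorem siteUInv_mul (i : Fin M) {c : ℂ} (hc : c ≠ 0) :
    (siteUInv i c : Op N M) * siteU i c = 1 := by
  rw [siteU, siteUInv, smul_mul_smul_comm, inv_mul_cancel₀ hc, one_smul, ← atSiteHom_apply,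
    ← atSiteHom_apply, ← map_mul, weyl_pow_pred_mul weylX_pow, map_one]

theorem siteW_mul_inv (i : Fin M) {c : ℂ} (hc : c ≠ 0) :
    (siteW i c : Op N M) * siteWInv i c = 1 := by
  rw [siteW, siteWInv, smul_mul_smul_comm, mul_inv_cancel₀ hc, one_smul, ← atSiteHom_apply,
    ← atSiteHom_apply, ← map_mul, weyl_mul_pow_pred weylZ_pow, map_one]

theorem siteWInv_mul (i : Fin M) {c : ℂ} (hc : c ≠ 0) :
    (siteWInv i c : Op N M) * siteW i c = 1 := by
  rw [siteW, siteWInv, smul_mul_smul_comm, inv_mul_cancel₀ hc, one_smul, ← atSiteHom_apply,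
    ← atSiteHom_apply, ← map_mul, weyl_pow_pred_mul weylZ_pow, map_one]

theorem siteU_mul_siteW (i : Fin M) (c c' : ℂ) :
    (siteU i c : Op N M) * siteW i c' = omegaHalf N ^ 2 • (siteW i c' * siteU i c) := by
  rw [siteU, siteW, smul_mul_smul_comm, smul_mul_smul_comm, ← atSiteHom_apply, ← atSiteHom_apply,
    ← map_mul, ← map_mul, weylX_mul_weylZ, map_smul, omega_eq_sq, smul_smul, smul_smul]
  congr 1; ring

/-- The Lax matrix at site `i`. -/
def siteLax (κ l : ℂ) (u w : Fin M → ℂ) (i : Fin M) : Matrix (Fin 2) (Fin 2) (Op N M) :=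
  lax (omegaHalf N) κ l (siteU i (u i)) (siteW i (w i))

theorem siteLax_apply (κ l : ℂ) (u w : Fin M → ℂ) (i : Fin M) (p q : Fin 2) :
    siteLax (N := N) κ l u w i p q =
      atSite i (lax (omegaHalf N) κ l (u i • weylX N) (w i • weylZ N) p q) := by
  rw [← atSiteHom_apply, lax_map, map_smul, map_smul]
  rfl

theorem commute_siteLax {i k : Fin M} (hik : i ≠ k) (κ l : ℂ)
    (u w u' w' : Fin M → ℂ) (p q r s : Fin 2) :
    Commute (siteLax (N := N) κ l u w i p q) (siteLax κ l u' w' k r s) := by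
  rw [siteLax_apply, siteLax_apply]
  exact commute_atSite hik _ _

end Site

variable {N : ℕ} [NeZero N]

/-! ### The rotated monodromy matrix -/

theorem commute_entries_iff {O : Type*} [Ring O] (x : O) (A : Matrix (Fin 2) (Fin 2) O) :
    Commute (Matrix.scalar (Fin 2) x) A ↔ ∀ i j, Commute x (A i j) := by
  simp only [Commute, SemiconjBy, Matrix.scalar_apply, ← Matrix.ext_iff, Matrix.diagonal_mul,
    Matrix.mul_diagonal]

theorem commute_list_prod_entry {O : Type*} [Ring O] {n : ℕ} (x : O)
    (f : Fin n → Matrix (Fin 2) (Fin 2) O) (h : ∀ k i j, Commute x (f k i j)) (i j : Fin 2) :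
    Commute x ((List.ofFn f).prod i j) := by
  revert i j
  rw [← commute_entries_iff]
  apply Commute.list_prod_right
  intro y hy
  obtain ⟨k, rfl⟩ := (List.mem_ofFn' _ _).1 hy
  rw [commute_entries_iff]
  exact h k

/-- The monodromy matrix of the chain, cyclically rotated so that the last site comes first,
is `siteLax (last) * bulkLax`. -/
def bulkLax {m : ℕ} (κ l : ℂ) (u w : Fin (m + 1) → ℂ) : Matrix (Fin 2) (Fin 2) (Op N (m + 1)) :=
  (List.ofFn fun i : Fin m => siteLax κ l u w i.castSucc).prod

/-- The rotated monodromy matrix as a polynomial in `x = 1 / l`. -/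
def rotMono {m : ℕ} (κ : ℂ) (u w : Fin (m + 1) → ℂ) :
    Matrix (Fin 2) (Fin 2) (Polynomial (Op N (m + 1))) :=
  laxPoly (omegaHalf N) κ (siteU (Fin.last m) (u (Fin.last m)))
      (siteW (Fin.last m) (w (Fin.last m))) *
    (List.ofFn fun i : Fin m => laxPoly (omegaHalf N) κ (siteU i.castSucc (u i.castSucc))
      (siteW i.castSucc (w i.castSucc))).prod

theorem rotMono_evalAt {m : ℕ} (κ x : ℂ) (u w : Fin (m + 1) → ℂ) :
    (rotMono (N := N) κ u w).map (evalAt x) =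
      siteLax κ x⁻¹ u w (Fin.last m) * bulkLax κ x⁻¹ u w := by
  rw [rotMono, bulkLax, Matrix.map_mul, laxPoly_evalAt]
  congr 1
  change (evalAt x : Polynomial (Op N (m + 1)) →+* _).mapMatrix _ = _
  rw [map_list_prod, List.map_ofFn]
  congr 2
  funext i
  exact laxPoly_evalAt _ _ _ _ _

/-- The trace over the auxiliary space with an insertion `p` between the last two sites. -/
def insertedQ {m : ℕ} (R : Fin (m + 1) → Matrix (ZMod N × ZMod N) (ZMod N × ZMod N) ℂ) :
    Matrix (ZMod N) (ZMod N) ℂ →ₗ[ℂ] Op N (m + 1) where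
  toFun p := auxTrace ((List.ofFn fun i : Fin m => atSiteAux i.castSucc (R i.castSucc)).prod *
    auxOp p * atSiteAux (Fin.last m) (R (Fin.last m)))
  map_add' p q := by rw [map_add, mul_add, add_mul, auxTrace_add]
  map_smul' c p := by rw [map_smul, mul_smul_comm, smul_mul_assoc, auxTrace_smul]; rfl

theorem insertedQ_one {m : ℕ} (R : Fin (m + 1) → Matrix (ZMod N × ZMod N) (ZMod N × ZMod N) ℂ) :
    insertedQ R 1 = auxTrace (List.ofFn fun i => atSiteAux i (R i)).prod := by
  change auxTrace _ = _
  rw [map_one, mul_one, prod_ofFn_succ_last]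

/-- The classical relation forces the non-vanishing of `1 + κ_φ^N W_φ`, which makes the upper right
entry of the auxiliary Lax matrix invertible. -/
theorem exists_right_inverse {κ k lam ul wl uφ wφ u' w' uφ' wφ' : ℂ}
    (hlam : lam ≠ 0) (hu : ul ≠ 0) (hw' : w' ≠ 0)
    (huφ : uφ ≠ 0) (hwφ : wφ ≠ 0) (huφ' : uφ' ≠ 0)
    (hC : ClassicalDarboux (κ ^ N) (k ^ N) (lam ^ N) (ul ^ N) (wl ^ N) (uφ ^ N) (wφ ^ N)
      (u' ^ N) (w' ^ N) (uφ' ^ N) (wφ' ^ N)) :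
    ∃ y : Matrix (ZMod N × ZMod N) (ZMod N × ZMod N) ℂ,
      (w' • (weylZ N ⊗ₖ (1 : Matrix (ZMod N) (ZMod N) ℂ))) *
        ((1 - (omegaHalf N * k) • (wφ' • ((1 : Matrix (ZMod N) (ZMod N) ℂ) ⊗ₖ weylZ N))) *
          (uφ' • ((1 : Matrix (ZMod N) (ZMod N) ℂ) ⊗ₖ weylX N))) * y = 1 := by
  have h11 := congrFun (congrFun (hC 1 one_ne_zero) 1) 1
  simp only [classAuxLax, classLax, Matrix.mul_apply, Fin.sum_univ_two, Matrix.of_apply,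
    Matrix.cons_val', Matrix.cons_val_zero, Matrix.cons_val_one, Matrix.cons_val_fin_one, div_one,
    mul_zero, zero_mul, add_zero] at h11
  have hne : 1 + k ^ N * wφ' ^ N ≠ 0 := by
    intro h0
    rw [h0, mul_zero, mul_zero] at h11
    have : lam ^ N * wφ ^ N / uφ ^ N * ul ^ N ≠ 0 := by positivity
    exact this h11
  set a : Matrix (ZMod N × ZMod N) (ZMod N × ZMod N) ℂ :=
    (omegaHalf N * k) • (wφ' • kronRight (ZMod N) (ZMod N) (weylZ N)) with ha
  have haN : a ^ N = (-(k ^ N * wφ' ^ N)) • 1 := by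
    rw [ha, smul_pow, smul_pow, ← map_pow, weylZ_pow, map_one, mul_pow, omegaHalf_pow, smul_smul]
    congr 1; ring
  set g := ∑ i ∈ Finset.range N, a ^ i
  have hg : (1 - a) * g = (1 + k ^ N * wφ' ^ N) • 1 := by
    rw [mul_neg_geom_sum, haN]; module
  refine ⟨(uφ'⁻¹ • kronRight (ZMod N) (ZMod N) (weylX N ^ (N - 1))) *
    ((1 + k ^ N * wφ' ^ N)⁻¹ • g) * (w'⁻¹ • kronLeft (ZMod N) (ZMod N) (weylZ N ^ (N - 1))), ?_⟩
  change (w' • kronLeft (ZMod N) (ZMod N) (weylZ N)) * ((1 - a) *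
    (uφ' • kronRight (ZMod N) (ZMod N) (weylX N))) * _ = 1
  have e1 : (uφ' • kronRight (ZMod N) (ZMod N) (weylX N)) *
      (uφ'⁻¹ • kronRight (ZMod N) (ZMod N) (weylX N ^ (N - 1))) = 1 := by
    rw [smul_mul_smul_comm, ← map_mul, weyl_mul_pow_pred weylX_pow, map_one, mul_inv_cancel₀ huφ',
      one_smul]
  have e2 : (w' • kronLeft (ZMod N) (ZMod N) (weylZ N)) *
      (w'⁻¹ • kronLeft (ZMod N) (ZMod N) (weylZ N ^ (N - 1))) = 1 := by
    rw [smul_mul_smul_comm, ← map_mul, weyl_mul_pow_pred weylZ_pow, map_one, mul_inv_cancel₀ hw',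
      one_smul]
  have e3 : (1 - a) * ((1 + k ^ N * wφ' ^ N)⁻¹ • g) = 1 := by
    rw [mul_smul_comm, hg, smul_smul, inv_mul_cancel₀ hne, one_smul]
  generalize (uφ' • kronRight (ZMod N) (ZMod N) (weylX N)) = U at *
  generalize (uφ'⁻¹ • kronRight (ZMod N) (ZMod N) (weylX N ^ (N - 1))) = Ui at *
  generalize (w' • kronLeft (ZMod N) (ZMod N) (weylZ N)) = W at *
  generalize (w'⁻¹ • kronLeft (ZMod N) (ZMod N) (weylZ N ^ (N - 1))) = Wi at *
  generalize ((1 + k ^ N * wφ' ^ N)⁻¹ • g) = G at *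
  calc W * ((1 - a) * U) * (Ui * G * Wi) = W * ((1 - a) * (U * Ui) * G) * Wi := by
        simp only [mul_assoc]
    _ = 1 := by rw [e1, mul_one, e3, mul_one, e2]

theorem isUnit_smul_of_mul {I : Type} [Fintype I] [DecidableEq I] {c : ℂ} (hc : c ≠ 0)
    {A B : Matrix I I ℂ} (h : A * B = 1) : IsUnit (c • A) := by
  rw [Matrix.isUnit_iff_isUnit_det]
  apply Matrix.isUnit_det_of_right_inverse (B := c⁻¹ • B)
  rw [smul_mul_smul_comm, h, mul_inv_cancel₀ hc, one_smul]

section Big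
variable {M : ℕ} (κ k lam : ℂ) (u w u' w' : Fin M → ℂ) (uφ wφ : ℕ → ℂ)
  (R : Fin M → Matrix (ZMod N × ZMod N) (ZMod N × ZMod N) ℂ)

/-- The auxiliary Lax matrix at the link `a`, on the auxiliary space alone. -/
def linkLax (k lam l : ℂ) (uφ wφ : ℕ → ℂ) (a : ℕ) :
    Matrix (Fin 2) (Fin 2) (Matrix (ZMod N) (ZMod N) ℂ) :=
  auxLax (omegaHalf N) k lam l (uφ a • weylX N) (wφ a • weylZ N)

variable {κ k lam u w u' w' uφ wφ R}

/-- The local quantum Darboux relation, as a relation between operators on (chain) ⊗ (auxiliary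
space). -/
theorem darboux_big (huφ : ∀ a, uφ a ≠ 0)
    (hR : ∀ i : Fin M, QuantumDarboux N κ k lam (u i) (w i) (uφ i.val) (wφ i.val)
        (u' i) (w' i) (uφ (i.val + 1)) (wφ (i.val + 1)) (R i)) {l : ℂ} (hl : l ≠ 0) (i : Fin M) :
    (linkLax k lam l uφ wφ i.val).map (auxOp (N := N) (M := M)) * (siteLax κ l u w i).map chainOp *
        Matrix.scalar (Fin 2) (atSiteAux i (R i)) =
      Matrix.scalar (Fin 2) (atSiteAux i (R i)) * (siteLax κ l u' w' i).map chainOp *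
        (linkLax k lam l uφ wφ (i.val + 1)).map auxOp := by
  have hmap : ∀ a p q, siteHom i (auxLax (omegaHalf N) k lam l
        (uφ a • ((1 : Matrix (ZMod N) (ZMod N) ℂ) ⊗ₖ weylX N))
        (wφ a • ((1 : Matrix (ZMod N) (ZMod N) ℂ) ⊗ₖ weylZ N)) p q) =
      auxOp (N := N) (M := M) (linkLax k lam l uφ wφ a p q) := by
    intro a p q
    have hX := weyl_mul_pow_pred (weylX_pow (N := N))
    have hX' : ((1 : Matrix (ZMod N) (ZMod N) ℂ) ⊗ₖ weylX N) *
        ((1 : Matrix (ZMod N) (ZMod N) ℂ) ⊗ₖ (weylX N ^ (N - 1))) = 1 := by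
      rw [← Matrix.mul_kronecker_mul, hX, one_mul, Matrix.one_kronecker_one]
    rw [auxLax_map _ _ _ _ _ (isUnit_smul_of_mul (huφ a) hX'), linkLax,
      auxLax_map _ _ _ _ _ (isUnit_smul_of_mul (huφ a) hX), map_smul, map_smul, map_smul, map_smul,
      siteHom_kronRight, siteHom_kronRight]
  have hmap' : ∀ (u w : Fin M → ℂ) p q, siteHom i (lax (omegaHalf N) κ l
        (u i • (weylX N ⊗ₖ (1 : Matrix (ZMod N) (ZMod N) ℂ)))
        (w i • (weylZ N ⊗ₖ (1 : Matrix (ZMod N) (ZMod N) ℂ))) p q) =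
      chainOp (siteLax κ l u w i p q) := by
    intro u w p q
    rw [lax_map, siteLax, lax_map, map_smul, map_smul, siteHom_kronLeft, siteHom_kronLeft, siteU,
      siteW, map_smul, map_smul]
  refine Matrix.ext fun p q => ?_
  have H := congrArg (siteHom i) (hR i l hl p q)
  rw [map_mul, map_mul, siteHom_apply i (R i), Matrix.mul_apply, Matrix.mul_apply, map_sum, map_sum]
    at H
  simp only [map_mul, hmap, hmap'] at H
  rw [Matrix.scalar_apply, Matrix.mul_diagonal, mul_assoc, Matrix.diagonal_mul, Matrix.mul_apply,
    Matrix.mul_apply]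
  exact H

end Big

variable {N : ℕ} [NeZero N]

/-! ### One application of a modified Q-operator -/

theorem exchangeLPoly_evalAt {I : Type} [Fintype I] [DecidableEq I] (h k lam ct x : ℂ)
    (π : Matrix I I ℂ) (q : ℕ → Matrix I I ℂ) (e : ℕ) (i r : Fin 2) :
    evalAt x (exchangeLPoly h h⁻¹ k lam ct π q e i r) = exchangeL h k lam ct x π q e i r := by
  fin_cases i <;> fin_cases r
  · simp only [exchangeLPoly, exchangeL, Fin.zero_eta, Matrix.of_apply, Matrix.cons_val',
      Matrix.cons_val_zero, Matrix.cons_val_fin_one, map_sub, evalAt_C, evalAt_mul_X, smul_smul]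
    congr 2; ring
  · simp only [exchangeLPoly, exchangeL, Fin.zero_eta, Fin.mk_one, Matrix.of_apply,
      Matrix.cons_val', Matrix.cons_val_zero, Matrix.cons_val_one, Matrix.cons_val_fin_one, map_neg,
      evalAt_C, evalAt_mul_X, smul_smul]
    congr 2; ring
  · simp only [exchangeLPoly, exchangeL, Fin.zero_eta, Fin.mk_one, Matrix.of_apply,
      Matrix.cons_val', Matrix.cons_val_zero, Matrix.cons_val_one, Matrix.cons_val_fin_one, map_neg,
      evalAt_C, div_eq_mul_inv]
  · simp only [exchangeLPoly, exchangeL, Fin.mk_one, Matrix.of_apply,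
      Matrix.cons_val', Matrix.cons_val_one, Matrix.cons_val_fin_one, evalAt_C]

/-- The first letter of the auxiliary space at a link. -/
def linkU (N : ℕ) [NeZero N] (a : ℂ) : Matrix (ZMod N) (ZMod N) ℂ := a • weylX N

/-- The second letter of the auxiliary space at a link. -/
def linkW (N : ℕ) [NeZero N] (a : ℂ) : Matrix (ZMod N) (ZMod N) ℂ := a • weylZ N

/-- The inverse of `linkU N a`. -/
def linkUInv (N : ℕ) [NeZero N] (a : ℂ) : Matrix (ZMod N) (ZMod N) ℂ := a⁻¹ • weylX N ^ (N - 1)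

/-- The inverse of `linkW N a`. -/
def linkWInv (N : ℕ) [NeZero N] (a : ℂ) : Matrix (ZMod N) (ZMod N) ℂ := a⁻¹ • weylZ N ^ (N - 1)

theorem linkU_mul_inv {a : ℂ} (ha : a ≠ 0) : linkU N a * linkUInv N a = 1 := by
  rw [linkU, linkUInv, smul_mul_smul_comm, weyl_mul_pow_pred weylX_pow, mul_inv_cancel₀ ha,
    one_smul]

theorem linkUInv_mul {a : ℂ} (ha : a ≠ 0) : linkUInv N a * linkU N a = 1 := by
  rw [linkU, linkUInv, smul_mul_smul_comm, weyl_pow_pred_mul weylX_pow, inv_mul_cancel₀ ha,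
    one_smul]

theorem linkW_mul_inv {a : ℂ} (ha : a ≠ 0) : linkW N a * linkWInv N a = 1 := by
  rw [linkW, linkWInv, smul_mul_smul_comm, weyl_mul_pow_pred weylZ_pow, mul_inv_cancel₀ ha,
    one_smul]

theorem linkWInv_mul {a : ℂ} (ha : a ≠ 0) : linkWInv N a * linkW N a = 1 := by
  rw [linkW, linkWInv, smul_mul_smul_comm, weyl_pow_pred_mul weylZ_pow, inv_mul_cancel₀ ha,
    one_smul]

theorem linkU_mul_linkW (a b : ℂ) :
    linkU N a * linkW N b = omegaHalf N ^ 2 • (linkW N b * linkU N a) := by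
  rw [linkU, linkW, smul_mul_smul_comm, smul_mul_smul_comm, weylX_mul_weylZ, omega_eq_sq, smul_smul,
    smul_smul]
  congr 1; ring

theorem isUnit_smul_one_kronecker {a : ℂ} (ha : a ≠ 0) :
    IsUnit (a • ((1 : Matrix (ZMod N) (ZMod N) ℂ) ⊗ₖ weylX N)) :=
  isUnit_smul_of_mul ha (B := (1 : Matrix (ZMod N) (ZMod N) ℂ) ⊗ₖ (weylX N ^ (N - 1))) (by
    rw [← Matrix.mul_kronecker_mul, weyl_mul_pow_pred weylX_pow, one_mul,
      Matrix.one_kronecker_one])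

/-- The exchange relation for the auxiliary `w`, with the scalars of the link spelled out. -/
theorem intertwiner_mul_linkWInv {κ k lam ul wl a₀ b₀ ul' wl' a b : ℂ}
    {R : Matrix (ZMod N × ZMod N) (ZMod N × ZMod N) ℂ} (hκ : κ ≠ 0) (hlam : lam ≠ 0)
    (hwl : wl ≠ 0) (hwl' : wl' ≠ 0) (ha₀ : a₀ ≠ 0) (ha : a ≠ 0) (hb : b ≠ 0)
    (H : QuantumDarboux N κ k lam ul wl a₀ b₀ ul' wl' a b R) :
    R * kronRight (ZMod N) (ZMod N) (linkWInv N b) = (omegaHalf N * k) • R +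
      (-(omegaHalf N * lam * k / κ)) • (kronLeft (ZMod N) (ZMod N) (wl⁻¹ • weylZ N ^ (N - 1)) * R *
        kronRight (ZMod N) (ZMod N) (linkUInv N a)) := by
  have hub : a • ((1 : Matrix (ZMod N) (ZMod N) ℂ) ⊗ₖ weylX N) =
    kronRight (ZMod N) (ZMod N) (linkU N a) := by rw [linkU, map_smul, kronRight_apply]
  have hwb : b • ((1 : Matrix (ZMod N) (ZMod N) ℂ) ⊗ₖ weylZ N) =
    kronRight (ZMod N) (ZMod N) (linkW N b) := by rw [linkW, map_smul, kronRight_apply]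
  have hk : ∀ (c : ℂ) (A : Matrix (ZMod N) (ZMod N) ℂ),
      c • (A ⊗ₖ (1 : Matrix (ZMod N) (ZMod N) ℂ)) = kronLeft (ZMod N) (ZMod N) (c • A) :=
    fun c A => by rw [map_smul, kronLeft_apply]
  have hk' : ∀ (c : ℂ) (A : Matrix (ZMod N) (ZMod N) ℂ),
      c • ((1 : Matrix (ZMod N) (ZMod N) ℂ) ⊗ₖ A) = kronRight (ZMod N) (ZMod N) (c • A) :=
    fun c A => by rw [map_smul, kronRight_apply]
  have hua := isUnit_smul_one_kronecker (N := N) ha₀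
  unfold QuantumDarboux at H
  rw [hub, hwb] at H
  simp only [hk, hk'] at H hua
  refine intertwiner_mul_aux_w_inv (omegaHalf_ne_zero N) hlam hκ H ?_ ?_ hua
    (commute_kronLeft_kronRight _ _) (commute_kronLeft_kronRight _ _)
    (commute_kronLeft_kronRight _ _) (commute_kronLeft_kronRight _ _)
    (wi' := kronLeft (ZMod N) (ZMod N) (wl'⁻¹ • weylZ N ^ (N - 1))) ?_ ?_ ?_ ?_ ?_
  · rw [← map_mul, ← map_mul, ← map_smul]
    congr 1
    rw [smul_mul_smul_comm, smul_mul_smul_comm, weylX_mul_weylZ, omega_eq_sq, smul_smul, smul_smul]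
    congr 1; ring
  · rw [← map_mul, ← map_mul, ← map_smul, linkU_mul_linkW]
  · rw [← map_mul, smul_mul_smul_comm, weyl_pow_pred_mul weylZ_pow, inv_mul_cancel₀ hwl, one_smul,
      map_one]
  · rw [← map_mul, smul_mul_smul_comm, weyl_mul_pow_pred weylZ_pow, mul_inv_cancel₀ hwl', one_smul,
      map_one]
  · rw [← map_mul, linkU_mul_inv ha, map_one]
  · rw [← map_mul, linkUInv_mul ha, map_one]
  · rw [← map_mul, linkW_mul_inv hb, map_one]

section Inserted
variable {m : ℕ} {κ k lam : ℂ} {u w u' w' : Fin (m + 2) → ℂ} {uφ wφ : ℕ → ℂ}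
  {R : Fin (m + 2) → Matrix (ZMod N × ZMod N) (ZMod N × ZMod N) ℂ}

/-- The auxiliary `u⁻¹` passes through the last `R` and becomes the last `u⁻¹` of the new state. -/
theorem insertedQ_mul_linkUInv (hκ : κ ≠ 0) (hlam : lam ≠ 0) (hu : ∀ i, u i ≠ 0)
    (hu' : ∀ i, u' i ≠ 0) (hw' : ∀ i, w' i ≠ 0) (hne : ∀ a, uφ a ≠ 0 ∧ wφ a ≠ 0)
    (hC : ∀ i : Fin (m + 2), ClassicalDarboux (κ ^ N) (k ^ N) (lam ^ N)
      (u i ^ N) (w i ^ N) (uφ i.val ^ N) (wφ i.val ^ N)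
      (u' i ^ N) (w' i ^ N) (uφ (i.val + 1) ^ N) (wφ (i.val + 1) ^ N))
    (hR : ∀ i : Fin (m + 2), QuantumDarboux N κ k lam (u i) (w i) (uφ i.val) (wφ i.val)
        (u' i) (w' i) (uφ (i.val + 1)) (wφ (i.val + 1)) (R i)) (p : Matrix (ZMod N) (ZMod N) ℂ) :
    insertedQ R (p * linkUInv N (uφ (m + 1))) =
      (k / κ) • (insertedQ R p * siteUInv (Fin.last _) (u' (Fin.last _))) := by
  obtain ⟨y, hy⟩ := exists_right_inverse hlam (hu _) (hw' _) (hne _).1 (hne _).2 (hne _).1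
    (hC (Fin.last _))
  have e := aux_u_mul_intertwiner (omegaHalf_ne_zero N) hlam (hR (Fin.last _))
    (isUnit_smul_one_kronecker (hne _).1) hy
  have e' := congrArg (siteHom (M := m + 2) (Fin.last _)) e
  rw [map_smul, map_smul, map_mul, map_mul, map_smul, map_smul, siteHom_kronRight,
    siteHom_kronLeft, siteHom_apply] at e'
  simp only [Fin.val_last] at e'
  have hcu : chainOp (siteU (Fin.last _) (u' (Fin.last _)) : Op N (m + 2)) =
    u' (Fin.last (m + 1)) • chainOp (atSite (Fin.last (m + 1)) (weylX N)) := map_smul _ _ _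
  have hau : auxOp (M := m + 2) (linkU N (uφ (m + 1))) = uφ (m + 1) • auxOp (weylX N) :=
    map_smul _ _ _
  rw [← hcu, ← hau] at e'
  have hUU := linkUInv_mul (N := N) (hne (m + 1)).1
  generalize linkU N (uφ (m + 1)) = U at *
  generalize linkUInv N (uφ (m + 1)) = Ui at *
  have hVV := siteU_mul_inv (N := N) (Fin.last (m + 1)) (hu' (Fin.last _))
  generalize (siteUInv (Fin.last _) (u' (Fin.last _)) : Op N (m + 2)) = V at *
  generalize (siteU (Fin.last _) (u' (Fin.last _)) : Op N (m + 2)) = v at *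
  change auxTrace _ = _ • (auxTrace _ * _)
  generalize (atSiteAux (Fin.last _) (R (Fin.last _)) : BigOp N (m + 2)) = Rl at *
  have e2 : auxOp Ui * Rl = (k / κ) • (Rl * chainOp V) := by
    have := congrArg (fun t => auxOp Ui * t * chainOp V) e'
    have l1 : auxOp Ui * (k • (auxOp U * Rl)) * chainOp V = k • (Rl * chainOp V) := by
      rw [mul_smul_comm, ← mul_assoc, ← map_mul, hUU, map_one, one_mul, smul_mul_assoc]
    have l2 : auxOp Ui * (κ • (Rl * chainOp v)) * chainOp V = κ • (auxOp Ui * Rl) := by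
      rw [mul_smul_comm, smul_mul_assoc, mul_assoc, mul_assoc, ← map_mul, hVV, map_one, mul_one]
    simp only [l1, l2] at this
    rw [div_eq_inv_mul, mul_smul, this, smul_smul, inv_mul_cancel₀ hκ, one_smul]
  rw [← auxTrace_mul_chainOp, ← auxTrace_smul, map_mul]
  congr 1
  rw [← mul_assoc, mul_assoc _ (auxOp Ui), e2, mul_smul_comm, mul_assoc _ Rl]

theorem exchange_aux {B : Type*} [Ring B] [Algebra ℂ B] {RR Ri Rl Wi p Ui V : B} {a c : ℂ}
    (e : Ri * Wi = a • Ri + c • (V * Ri * Ui)) (hc : Commute RR V) :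
    RR * Ri * (Wi * p) * Rl = a • (RR * Ri * p * Rl) + c • (V * (RR * Ri * (Ui * p) * Rl)) := by
  calc RR * Ri * (Wi * p) * Rl = RR * (Ri * Wi) * p * Rl := by simp only [mul_assoc]
    _ = a • (RR * Ri * p * Rl) + c • ((RR * V) * Ri * (Ui * p) * Rl) := by
        rw [e]
        simp only [mul_add, add_mul, mul_smul_comm, smul_mul_assoc, mul_assoc]
    _ = _ := by rw [hc.eq]; simp only [mul_assoc]

/-- The auxiliary `w⁻¹` passes through the last but one `R`. -/
theorem insertedQ_linkWInv_mul (hκ : κ ≠ 0) (hlam : lam ≠ 0) (hw : ∀ i, w i ≠ 0)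
    (hw' : ∀ i, w' i ≠ 0) (hne : ∀ a, uφ a ≠ 0 ∧ wφ a ≠ 0)
    (hR : ∀ i : Fin (m + 2), QuantumDarboux N κ k lam (u i) (w i) (uφ i.val) (wφ i.val)
        (u' i) (w' i) (uφ (i.val + 1)) (wφ (i.val + 1)) (R i)) (p : Matrix (ZMod N) (ZMod N) ℂ) :
    insertedQ R (linkWInv N (wφ (m + 1)) * p) = (omegaHalf N * k) • insertedQ R p +
      (-(omegaHalf N * lam * k / κ)) • (siteWInv (Fin.last m).castSucc (w (Fin.last m).castSucc) *
        insertedQ R (linkUInv N (uφ (m + 1)) * p)) := by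
  set i : Fin (m + 2) := (Fin.last m).castSucc with hi
  have hRi := hR i
  rw [show i.val + 1 = m + 1 by simp [hi]] at hRi
  have e' := congrArg (siteHom (M := m + 2) i)
    (intertwiner_mul_linkWInv hκ hlam (hw i) (hw' i) (hne _).1 (hne _).1 (hne _).2 hRi)
  rw [map_add, map_smul (siteHom i) (omegaHalf N * k), map_smul (siteHom i) (-_), map_mul, map_mul,
    map_mul, kronRight_apply, kronRight_apply, kronLeft_apply, siteHom_kronRight,
    siteHom_kronRight, siteHom_kronLeft, siteHom_apply] at e'
  have hpi : (atSite i ((w i)⁻¹ • weylZ N ^ (N - 1)) : Op N (m + 2)) = siteWInv i (w i) := by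
    rw [← atSiteHom_apply, map_smul]; rfl
  rw [hpi] at e'
  have hij : ∀ j : Fin m, j.castSucc.castSucc ≠ i := fun j hji =>
    (Fin.castSucc_lt_last j).ne (Fin.castSucc_injective _ hji)
  have hcomm : Commute (List.ofFn fun j : Fin m => (atSiteAux j.castSucc.castSucc
      (R j.castSucc.castSucc) : BigOp N (m + 2))).prod (chainOp (siteWInv i (w i))) := by
    apply Commute.list_prod_left
    intro x hx
    obtain ⟨j, rfl⟩ := (List.mem_ofFn' _ _).1 hx
    rw [← hpi]
    exact commute_atSiteAux_chainOp (hij j) _ _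
  have key := exchange_aux (RR := (List.ofFn fun j : Fin m => (atSiteAux j.castSucc.castSucc
      (R j.castSucc.castSucc) : BigOp N (m + 2))).prod) (p := auxOp p)
      (Rl := (atSiteAux (Fin.last _) (R (Fin.last _)) : BigOp N (m + 2))) e' hcomm
  rw [← map_mul, ← map_mul] at key
  have key2 := congrArg auxTrace key
  rw [auxTrace_add, auxTrace_smul, auxTrace_smul, auxTrace_chainOp_mul] at key2
  have hI : ∀ p, insertedQ R p = auxTrace ((List.ofFn fun j : Fin m =>
      (atSiteAux j.castSucc.castSucc (R j.castSucc.castSucc) : BigOp N (m + 2))).prod *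
      atSiteAux i (R i) * auxOp p * atSiteAux (Fin.last _) (R (Fin.last _))) := by
    intro p
    change auxTrace _ = _
    rw [prod_ofFn_succ_last]
  rw [hI, hI, hI]
  exact key2

/-- The inserted operator exchanges the two monodromy matrices. -/
theorem insertedQ_monodromy (hne : ∀ a, uφ a ≠ 0 ∧ wφ a ≠ 0)
    (hper1 : uφ (m + 2) = uφ 0) (hper2 : wφ (m + 2) = wφ 0)
    (hR : ∀ i : Fin (m + 2), QuantumDarboux N κ k lam (u i) (w i) (uφ i.val) (wφ i.val)
        (u' i) (w' i) (uφ (i.val + 1)) (wφ (i.val + 1)) (R i)) {x : ℂ} (hx : x ≠ 0)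
    (p : Matrix (ZMod N) (ZMod N) ℂ) (i j : Fin 2) :
    ∑ r, (rotMono (N := N) κ u w).map (evalAt (O := Op N (m + 2)) x) r j *
        insertedQ R (p * auxLaxInv (omegaHalf N) k lam x (linkU N (uφ (m + 1)))
          (linkUInv N (uφ (m + 1))) (linkW N (wφ (m + 1))) i r) =
      ∑ r, insertedQ R (auxLaxInv (omegaHalf N) k lam x (linkU N (uφ (m + 1)))
          (linkUInv N (uφ (m + 1))) (linkW N (wφ (m + 1))) r j * p) *
        (rotMono (N := N) κ u' w').map (evalAt (O := Op N (m + 2)) x) i r := by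
  rw [rotMono_evalAt, rotMono_evalAt]
  have hl : x⁻¹ ≠ 0 := inv_ne_zero hx
  have hT : linkLax k lam x⁻¹ uφ wφ (m + 1) = auxLaxInv (omegaHalf N) k lam x (linkU N (uφ (m + 1)))
      (linkUInv N (uφ (m + 1))) (linkW N (wφ (m + 1))) :=
    auxLax_eq_auxLaxInv (linkU_mul_inv (hne _).1)
  have hbig := darboux_big (M := m + 2) (κ := κ) (fun a => (hne a).1) hR hl
  have hT0 : linkLax k lam x⁻¹ uφ wφ (m + 2) = linkLax (N := N) k lam x⁻¹ uφ wφ 0 := by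
    rw [linkLax, linkLax, hper1, hper2]
  have hsL : ∀ (i k : Fin (m + 2)) (u w : Fin (m + 2) → ℂ) (p q : Fin 2), i ≠ k →
      Commute (atSiteAux i (R i)) (chainOp (siteLax κ x⁻¹ u w k p q)) := by
    intro i k u w p q hik
    rw [siteLax_apply]
    exact commute_atSiteAux_chainOp hik _ _
  have hchprod : ∀ (u w : Fin (m + 2) → ℂ), (bulkLax (N := N) κ x⁻¹ u w).map chainOp =
      (List.ofFn fun i : Fin (m + 1) => (siteLax κ x⁻¹ u w i.castSucc).map chainOp).prod := by
    intro u w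
    change (chainOp : Op N (m + 2) →ₐ[ℂ] _).toRingHom.mapMatrix _ = _
    rw [bulkLax, map_list_prod, List.map_ofFn]
    rfl
  have := trace_darboux (chainOp (N := N) (M := m + 2)).toRingHom
    (auxOp (N := N) (M := m + 2)).toRingHom
    ⟨⟨auxTrace, by ext; simp [auxTrace]⟩, auxTrace_add⟩
    auxTrace_chainOp_mul auxTrace_mul_chainOp auxTrace_auxOp_mul
    (fun _ _ => commute_kronLeft_kronRight _ _)
    (E := siteLax κ x⁻¹ u w (Fin.last _)) (N := bulkLax κ x⁻¹ u w)
    (E' := siteLax κ x⁻¹ u' w' (Fin.last _)) (N' := bulkLax κ x⁻¹ u' w')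
    (T := linkLax k lam x⁻¹ uφ wφ (m + 1)) (T0 := linkLax k lam x⁻¹ uφ wφ 0)
    (RR := (List.ofFn fun i : Fin (m + 1) => atSiteAux i.castSucc (R i.castSucc)).prod)
    (Rl := atSiteAux (Fin.last _) (R (Fin.last _)))
    (fun _ _ k l => commute_list_prod_entry _ _
      (fun _ _ _ => commute_siteLax (Fin.castSucc_lt_last _).ne' _ _ _ _ _ _ _ _ _ _) k l)
    (fun _ _ k l => commute_list_prod_entry _ _
      (fun _ _ _ => commute_siteLax (Fin.castSucc_lt_last _).ne' _ _ _ _ _ _ _ _ _ _) k l)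
    (fun i j => by
      apply Commute.list_prod_right
      intro y hy
      obtain ⟨a, rfl⟩ := (List.mem_ofFn' _ _).1 hy
      exact (hsL _ _ _ _ _ _ (Fin.castSucc_lt_last a).ne).symm)
    (fun i j => by
      have : Commute (atSiteAux (Fin.last _) (R (Fin.last _)))
          ((bulkLax (N := N) κ x⁻¹ u' w').map chainOp i j) := by
        rw [hchprod]
        exact commute_list_prod_entry _ _
          (fun a p q => hsL _ _ _ _ _ _ (Fin.castSucc_lt_last a).ne') i j
      exact this.symm)
    (by
      have := hbig (Fin.last _)
      rw [Fin.val_last, hT0] at this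
      exact this)
    (by
      have hd := darboux_prod
        (fun a => (linkLax k lam x⁻¹ uφ wφ a).map (auxOp (N := N) (M := m + 2)))
        (fun i : Fin (m + 1) => (siteLax κ x⁻¹ u w i.castSucc).map chainOp)
        (fun i : Fin (m + 1) => (siteLax κ x⁻¹ u' w' i.castSucc).map chainOp)
        (fun i : Fin (m + 1) => Matrix.scalar (Fin 2) (atSiteAux i.castSucc (R i.castSucc)))
        (fun i => hbig i.castSucc)
        (fun i j hij => (commute_entries_iff _ _).2 fun p q =>
          hsL _ _ _ _ _ _ (fun hc => hij (Fin.castSucc_injective _ hc)))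
        (fun i j hij => (commute_entries_iff _ _).2 fun p q =>
          hsL _ _ _ _ _ _ (fun hc => hij (Fin.castSucc_injective _ hc)))
      rw [← hchprod, ← hchprod] at hd
      have hs : (List.ofFn fun i : Fin (m + 1) =>
          Matrix.scalar (Fin 2) (atSiteAux i.castSucc (R i.castSucc) : BigOp N (m + 2))).prod =
          Matrix.scalar (Fin 2) (List.ofFn fun i : Fin (m + 1) =>
            (atSiteAux i.castSucc (R i.castSucc) : BigOp N (m + 2))).prod := by
        rw [map_list_prod, List.map_ofFn]; rfl
      rw [hs] at hd
      exact hd) p i j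
  rw [hT] at this
  exact this

end Inserted

/-- One application of a modified Q-operator: insertions of powers of the auxiliary `u⁻¹` are
expressed through `Q` and the last `u` of the new state, and they exchange the monodromy matrices
of the two states. -/
theorem modifiedQ_stepRel {m : ℕ} {κ : ℂ} (hκ : κ ≠ 0) {φ : ℝ} {lam : ℂ}
    (hlam : lam ≠ 0) {u w u' w' : Fin (m + 2) → ℂ} (hu : ∀ i, u i ≠ 0) (hw : ∀ i, w i ≠ 0)
    (hu' : ∀ i, u' i ≠ 0) (hw' : ∀ i, w' i ≠ 0) {Q : Op N (m + 2)}
    (hQ : IsModifiedQ N (m + 2) κ φ lam u w u' w' Q) :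
    ∃ k : ℂ, k ^ N = κ ^ N / Delta (κ ^ N) φ ∧ ∃ q : ℕ → Op N (m + 2), q 0 = Q ∧
      (∀ e, q (e + 1) = (k / κ) • (q e * siteUInv (Fin.last _) (u' (Fin.last _)))) ∧
      StepRel (omegaHalf N) (omegaHalf N)⁻¹ k lam (-(omegaHalf N * lam * k / κ))
        (siteWInv (Fin.last m).castSucc (w (Fin.last m).castSucc)) q
        (rotMono κ u w) (rotMono κ u' w') := by
  obtain ⟨k, uφ, wφ, R, hk, hne, ⟨hper1, hper2⟩, hC, hR, rfl⟩ := hQ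
  refine ⟨k, hk, ?_⟩
  have hh := omegaHalf_ne_zero N
  have hB1 := insertedQ_mul_linkUInv hκ hlam hu hu' hw' hne hC fun i => (hR i).2
  have hB2 := insertedQ_linkWInv_mul hκ hlam hw hw' hne fun i => (hR i).2
  have hB3 := fun (x : ℂ) (hx : x ≠ 0) =>
    insertedQ_monodromy hne hper1 hper2 (fun i => (hR i).2) hx
  have hUW := linkU_mul_linkW (N := N) (uφ (m + 1)) (wφ (m + 1))
  have hUUi := linkU_mul_inv (N := N) (hne (m + 1)).1
  have hUiU := linkUInv_mul (N := N) (hne (m + 1)).1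
  have hWWi := linkW_mul_inv (N := N) (hne (m + 1)).2
  have hWiW := linkWInv_mul (N := N) (hne (m + 1)).2
  rw [← insertedQ_one]
  generalize linkU N (uφ (m + 1)) = U at *
  generalize linkUInv N (uφ (m + 1)) = Ui at *
  generalize linkW N (wφ (m + 1)) = W at *
  generalize linkWInv N (wφ (m + 1)) = Wi at *
  generalize insertedQ R = Qf at *
  refine ⟨fun e => Qf (Ui ^ e), ?_, ?_, ?_⟩
  · simp only [pow_zero]
  · intro e; simp only [pow_succ]; exact hB1 _
  · intro e i
    constructor
    · apply polynomial_eq_of_evalAt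
      intro x hx
      have := (exchange_relations hh Qf hUW hUUi hUiU hWWi hWiW hB2 (hB3 x hx) e i).1
      rw [map_mul, map_mul, map_sub, map_one, evalAt_mul_X, evalAt_C, evalAt_C, map_sum]
      simp only [map_add, evalAt_smul, map_mul, exchangeLPoly_evalAt]
      rw [← div_eq_mul_inv]
      refine Eq.trans ?_ this
      rw [sub_mul, one_mul, sub_smul, one_smul, smul_mul_assoc, ← Algebra.smul_def, smul_smul,
        mul_comm x]
      rfl
    · apply polynomial_eq_of_evalAt
      intro x hx
      have := (exchange_relations hh Qf hUW hUUi hUiU hWWi hWiW hB2 (hB3 x hx) e i).2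
      rw [map_mul, map_mul, map_sub, map_one, evalAt_mul_X, evalAt_C, evalAt_C, map_sum]
      simp only [map_add, map_sub, evalAt_smul, evalAt_mul_X]
      simp only [evalAt_C, map_mul, exchangeLPoly_evalAt]
      refine Eq.trans ?_ (this.trans ?_)
      · rw [sub_mul, one_mul, sub_smul, one_smul, smul_mul_assoc, ← Algebra.smul_def, smul_smul,
          mul_comm x]
        rfl
      · refine Finset.sum_congr rfl fun r _ => ?_
        simp only [smul_smul, sub_smul, Matrix.map_apply]
        rw [show (omegaHalf N)⁻¹ * -(omegaHalf N * lam * k / κ) * x =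
          x / omegaHalf N * -(omegaHalf N * lam * k / κ) by ring,
          show lam * k * (omegaHalf N)⁻¹ * x = lam * k / omegaHalf N * x by ring]

/-! ### Solitonic tau-functions as determinants -/

/-- A determinant whose last row consists of the powers of `z`. -/
theorem det_last_row_pow {j : ℕ} (R : ℕ → ℕ → ℂ) (z : ℂ) :
    (Matrix.of fun k i : Fin (j + 1) => if k.val = j then z ^ i.val else R k i).det =
      (Matrix.of fun k i : Fin j => z * R k i - R k (i + 1)).det := by
  rw [Matrix.det_eq_of_forall_col_eq_smul_add_pred (B := Matrix.of fun k i : Fin (j + 1) =>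
    Fin.cases (if k.val = j then 1 else R k 0)
      (fun i => if k.val = j then 0 else R k (i + 1) - z * R k i) i) (fun _ => z)]
  · rw [Matrix.det_succ_row _ (Fin.last j), Fin.sum_univ_succ, Finset.sum_eq_zero]
    · simp only [Matrix.of_apply, Fin.val_last, Fin.val_zero, Fin.cases_zero, if_true, add_zero,
        mul_one]
      have : (Matrix.of fun k i : Fin j => z * R k i - R k (i + 1)) =
          (-1 : ℂ) • (Matrix.of fun k i : Fin j => R k (i + 1) - z * R k i) := by
        ext k i; simp
      rw [this, Matrix.det_smul, Fintype.card_fin]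
      congr 2
      ext k i
      have hk := k.isLt.ne
      simp [Matrix.submatrix, hk]
    · intro i _
      simp
  · intro k
    by_cases hk : k.val = j <;> simp [hk]
  · intro k i
    by_cases hk : k.val = j
    · simp [hk, pow_succ, mul_comm]
    · simp [hk]

/-- Linearity of a determinant in its last row. -/
theorem det_last_row_sub {j : ℕ} (R : ℕ → ℕ → ℂ) (a b : ℕ → ℂ) (β : ℂ) :
    (Matrix.of fun k i : Fin (j + 1) => if k.val = j then a i - β * b i else R k i).det =
      (Matrix.of fun k i : Fin (j + 1) => if k.val = j then a i else R k i).det -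
      β * (Matrix.of fun k i : Fin (j + 1) => if k.val = j then b i else R k i).det := by
  have h : ∀ c : ℕ → ℂ, (Matrix.of fun k i : Fin (j + 1) => if k.val = j then c i else R k i) =
      Matrix.updateRow (Matrix.of fun k i : Fin (j + 1) => R k i) (Fin.last j) (fun i => c i) := by
    intro c
    ext k i
    rw [Matrix.updateRow_apply]
    have : k = Fin.last j ↔ k.val = j := by rw [Fin.ext_iff, Fin.val_last]
    simp only [Matrix.of_apply, this]
  rw [h (fun i => a i - β * b i), h a, h b]
  have e : (fun i : Fin (j + 1) => a i - β * b i) =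
      (fun i : Fin (j + 1) => a i) + (-β) • (fun i : Fin (j + 1) => b i) := by
    ext i; simp [sub_eq_add_neg]
  rw [e, Matrix.det_updateRow_add, Matrix.det_updateRow_smul]
  ring

/-- Genericity of the first `n` wave numbers: with `x = Δ(φ_k)` and `y = Δ*(φ_k)`, no denominator
of the tau-functions vanishes, and `x`, `y` are related by `x + y = Λ - K`. -/
structure GenericWaves (K : ℂ) (φ : ℕ → ℝ) (n : ℕ) : Prop where
  x_ne : ∀ k < n, Delta K (φ k) ≠ 0
  y_ne : ∀ k < n, DeltaStar K (φ k) ≠ 0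
  xy_ne : ∀ k < n, ∀ l < n, Delta K (φ k) ≠ DeltaStar K (φ l)
  y_inj : ∀ k < n, ∀ l < n, DeltaStar K (φ k) = DeltaStar K (φ l) → k = l
  Lam_inj : ∀ k < n, ∀ l < n, Lam K (φ k) = Lam K (φ l) → k = l
  one_sub_y : ∀ k < n, 1 - DeltaStar K (φ k) ≠ 0
  add_eq : ∀ k < n, Delta K (φ k) + DeltaStar K (φ k) = Lam K (φ k) - K
  exp_eq : ∀ k < n, ∀ m : ℕ, Complex.exp (2 * Complex.I * m * φ k) =
    (Delta K (φ k) / DeltaStar K (φ k)) ^ m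

variable {K : ℂ} {φ : ℕ → ℝ} {n : ℕ}

/-- A tau-function with the amplitudes parametrized by `β` is a determinant divided by the
Vandermonde determinant of the `Δ*`. In the induction the two tau-functions of the recursion become
determinants that differ in the last row only: it consists of the powers of `Δ*(φ_j)` or of
`Δ(φ_j)`. -/
theorem tau_mul_eq_det (hW : GenericWaves K φ n) (m : ℕ) {j : ℕ} (hj : j ≤ n) (f β : ℕ → ℂ)
    (hf : ∀ k < j, f k * Complex.exp (2 * Complex.I * m * φ k) =
      -β k * ∏ l ∈ (Finset.range j).erase k, ((DeltaStar K (φ l) - Delta K (φ k)) /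
        (DeltaStar K (φ l) - DeltaStar K (φ k)))) :
    tau K φ m j f * ∏ k ∈ Finset.range j, ∏ l ∈ Finset.range k,
        (DeltaStar K (φ k) - DeltaStar K (φ l)) =
      (Matrix.of fun k i : Fin j => DeltaStar K (φ k) ^ i.val -
        β k * Delta K (φ k) ^ i.val).det := by
  induction j generalizing f β with
  | zero => simp [tau]
  | succ j ih =>
    set x : ℕ → ℂ := fun k => Delta K (φ k) with hx
    set y : ℕ → ℂ := fun k => DeltaStar K (φ k) with hy
    have hxy : ∀ k < n, ∀ l < n, x k ≠ y l := hW.xy_ne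
    have hyy : ∀ k < n, ∀ l < n, k ≠ l → y k ≠ y l := fun k hk l hl h e => h (hW.y_inj k hk l hl e)
    have herase : ∀ k < j, (Finset.range (j + 1)).erase k =
        insert j ((Finset.range j).erase k) := by
      intro k hk
      ext a
      simp only [Finset.mem_erase, Finset.mem_range, Finset.mem_insert]
      omega
    have hprod : ∀ k < j, ∀ F : ℕ → ℂ, ∏ l ∈ (Finset.range (j + 1)).erase k, F l =
        F j * ∏ l ∈ (Finset.range j).erase k, F l := by
      intro k hk F
      rw [herase k hk, Finset.prod_insert (by simp)]
    -- the rows of the two smaller determinants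
    have hE : ∀ (z : ℂ) (β' : ℕ → ℂ), (∀ k < j, β' k * (z - y k) = β k * (z - x k)) →
        (∏ k ∈ Finset.range j, (z - y k)) *
          (Matrix.of fun k i : Fin j => y k ^ i.val - β' k * x k ^ i.val).det =
        (Matrix.of fun k i : Fin (j + 1) =>
          if k.val = j then z ^ i.val else y k ^ i.val - β k * x k ^ i.val).det := by
      intro z β' hβ'
      rw [det_last_row_pow (fun k i => y k ^ i - β k * x k ^ i), ← Fin.prod_univ_eq_prod_range
        (fun k => z - y k), ← Matrix.det_mul_column]
      congr 1
      ext k i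
      have := hβ' k k.isLt
      simp only [Matrix.of_apply]
      linear_combination (-(x k ^ i.val)) * this
    have h1 := ih (by omega) f (fun k => β k * ((y j - x k) / (y j - y k))) (by
      intro k hk
      rw [hf k (by omega), hprod k hk]
      ring)
    have h2 := ih (by omega) (fun k => dShift K (φ k) (φ j) * f k)
      (fun k => β k * ((x j - x k) / (x j - y k))) (by
      intro k hk
      rw [mul_assoc, hf k (by omega), hprod k hk, dShift]
      have e1 : y j - y k ≠ 0 := sub_ne_zero.2 (hyy j (by omega) k (by omega) (by omega))
      have e2 : x j - y k ≠ 0 := sub_ne_zero.2 (hxy j (by omega) k (by omega))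
      have e3 : x k - y j ≠ 0 := sub_ne_zero.2 (hxy k (by omega) j (by omega))
      have e4 : y k - x j ≠ 0 := sub_ne_zero.2 (hxy j (by omega) k (by omega)).symm
      have e5 : (x k - x j) * (y k - y j) / ((x k - y j) * (y k - x j)) *
          ((y j - x k) / (y j - y k))
          = (x j - x k) / (x j - y k) := by
        field_simp
        ring
      change (x k - x j) * (y k - y j) / ((x k - y j) * (y k - x j)) *
        (-β k * ((y j - x k) / (y j - y k) * _)) = _
      rw [← e5]
      ring)
    have hEy := hE (y j) (fun k => β k * ((y j - x k) / (y j - y k))) (by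
      intro k hk
      have e1 : y j - y k ≠ 0 := sub_ne_zero.2 (hyy j (by omega) k (by omega) (by omega))
      field_simp)
    have hEx := hE (x j) (fun k => β k * ((x j - x k) / (x j - y k))) (by
      intro k hk
      have e1 : x j - y k ≠ 0 := sub_ne_zero.2 (hxy j (by omega) k (by omega))
      field_simp)
    have hlast : (Matrix.of fun k i : Fin (j + 1) => y k ^ i.val - β k * x k ^ i.val) =
        Matrix.of fun k i : Fin (j + 1) => if k.val = j then y j ^ i.val - β j * x j ^ i.val
          else y k ^ i.val - β k * x k ^ i.val := by
      ext k i
      simp only [Matrix.of_apply]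
      split_ifs with hk
      · rw [hk]
      · rfl
    have hfj := hf j (by omega)
    have herj : (Finset.range (j + 1)).erase j = Finset.range j := by
      ext a; simp only [Finset.mem_erase, Finset.mem_range]; omega
    rw [herj, Finset.prod_div_distrib] at hfj
    have hpn : ∏ l ∈ Finset.range j, (y l - y j) ≠ 0 := Finset.prod_ne_zero_iff.2 fun l hl => by
      have := Finset.mem_range.1 hl
      exact sub_ne_zero.2 (hyy l (by omega) j (by omega) (by omega))
    have hsgn : ∀ z, ∏ l ∈ Finset.range j, (y l - z) =
        (-1) ^ j * ∏ l ∈ Finset.range j, (z - y l) := by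
      intro z
      rw [Finset.prod_congr rfl (fun l _ => (by ring : y l - z = (-1) * (z - y l))),
        Finset.prod_mul_distrib, Finset.prod_const, Finset.card_range]
    have hfj' : f j * Complex.exp (2 * Complex.I * m * φ j) * ∏ l ∈ Finset.range j, (y j - y l) =
        -β j * ∏ l ∈ Finset.range j, (x j - y l) := by
      have h3 : f j * Complex.exp (2 * Complex.I * m * φ j) * ∏ l ∈ Finset.range j, (y l - y j) =
          -β j * ∏ l ∈ Finset.range j, (y l - x j) := by
        rw [hfj, mul_assoc]
        congr 1
        exact div_mul_cancel₀ _ hpn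
      rw [hsgn, hsgn] at h3
      have h4 : ((-1 : ℂ) ^ j) ≠ 0 := pow_ne_zero _ (by norm_num)
      apply mul_left_cancel₀ h4
      linear_combination h3
    rw [hlast, det_last_row_sub (fun k i => y k ^ i - β k * x k ^ i) (fun i => y j ^ i)
      (fun i => x j ^ i), ← hEy, ← hEx, ← h1, ← h2, tau, Finset.prod_range_succ]
    linear_combination (tau K φ m j (fun k => dShift K (φ k) (φ j) * f k) *
      ∏ k ∈ Finset.range j, ∏ l ∈ Finset.range k, (y k - y l)) * hfj'

/-! ### Triangular determinants of polynomial values -/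

section Polys
open Polynomial

/-- The polynomial in `t = X Y` that equals `(Y^e - X^e) / (Y - X)` if `X + Y = 1 - K t`. -/
def hSym (K : ℂ) : ℕ → ℂ[X]
  | 0 => 0
  | 1 => 1
  | e + 2 => (1 - C K * X) * hSym K (e + 1) - X * hSym K e

theorem hSym_eval {K a b t : ℂ} (hs : a + b = 1 - K * t) (hp : a * b = t) (e : ℕ) :
    (b - a) * (hSym K e).eval t = b ^ e - a ^ e := by
  induction e using Nat.twoStepInduction with
  | zero => simp [hSym]
  | one => simp [hSym]
  | more e h1 h2 =>
    simp only [hSym, eval_sub, eval_mul, eval_one, eval_C, eval_X]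
    rw [← hs, ← hp] at *
    linear_combination (-(a * b)) * h1 + (a + b) * h2

theorem hSym_coeff_zero (K : ℂ) (e : ℕ) : (hSym K (e + 1)).coeff 0 = 1 := by
  induction e with
  | zero => simp [hSym]
  | succ e ih => simp [hSym, coeff_sub, mul_coeff_zero, ih]

theorem hSym_coeff (K : ℂ) (e : ℕ) :
    (hSym K (e + 1)).coeff e = (-K) ^ e ∧ ∀ l, e < l → (hSym K (e + 1)).coeff l = 0 := by
  have key : ∀ e l, (hSym K (e + 2)).coeff (l + 1) = (hSym K (e + 1)).coeff (l + 1) -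
      K * (hSym K (e + 1)).coeff l - (hSym K e).coeff l := by
    intro e l
    rw [hSym, coeff_sub, sub_mul, one_mul, mul_assoc, coeff_sub, coeff_C_mul, coeff_X_mul,
      coeff_X_mul]
  induction e using Nat.twoStepInduction with
  | zero =>
    refine ⟨by simp [hSym], fun l hl => ?_⟩
    simp [hSym, coeff_one, hl.ne']
  | one =>
    constructor
    · rw [key]; simp [hSym, coeff_one]
    · intro l hl
      obtain ⟨l, rfl⟩ : ∃ l', l = l' + 1 := ⟨l - 1, by omega⟩
      rw [key]
      simp [hSym, coeff_one, show l ≠ 0 by omega]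
  | more e h1 h2 =>
    constructor
    · rw [key, h2.2 _ (by omega), h2.1, h1.2 _ (by omega)]
      ring
    · intro l hl
      obtain ⟨l, rfl⟩ : ∃ l', l = l' + 1 := ⟨l - 1, by omega⟩
      rw [key, h2.2 _ (by omega), h2.2 _ (by omega), h1.2 _ (by omega)]
      ring

/-- A determinant of values of polynomials at distinct points does not vanish, if the polynomials
are triangular: those before `a` with respect to the degree, those from `a` on with respect to
the order at zero. -/
theorem det_eval_ne_zero {j : ℕ} (a : ℕ) (p : ℕ → ℂ[X]) (t r : ℕ → ℂ)
    (ht : ∀ k < j, ∀ l < j, t k = t l → k = l) (hr : ∀ k < j, r k ≠ 0)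
    (hdeg : ∀ i < j, ∀ l, j ≤ l → (p i).coeff l = 0)
    (hne : ∀ i < j, (p i).coeff (j - 1 - i) ≠ 0)
    (hup : ∀ i < j, i < a → ∀ i' < j, i < i' → (p i').coeff (j - 1 - i) = 0)
    (hlow : ∀ i < j, a ≤ i → ∀ i' < i, (p i').coeff (j - 1 - i) = 0) :
    (Matrix.of fun k i : Fin j => r k * (p i).eval (t k)).det ≠ 0 := by
  intro hdet
  obtain ⟨c, hc0, hc⟩ := Matrix.exists_mulVec_eq_zero_iff.2 hdet
  set P : ℂ[X] := ∑ i : Fin j, C (c i) * p i with hP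
  have hPdeg : P.degree < j := by
    rw [degree_lt_iff_coeff_zero]
    intro l hl
    simp only [hP, finsetSum_coeff, coeff_C_mul]
    exact Finset.sum_eq_zero fun i _ => by rw [hdeg i i.isLt l (by exact_mod_cast hl), mul_zero]
  have hP0 : P = 0 := by
    refine eq_zero_of_degree_lt_of_eval_index_eq_zero (s := Finset.univ) (v := fun k : Fin j => t k)
      (fun k _ l _ h => Fin.ext (ht k k.isLt l l.isLt h)) (by simpa using hPdeg) fun k _ => ?_
    have h1 := congrFun hc k
    simp only [Matrix.mulVec, dotProduct, Matrix.of_apply, Pi.zero_apply, mul_assoc,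
      ← Finset.mul_sum] at h1
    have h2 := (mul_eq_zero.1 h1).resolve_left (hr k k.isLt)
    simp only [hP, eval_finsetSum, eval_mul, eval_C]
    rw [← h2]
    exact Finset.sum_congr rfl fun i _ => mul_comm _ _
  have hcoeff : ∀ l, ∑ i : Fin j, c i * (p i).coeff l = 0 := by
    intro l
    have := congrArg (fun A => A.coeff l) hP0
    simpa only [hP, finsetSum_coeff, coeff_C_mul, coeff_zero] using this
  have hextract : ∀ i : Fin j, (∀ i' : Fin j, i' ≠ i → c i' * (p i').coeff (j - 1 - i) = 0) →
      c i = 0 := by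
    intro i hi
    have h1 := hcoeff (j - 1 - i)
    rw [Finset.sum_eq_single i (fun i' _ h => hi i' h)
      (fun h => absurd (Finset.mem_univ _) h)] at h1
    exact (mul_eq_zero.1 h1).resolve_right (hne i i.isLt)
  have hcup : ∀ i, ∀ hi : i < j, i < a → c ⟨i, hi⟩ = 0 := by
    intro i
    induction i using Nat.strong_induction_on with
    | _ i ih =>
      intro hi hia
      refine hextract ⟨i, hi⟩ fun i' hne' => ?_
      rcases lt_trichotomy i'.val i with hlt | heq | hgt
      · rw [ih i' hlt i'.isLt (by omega), zero_mul]
      · exact absurd (Fin.ext heq) hne'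
      · rw [hup i hi hia i' i'.isLt hgt, mul_zero]
  have hclow : ∀ s i, ∀ hi : i < j, j - i ≤ s → a ≤ i → c ⟨i, hi⟩ = 0 := by
    intro s
    induction s with
    | zero => intro i hi hs; omega
    | succ s ih =>
      intro i hi hs hia
      refine hextract ⟨i, hi⟩ fun i' hne' => ?_
      rcases lt_trichotomy i'.val i with hlt | heq | hgt
      · rw [hlow i hi hia i' hlt, mul_zero]
      · exact absurd (Fin.ext heq) hne'
      · rw [ih i' i'.isLt (by omega) (by omega), zero_mul]
  apply hc0
  ext i
  rcases lt_or_ge i.val a with h | h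
  · exact hcup i i.isLt h
  · exact hclow _ i i.isLt le_rfl h

end Polys

/-! ### Genericity of the wave numbers -/

/-- The properties of `Δ` and `Δ*` at one wave number, in terms of
`s = √(cos² φ + K) + cos φ`. -/
theorem exists_soliton_root {K : ℂ} (φ : ℝ) :
    ∃ s : ℂ, Delta K φ = Complex.exp (φ * Complex.I) * s ∧
      DeltaStar K φ = Complex.exp (-(φ * Complex.I)) * s ∧ Lam K φ = s ^ 2 ∧
      s ^ 2 - 2 * Real.cos φ * s = K ∧ s - Real.cos φ =
        ((Real.cos φ : ℂ) ^ 2 + K) ^ (1 / 2 : ℂ) := by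
  set R : ℂ := ((Real.cos φ : ℂ) ^ 2 + K) ^ (1 / 2 : ℂ) with hR
  have hR2 : R ^ 2 = (Real.cos φ : ℂ) ^ 2 + K := by
    generalize (Real.cos φ : ℂ) ^ 2 + K = z at hR
    rw [hR, show (1 / 2 : ℂ) = ((2 : ℕ) : ℂ)⁻¹ by norm_num]
    exact Complex.cpow_nat_inv_pow z two_ne_zero
  have hE : Complex.exp (φ * Complex.I) * Complex.exp (-(φ * Complex.I)) = 1 := by
    rw [← Complex.exp_add, add_neg_cancel, Complex.exp_zero]
  refine ⟨R + Real.cos φ, rfl, rfl, ?_, ?_, ?_⟩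
  · rw [Lam, Delta, DeltaStar, ← hR]
    linear_combination (R + Real.cos φ) ^ 2 * hE
  · linear_combination hR2
  · rw [add_sub_cancel_right]

/-- The wave numbers `p π / M` are generic. -/
theorem genericWaves {M : ℕ} {K : ℂ} (hK : K ≠ 0)
    (hgen : ∀ p < M, (Real.cos (p * Real.pi / M) : ℂ) ^ 2 + K ≠ 0) {φ : ℕ → ℝ}
    (hφ : ∀ k < M - 1, ∃ p : ℕ, 1 ≤ p ∧ p ≤ M - 1 ∧ φ k = p * Real.pi / M)
    (hφ_inj : ∀ j < M - 1, ∀ k < M - 1, φ j = φ k → j = k) :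
    GenericWaves K φ (M - 1) ∧
      ∀ k < M - 1, (Delta K (φ k) / DeltaStar K (φ k)) ^ M = 1 := by
  choose s hx hy hL hs hR using fun k => exists_soliton_root (K := K) (φ k)
  have hMpos : ∀ k < M - 1, (0 : ℝ) < M := fun k hk => by
    have : 0 < M := by omega
    exact_mod_cast this
  have hpos : ∀ k < M - 1, 0 < φ k ∧ φ k < Real.pi := by
    intro k hk
    obtain ⟨p, h1, h2, h3⟩ := hφ k hk
    have hM := hMpos k hk
    have hp : (0 : ℝ) < p := by exact_mod_cast h1
    have hp' : (p : ℝ) < M := by exact_mod_cast (by omega : p < M)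
    rw [h3]
    refine ⟨by positivity, ?_⟩
    rw [div_lt_iff₀ hM, mul_comm]
    exact mul_lt_mul_of_pos_left hp' Real.pi_pos
  have hcs : ∀ k < M - 1, (Real.cos (φ k) : ℂ) ^ 2 + K ≠ 0 := by
    intro k hk
    obtain ⟨p, h1, h2, h3⟩ := hφ k hk
    rw [h3]
    exact hgen p (by omega)
  have hs0 : ∀ k, s k ≠ 0 := fun k h0 => hK (by rw [← hs k, h0]; ring)
  have hE : ∀ k, Complex.exp (φ k * Complex.I) * Complex.exp (-(φ k * Complex.I)) = 1 := fun k => by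
    rw [← Complex.exp_add, add_neg_cancel, Complex.exp_zero]
  have hE1 : ∀ k, Complex.exp (φ k * Complex.I) = Real.cos (φ k) + Real.sin (φ k) * Complex.I :=
    fun k => by rw [Complex.exp_mul_I, Complex.ofReal_cos, Complex.ofReal_sin]
  have hE2 : ∀ k, Complex.exp (-(φ k * Complex.I)) =
      Real.cos (φ k) - Real.sin (φ k) * Complex.I := fun k => by
    rw [← neg_mul, Complex.exp_mul_I, Complex.cos_neg, Complex.sin_neg, Complex.ofReal_cos,
      Complex.ofReal_sin]
    ring
  have hx0 : ∀ k, Delta K (φ k) ≠ 0 := fun k => by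
    rw [hx]; exact mul_ne_zero (Complex.exp_ne_zero _) (hs0 k)
  have hy0 : ∀ k, DeltaStar K (φ k) ≠ 0 := fun k => by
    rw [hy]; exact mul_ne_zero (Complex.exp_ne_zero _) (hs0 k)
  have hadd : ∀ k, Delta K (φ k) + DeltaStar K (φ k) = Lam K (φ k) - K := fun k => by
    rw [hx, hy, hL, hE1, hE2]
    linear_combination -hs k
  have hmul : ∀ k, Delta K (φ k) * DeltaStar K (φ k) = Lam K (φ k) := fun k => rfl
  have hdiv : ∀ k, Delta K (φ k) / DeltaStar K (φ k) = Complex.exp (2 * Complex.I * φ k) := by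
    intro k
    rw [div_eq_iff (hy0 k), hx, hy, ← mul_assoc, ← Complex.exp_add]
    congr 2
    ring
  have hLinj : ∀ k < M - 1, ∀ l < M - 1, Lam K (φ k) = Lam K (φ l) → k = l := by
    intro k hk l hl h
    rw [hL, hL] at h
    have hcs' : Real.cos (φ k) * s k = Real.cos (φ l) * s l := by
      linear_combination (h - hs k + hs l) / 2
    rcases sq_eq_sq_iff_eq_or_eq_neg.1 h with h1 | h1
    · rw [h1] at hcs'
      have h2 := mul_right_cancel₀ (hs0 l) hcs'
      have h3 : Real.cos (φ k) = Real.cos (φ l) := by exact_mod_cast h2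
      exact hφ_inj k hk l hl (Real.injOn_cos ⟨(hpos k hk).1.le, (hpos k hk).2.le⟩
        ⟨(hpos l hl).1.le, (hpos l hl).2.le⟩ h3)
    · rw [h1] at hcs'
      have h2 : (Real.cos (φ k) : ℂ) = -Real.cos (φ l) := by
        apply mul_right_cancel₀ (hs0 l)
        linear_combination -hcs'
      have h3 : ((Real.cos (φ l) : ℂ) ^ 2 + K) ^ (1 / 2 : ℂ) = 0 := by
        have h4 := hR k
        rw [h1, h2, neg_sq, ← hR l] at h4
        rw [← hR l]
        linear_combination -h4 / 2
      exact absurd ((Complex.cpow_eq_zero_iff _ _).1 h3).1 (hcs l hl)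
  have hxy0 : ∀ k < M - 1, Delta K (φ k) ≠ DeltaStar K (φ k) := by
    intro k hk h
    rw [hx, hy, hE1, hE2] at h
    have h1 := mul_right_cancel₀ (hs0 k) h
    have h2 : (Real.sin (φ k) : ℂ) * Complex.I = 0 := by linear_combination h1 / 2
    have h3 := (mul_eq_zero.1 h2).resolve_right Complex.I_ne_zero
    exact (Real.sin_pos_of_pos_of_lt_pi (hpos k hk).1 (hpos k hk).2).ne' (by exact_mod_cast h3)
  have h1K : ∀ k < M - 1, (1 - Delta K (φ k)) * (1 - DeltaStar K (φ k)) ≠ 0 := by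
    intro k hk
    have h1 : (1 - Delta K (φ k)) * (1 - DeltaStar K (φ k)) = 1 + K := by
      linear_combination hmul k - hadd k
    rw [h1]
    have := hgen 0 (by omega)
    simpa using this
  -- `x` and `y` are the two roots of a quadratic equation with coefficients in `Λ`, and the
  -- equation `(x - 1) (y - 1) = 1 + K` recovers each of them from the other one
  have hyinj : ∀ k < M - 1, ∀ l < M - 1, DeltaStar K (φ k) = DeltaStar K (φ l) → k = l := by
    intro k hk l hl h
    apply hLinj k hk l hl
    have h1 : (Delta K (φ k) - Delta K (φ l)) * (1 - DeltaStar K (φ l)) = 0 := by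
      have := hadd k
      rw [← hmul, h] at this
      linear_combination this - hadd l + hmul l
    rcases mul_eq_zero.1 h1 with h2 | h2
    · rw [← hmul, ← hmul, h, sub_eq_zero.1 h2]
    · exact absurd h2 (right_ne_zero_of_mul (h1K l hl))
  have hxyne : ∀ k < M - 1, ∀ l < M - 1, Delta K (φ k) ≠ DeltaStar K (φ l) := by
    intro k hk l hl h
    have h1 : (DeltaStar K (φ k) - Delta K (φ l)) * (1 - DeltaStar K (φ l)) = 0 := by
      have := hadd k
      rw [← hmul, h] at this
      linear_combination this - hadd l + hmul l
    rcases mul_eq_zero.1 h1 with h2 | h2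
    · have : k = l := hLinj k hk l hl (by rw [← hmul, ← hmul, h, sub_eq_zero.1 h2, mul_comm])
      subst this
      exact hxy0 k hk h
    · exact absurd h2 (right_ne_zero_of_mul (h1K l hl))
  refine ⟨⟨fun k _ => hx0 k, fun k _ => hy0 k, hxyne, hyinj, hLinj,
    fun k hk => right_ne_zero_of_mul (h1K k hk), fun k _ => hadd k, fun k _ m => ?_⟩,
      fun k hk => ?_⟩
  · rw [hdiv, ← Complex.exp_nat_mul]
    congr 1
    ring
  · obtain ⟨p, h1, h2, h3⟩ := hφ k hk
    rw [hdiv, ← Complex.exp_nat_mul, Complex.exp_eq_one_iff]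
    refine ⟨p, ?_⟩
    have hM : (M : ℂ) ≠ 0 := by
      have := (hMpos k hk).ne'
      exact_mod_cast this
    rw [h3]
    push_cast
    field_simp

/-! ### Values of the tau-functions at the degenerate amplitudes -/

section Values
open Polynomial
variable {K : ℂ} {φ : ℕ → ℝ} {n : ℕ}

/-- The determinant formula at the amplitudes `-g_k ∏ s(φ_k, φ_l)`; the products of the `s` are
just what makes the parameters `β` of the determinant explicit. -/
theorem tau_amp_mul_eq_det (hW : GenericWaves K φ n) (m : ℕ) {j : ℕ} (hj : j ≤ n) (g : ℕ → ℂ) :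
    tau K φ m j (fun k => g k * amp K φ (fun _ => -1) j k) *
        ∏ k ∈ Finset.range j, ∏ l ∈ Finset.range k, (DeltaStar K (φ k) - DeltaStar K (φ l)) =
      (Matrix.of fun k i : Fin j => DeltaStar K (φ k) ^ i.val -
        g k * (Delta K (φ k) / DeltaStar K (φ k)) ^ m *
          (DeltaStar K (φ k) / Delta K (φ k)) ^ (j - 1) * Delta K (φ k) ^ i.val).det := by
  refine tau_mul_eq_det hW m hj _ (fun k => g k * (Delta K (φ k) / DeltaStar K (φ k)) ^ m *
    (DeltaStar K (φ k) / Delta K (φ k)) ^ (j - 1)) fun k hk => ?_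
  have h1 : amp K φ (fun _ => -1) j k = -((DeltaStar K (φ k) / Delta K (φ k)) ^ (j - 1) *
      ∏ l ∈ (Finset.range j).erase k, ((DeltaStar K (φ l) - Delta K (φ k)) /
        (DeltaStar K (φ l) - DeltaStar K (φ k)))) := by
    simp only [amp, sFun]
    rw [Finset.prod_mul_distrib, Finset.prod_const, Finset.card_erase_of_mem (by simpa using hk),
      Finset.card_range, neg_one_mul]
  rw [h1, hW.exp_eq k (by omega)]
  ring

theorem prod_sub_ne_zero (hW : GenericWaves K φ n) {j : ℕ} (hj : j ≤ n) :
    ∏ k ∈ Finset.range j, ∏ l ∈ Finset.range k, (DeltaStar K (φ k) - DeltaStar K (φ l)) ≠ 0 :=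
  Finset.prod_ne_zero_iff.2 fun k hk => Finset.prod_ne_zero_iff.2 fun l hl => by
    rw [Finset.mem_range] at hk hl
    refine sub_ne_zero.2 fun h => ?_
    have := hW.y_inj k (by omega) l (by omega) h
    omega

/-- At the degenerate amplitudes the first tau-functions vanish: the determinant has a zero
column. -/
theorem tau_amp_eq_zero (hW : GenericWaves K φ n) {m j : ℕ} (hj : j ≤ n) (hm : m < j) :
    tau K φ m j (amp K φ (fun _ => -1) j) = 0 := by
  have h1 := tau_amp_mul_eq_det hW m hj (fun _ => 1)
  simp only [one_mul] at h1
  rw [Matrix.det_eq_zero_of_column_eq_zero (⟨j - 1 - m, by omega⟩ : Fin j)] at h1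
  · exact (mul_eq_zero.1 h1).resolve_right (prod_sub_ne_zero hW hj)
  · intro k
    have hx := hW.x_ne k (by omega)
    have hy := hW.y_ne k (by omega)
    simp only [Matrix.of_apply]
    rw [show j - 1 = m + (j - 1 - m) by omega, Nat.add_sub_cancel_left, pow_add, ← mul_assoc,
      ← mul_pow, div_mul_div_cancel₀ hy, div_self hx, one_pow, one_mul, ← mul_pow,
      div_mul_cancel₀ _ hx, sub_self]

/-- `hSym` at the inverses of `Δ` and `Δ*`, whose sum is `1 - K / Λ`. -/
theorem hSym_eval_inv (hW : GenericWaves K φ n) {k : ℕ} (hk : k < n) (e : ℕ) :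
    ((DeltaStar K (φ k))⁻¹ - (Delta K (φ k))⁻¹) * (hSym K e).eval (Lam K (φ k))⁻¹ =
      (DeltaStar K (φ k))⁻¹ ^ e - (Delta K (φ k))⁻¹ ^ e := by
  have hx := hW.x_ne k hk
  have hy := hW.y_ne k hk
  have h1 := hW.add_eq k hk
  have hL : Lam K (φ k) = Delta K (φ k) * DeltaStar K (φ k) := rfl
  apply hSym_eval
  · rw [hL] at h1 ⊢
    field_simp
    linear_combination h1
  · rw [hL, mul_inv]

theorem inv_sub_inv_ne_zero (hW : GenericWaves K φ n) {k : ℕ} (hk : k < n) :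
    (DeltaStar K (φ k))⁻¹ - (Delta K (φ k))⁻¹ ≠ 0 :=
  sub_ne_zero.2 fun h => hW.xy_ne k hk k hk (inv_injective h).symm

theorem Lam_ne_zero (hW : GenericWaves K φ n) {k : ℕ} (hk : k < n) : Lam K (φ k) ≠ 0 :=
  mul_ne_zero (hW.x_ne k hk) (hW.y_ne k hk)

theorem Lam_inv_inj (hW : GenericWaves K φ n) {j : ℕ} (hj : j ≤ n) :
    ∀ k < j, ∀ l < j, (Lam K (φ k))⁻¹ = (Lam K (φ l))⁻¹ → k = l := fun k hk l hl h =>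
  hW.Lam_inj k (by omega) l (by omega) (inv_injective h)

theorem pow_mul_inv_sub_inv {x y : ℂ} (hx : x ≠ 0) (hy : y ≠ 0) {a i e : ℕ} (h : a = i + e) :
    y ^ a * (y⁻¹ ^ e - x⁻¹ ^ e) = y ^ i - (y / x) ^ a * x ^ i := by
  have h1 : y ^ e * y⁻¹ ^ e = 1 := by rw [← mul_pow, mul_inv_cancel₀ hy, one_pow]
  have h2 : x ^ i * x⁻¹ ^ i = 1 := by rw [← mul_pow, mul_inv_cancel₀ hx, one_pow]
  rw [div_eq_mul_inv, mul_pow, h, pow_add y, pow_add x⁻¹]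
  linear_combination y ^ i * h1 + y ^ i * y ^ e * x⁻¹ ^ e * h2

theorem pow_mul_inv_sub_inv_succ {x y : ℂ} (hx : x ≠ 0) (hy : y ≠ 0) (hy1 : 1 - y ≠ 0)
    {a i e : ℕ} (h : a = i + (e + 1)) :
    y ^ i - (1 - x) / (1 - y) * (y / x) ^ a * x ^ i =
      y ^ a / (1 - y) * (y⁻¹ ^ (e + 1) - x⁻¹ ^ (e + 1) - (y⁻¹ ^ e - x⁻¹ ^ e)) := by
  have h5 := pow_mul_inv_sub_inv hx hy h
  have h6 := pow_mul_inv_sub_inv hx hy (a := a) (i := i + 1) (e := e) (by omega)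
  have h7 : y ^ a / (1 - y) * (y⁻¹ ^ (e + 1) - x⁻¹ ^ (e + 1) - (y⁻¹ ^ e - x⁻¹ ^ e)) =
      (y ^ a * (y⁻¹ ^ (e + 1) - x⁻¹ ^ (e + 1)) - y ^ a * (y⁻¹ ^ e - x⁻¹ ^ e)) / (1 - y) := by
    rw [div_mul_eq_mul_div, mul_sub]
  rw [h7, h5, h6, eq_div_iff hy1]
  generalize (y / x) ^ a = r
  have h8 : (1 - x) / (1 - y) * (1 - y) = 1 - x := div_mul_cancel₀ _ hy1
  linear_combination (-(r * x ^ i)) * h8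

theorem pow_mul_sub_succ {x y : ℂ} (hx : x ≠ 0) (hy : y ≠ 0) (hy1 : 1 - y ≠ 0) {a i s : ℕ}
    (h : i = a + s) :
    y ^ i - (1 - x) / (1 - y) * (y / x) ^ a * x ^ i =
      y ^ a / (1 - y) * (x ^ (s + 1) * y ^ (s + 1) * (y⁻¹ ^ (s + 1) - x⁻¹ ^ (s + 1)) -
        x ^ s * y ^ s * (y⁻¹ ^ s - x⁻¹ ^ s)) := by
  have h1 : ∀ s, x ^ s * y ^ s * (y⁻¹ ^ s - x⁻¹ ^ s) = x ^ s - y ^ s := by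
    intro s
    have h1 : y ^ s * y⁻¹ ^ s = 1 := by rw [← mul_pow, mul_inv_cancel₀ hy, one_pow]
    have h2 : x ^ s * x⁻¹ ^ s = 1 := by rw [← mul_pow, mul_inv_cancel₀ hx, one_pow]
    linear_combination x ^ s * h1 - y ^ s * h2
  have h2 : (y / x) ^ a * x ^ a = y ^ a := by rw [← mul_pow, div_mul_cancel₀ _ hx]
  rw [h1, h1, h, pow_add x, div_mul_eq_mul_div (y ^ a), eq_div_iff hy1, pow_add y]
  generalize (y / x) ^ a = r at *
  have h8 : (1 - x) / (1 - y) * (1 - y) = 1 - x := div_mul_cancel₀ _ hy1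
  linear_combination (-(r * x ^ a * x ^ s)) * h8 - (1 - x) * x ^ s * h2

/-- The entries of the determinant are, up to factors of the rows, polynomials of the degrees
`j - 1, …, 0` in `1 / Λ`, so that the determinant is a Vandermonde determinant. -/
theorem tau_amp_ne_zero (hK : K ≠ 0) (hW : GenericWaves K φ n)
    (hper : ∀ k < n, (Delta K (φ k) / DeltaStar K (φ k)) ^ (n + 1) = 1) {j : ℕ} (hj : j ≤ n) :
    tau K φ n j (amp K φ (fun _ => -1) j) ≠ 0 := by
  have h1 := tau_amp_mul_eq_det hW n hj (fun _ => 1)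
  simp only [one_mul] at h1
  refine left_ne_zero_of_mul (b := ∏ k ∈ Finset.range j, ∏ l ∈ Finset.range k,
    (DeltaStar K (φ k) - DeltaStar K (φ l))) ?_
  rw [h1]
  have h2 : (Matrix.of fun k i : Fin j => DeltaStar K (φ k) ^ i.val -
        (Delta K (φ k) / DeltaStar K (φ k)) ^ n *
          (DeltaStar K (φ k) / Delta K (φ k)) ^ (j - 1) * Delta K (φ k) ^ i.val) =
      Matrix.of fun k i : Fin j =>
        (DeltaStar K (φ k) ^ j * ((DeltaStar K (φ k))⁻¹ - (Delta K (φ k))⁻¹)) *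
          (hSym K (j - i)).eval (Lam K (φ k))⁻¹ := by
    ext k i
    have hk : k.val < n := by omega
    have hx := hW.x_ne k hk
    have hy := hW.y_ne k hk
    have hp := hper k hk
    simp only [Matrix.of_apply]
    rw [mul_assoc (DeltaStar K (φ k) ^ j), hSym_eval_inv hW hk]
    obtain ⟨e, he⟩ : ∃ e, j = i.val + e := ⟨j - i, by omega⟩
    have hp' : (Delta K (φ k) / DeltaStar K (φ k)) ^ n *
        (DeltaStar K (φ k) / Delta K (φ k)) ^ (j - 1) =
          (DeltaStar K (φ k) / Delta K (φ k)) ^ j := by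
      have h3 : (Delta K (φ k) / DeltaStar K (φ k)) ^ n = DeltaStar K (φ k) / Delta K (φ k) := by
        rw [← inv_div (Delta K (φ k))]
        refine eq_inv_of_mul_eq_one_left ?_
        rw [← pow_succ, hp]
      rw [h3, ← pow_succ', show j - 1 + 1 = j by have := i.isLt; omega]
    rw [hp', show j - i.val = e by omega, pow_mul_inv_sub_inv hx hy he]
  rw [h2]
  refine det_eval_ne_zero j (fun i => hSym K (j - i)) (fun k => (Lam K (φ k))⁻¹)
    (fun k => DeltaStar K (φ k) ^ j * ((DeltaStar K (φ k))⁻¹ - (Delta K (φ k))⁻¹))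
    (Lam_inv_inj hW hj)
    (fun k hk => mul_ne_zero (pow_ne_zero _ (hW.y_ne k (by omega)))
      (inv_sub_inv_ne_zero hW (by omega))) ?_ ?_ ?_ ?_
  · intro i hi l hl
    rw [show j - i = (j - 1 - i) + 1 by omega]
    exact (hSym_coeff K _).2 l (by omega)
  · intro i hi
    rw [show j - i = (j - 1 - i) + 1 by omega, (hSym_coeff K _).1]
    exact pow_ne_zero _ (neg_ne_zero.2 hK)
  · intro i hi _ i' hi' hii'
    rw [show j - i' = (j - 1 - i') + 1 by omega]
    exact (hSym_coeff K _).2 _ (by omega)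
  · intro i hi hji
    omega

/-- The determinant formula for `Θ`; the exponent `e` only matters modulo the period `n + 1`. -/
theorem Theta_amp_mul_eq_det (hW : GenericWaves K φ n)
    (hper : ∀ k < n, (Delta K (φ k) / DeltaStar K (φ k)) ^ (n + 1) = 1) {m j e : ℕ} (hj : j ≤ n)
    (he : (j + n + 1 - m) % (n + 1) = e % (n + 1)) (hm : m ≤ n) :
    Theta K φ m j (amp K φ (fun _ => -1) j) *
        ∏ k ∈ Finset.range j, ∏ l ∈ Finset.range k, (DeltaStar K (φ k) - DeltaStar K (φ l)) =
      (Matrix.of fun k i : Fin j => DeltaStar K (φ k) ^ i.val -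
        (1 - Delta K (φ k)) / (1 - DeltaStar K (φ k)) *
          (DeltaStar K (φ k) / Delta K (φ k)) ^ e * Delta K (φ k) ^ i.val).det := by
  rw [Theta, tau_amp_mul_eq_det hW m hj]
  congr 1
  ext k i
  have hk : k.val < n := by omega
  have hx := hW.x_ne k hk
  have hy := hW.y_ne k hk
  have hp : (DeltaStar K (φ k) / Delta K (φ k)) ^ (n + 1) = 1 := by
    rw [← inv_div, inv_pow, hper k hk, inv_one]
  have h1 : (Delta K (φ k) / DeltaStar K (φ k)) ^ m =
      (DeltaStar K (φ k) / Delta K (φ k)) ^ (n + 1 - m) := by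
    rw [← inv_div (DeltaStar K (φ k)), inv_pow]
    refine inv_eq_of_mul_eq_one_left ?_
    rw [← pow_add, show n + 1 - m + m = n + 1 by omega, hp]
  have h2 : (DeltaStar K (φ k) / Delta K (φ k)) ^ e =
      (DeltaStar K (φ k) / Delta K (φ k)) ^ (j + n + 1 - m) := by
    rw [pow_eq_pow_mod e hp, pow_eq_pow_mod (j + n + 1 - m) hp, he]
  simp only [Matrix.of_apply, cFun]
  rw [h1, h2, show j + n + 1 - m = 1 + (n + 1 - m) + (j - 1) by have := i.isLt; omega, pow_add,
    pow_add, pow_one]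
  ring

/-- For `Θ` the entries are, up to factors of the rows, values of the polynomials
`(h_{e+1} - h_e) / t`, again of the degrees `j - 1, …, 0`. -/
theorem Theta_amp_ne_zero (hK : K ≠ 0) (hW : GenericWaves K φ n)
    (hper : ∀ k < n, (Delta K (φ k) / DeltaStar K (φ k)) ^ (n + 1) = 1) {j : ℕ} (hj : j ≤ n) :
    Theta K φ n j (amp K φ (fun _ => -1) j) ≠ 0 := by
  have h1 := Theta_amp_mul_eq_det hW hper (m := n) (e := j + 1) hj
    (by rw [show j + n + 1 - n = j + 1 by omega]) le_rfl
  refine left_ne_zero_of_mul (b := ∏ k ∈ Finset.range j, ∏ l ∈ Finset.range k,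
    (DeltaStar K (φ k) - DeltaStar K (φ l))) ?_
  rw [h1]
  have h2 : (Matrix.of fun k i : Fin j => DeltaStar K (φ k) ^ i.val -
        (1 - Delta K (φ k)) / (1 - DeltaStar K (φ k)) *
          (DeltaStar K (φ k) / Delta K (φ k)) ^ (j + 1) * Delta K (φ k) ^ i.val) =
      Matrix.of fun k i : Fin j =>
        (DeltaStar K (φ k) ^ (j + 1) / (1 - DeltaStar K (φ k)) *
          ((DeltaStar K (φ k))⁻¹ - (Delta K (φ k))⁻¹) * (Lam K (φ k))⁻¹) *
          (divX (hSym K (j + 1 - i) - hSym K (j - i))).eval (Lam K (φ k))⁻¹ := by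
    ext k i
    have hk : k.val < n := by omega
    have hx := hW.x_ne k hk
    have hy := hW.y_ne k hk
    have hy1 := hW.one_sub_y k hk
    obtain ⟨e, he⟩ : ∃ e, j = i.val + (e + 1) := ⟨j - i - 1, by omega⟩
    have hdiv : (Lam K (φ k))⁻¹ * (divX (hSym K (e + 2) - hSym K (e + 1))).eval (Lam K (φ k))⁻¹ =
        (hSym K (e + 2)).eval (Lam K (φ k))⁻¹ - (hSym K (e + 1)).eval (Lam K (φ k))⁻¹ := by
      have h3 := congrArg (eval (Lam K (φ k))⁻¹) (X_mul_divX_add (hSym K (e + 2) - hSym K (e + 1)))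
      rw [coeff_sub, hSym_coeff_zero, hSym_coeff_zero, sub_self, C_0, add_zero, eval_mul, eval_X,
        eval_sub] at h3
      exact h3
    simp only [Matrix.of_apply]
    rw [show j + 1 - i.val = e + 2 by omega, show j - i.val = e + 1 by omega,
      mul_assoc _ (Lam K (φ k))⁻¹, hdiv,
      mul_assoc (DeltaStar K (φ k) ^ (j + 1) / (1 - DeltaStar K (φ k))),
      mul_sub ((DeltaStar K (φ k))⁻¹ - (Delta K (φ k))⁻¹), hSym_eval_inv hW hk,
      hSym_eval_inv hW hk]
    exact pow_mul_inv_sub_inv_succ hx hy hy1 (by omega)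
  rw [h2]
  refine det_eval_ne_zero j (fun i => divX (hSym K (j + 1 - i) - hSym K (j - i)))
    (fun k => (Lam K (φ k))⁻¹)
    (fun k => DeltaStar K (φ k) ^ (j + 1) / (1 - DeltaStar K (φ k)) *
          ((DeltaStar K (φ k))⁻¹ - (Delta K (φ k))⁻¹) * (Lam K (φ k))⁻¹)
    (Lam_inv_inj hW hj)
    (fun k hk => mul_ne_zero (mul_ne_zero (div_ne_zero (pow_ne_zero _ (hW.y_ne k (by omega)))
      (hW.one_sub_y k (by omega))) (inv_sub_inv_ne_zero hW (by omega)))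
      (inv_ne_zero (Lam_ne_zero hW (by omega)))) ?_ ?_ ?_ ?_
  · intro i hi l hl
    rw [coeff_divX, coeff_sub, show j + 1 - i = (j - i) + 1 by omega,
      show j - i = (j - 1 - i) + 1 by omega, (hSym_coeff K _).2 _ (by omega),
      (hSym_coeff K _).2 _ (by omega), sub_zero]
  · intro i hi
    rw [coeff_divX, coeff_sub, show j + 1 - i = (j - 1 - i + 1) + 1 by omega,
      show j - i = (j - 1 - i) + 1 by omega, (hSym_coeff K _).1,
      (hSym_coeff K _).2 _ (by omega), sub_zero]
    exact pow_ne_zero _ (neg_ne_zero.2 hK)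
  · intro i hi _ i' hi' hii'
    rw [coeff_divX, coeff_sub, show j + 1 - i' = (j - i') + 1 by omega,
      show j - i' = (j - 1 - i') + 1 by omega, (hSym_coeff K _).2 _ (by omega),
      (hSym_coeff K _).2 _ (by omega), sub_zero]
  · intro i hi hji
    omega

/-- With all the solitons present no `Θ_m` with `m < n` vanishes. The polynomials are triangular
in two different senses to the left and to the right of the column `n - m`. -/
theorem Theta_amp_full_ne_zero (hK : K ≠ 0) (hW : GenericWaves K φ n)
    (hper : ∀ k < n, (Delta K (φ k) / DeltaStar K (φ k)) ^ (n + 1) = 1) {m : ℕ} (hm : m < n) :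
    Theta K φ m n (amp K φ (fun _ => -1) n) ≠ 0 := by
  have h1 := Theta_amp_mul_eq_det hW hper (m := m) (e := n - m) le_rfl
    (by rw [show n + n + 1 - m = (n - m) + (n + 1) by omega, Nat.add_mod_right]) hm.le
  refine left_ne_zero_of_mul (b := ∏ k ∈ Finset.range n, ∏ l ∈ Finset.range k,
    (DeltaStar K (φ k) - DeltaStar K (φ l))) ?_
  rw [h1]
  let p : ℕ → ℂ[X] := fun i => if i < n - m then
      X ^ m * (hSym K (n - m - i) - hSym K (n - m - i - 1))
    else X ^ (n - 1 - i) * hSym K (i - (n - m) + 1) - X ^ (n - i) * hSym K (i - (n - m))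
  have h2 : (Matrix.of fun k i : Fin n => DeltaStar K (φ k) ^ i.val -
        (1 - Delta K (φ k)) / (1 - DeltaStar K (φ k)) *
          (DeltaStar K (φ k) / Delta K (φ k)) ^ (n - m) * Delta K (φ k) ^ i.val) =
      Matrix.of fun k i : Fin n =>
        (DeltaStar K (φ k) ^ (n - m) / (1 - DeltaStar K (φ k)) *
          ((DeltaStar K (φ k))⁻¹ - (Delta K (φ k))⁻¹) * Lam K (φ k) ^ m) *
          (p i).eval (Lam K (φ k))⁻¹ := by
    ext k i
    have hk : k.val < n := by omega
    have hx := hW.x_ne k hk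
    have hy := hW.y_ne k hk
    have hy1 := hW.one_sub_y k hk
    have hL0 := Lam_ne_zero hW hk
    have hv := hSym_eval_inv hW hk
    have hL : Lam K (φ k) = Delta K (φ k) * DeltaStar K (φ k) := rfl
    simp only [Matrix.of_apply, p]
    generalize DeltaStar K (φ k) = y at *
    generalize Delta K (φ k) = x at *
    generalize Lam K (φ k) = L at *
    split_ifs with hi
    · obtain ⟨e, he⟩ : ∃ e, n - m = i.val + (e + 1) := ⟨n - m - i - 1, by omega⟩
      rw [show n - m - i.val = e + 1 by omega, show e + 1 - 1 = e by omega, eval_mul, eval_sub,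
        eval_pow, eval_X]
      have : y ^ (n - m) / (1 - y) * (y⁻¹ - x⁻¹) * L ^ m *
          (L⁻¹ ^ m * ((hSym K (e + 1)).eval L⁻¹ - (hSym K e).eval L⁻¹)) =
          y ^ (n - m) / (1 - y) * ((y⁻¹ - x⁻¹) * (hSym K (e + 1)).eval L⁻¹ -
            (y⁻¹ - x⁻¹) * (hSym K e).eval L⁻¹) := by
        have h3 : L ^ m * L⁻¹ ^ m = 1 := by rw [← mul_pow, mul_inv_cancel₀ hL0, one_pow]
        linear_combination (y ^ (n - m) / (1 - y) * (y⁻¹ - x⁻¹) *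
          ((hSym K (e + 1)).eval L⁻¹ - (hSym K e).eval L⁻¹)) * h3
      rw [this, hv, hv]
      exact pow_mul_inv_sub_inv_succ hx hy hy1 he
    · obtain ⟨s, hs⟩ : ∃ s, i.val = (n - m) + s := ⟨i - (n - m), by omega⟩
      obtain ⟨r, hr⟩ : ∃ r, m = r + 1 + s := ⟨n - 1 - i, by have := i.isLt; omega⟩
      rw [show n - 1 - i.val = r by omega, show n - i.val = r + 1 by omega,
        show i.val - (n - m) = s by omega, eval_sub, eval_mul, eval_mul, eval_pow, eval_pow,
        eval_X]
      have : y ^ (n - m) / (1 - y) * (y⁻¹ - x⁻¹) * L ^ m *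
          (L⁻¹ ^ r * (hSym K (s + 1)).eval L⁻¹ - L⁻¹ ^ (r + 1) * (hSym K s).eval L⁻¹) =
          y ^ (n - m) / (1 - y) * (L ^ (s + 1) * ((y⁻¹ - x⁻¹) * (hSym K (s + 1)).eval L⁻¹) -
            L ^ s * ((y⁻¹ - x⁻¹) * (hSym K s).eval L⁻¹)) := by
        have h3 : L ^ m * L⁻¹ ^ r = L ^ (s + 1) := by
          rw [hr, show r + 1 + s = r + (s + 1) by ring, pow_add, mul_right_comm, ← mul_pow,
            mul_inv_cancel₀ hL0, one_pow, one_mul]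
        have h4 : L ^ m * L⁻¹ ^ (r + 1) = L ^ s := by
          rw [hr, pow_add L, mul_right_comm, ← mul_pow, mul_inv_cancel₀ hL0, one_pow, one_mul]
        linear_combination (y ^ (n - m) / (1 - y) * (y⁻¹ - x⁻¹) * (hSym K (s + 1)).eval L⁻¹) * h3 -
          (y ^ (n - m) / (1 - y) * (y⁻¹ - x⁻¹) * (hSym K s).eval L⁻¹) * h4
      rw [this, hv, hv, hL, mul_pow, mul_pow]
      exact pow_mul_sub_succ hx hy hy1 hs
  rw [h2]
  have hcup : ∀ i < n, i < n - m → ∀ l, (p i).coeff l =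
      if m ≤ l then (hSym K (n - m - i)).coeff (l - m) - (hSym K (n - m - i - 1)).coeff (l - m)
      else 0 := by
    intro i hi him l
    simp only [p, if_pos him, coeff_X_pow_mul', coeff_sub]
  have hclow : ∀ i < n, n - m ≤ i → ∀ l, (p i).coeff l =
      (if n - 1 - i ≤ l then (hSym K (i - (n - m) + 1)).coeff (l - (n - 1 - i)) else 0) -
      if n - i ≤ l then (hSym K (i - (n - m))).coeff (l - (n - i)) else 0 := by
    intro i hi him l
    simp only [p, if_neg (not_lt.2 him), coeff_X_pow_mul', coeff_sub]
  have hdeg0 : ∀ e l, e ≤ l → (hSym K e).coeff l = 0 := by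
    intro e l hl
    cases e with
    | zero => simp [hSym]
    | succ e => exact (hSym_coeff K e).2 l hl
  refine det_eval_ne_zero (n - m) p (fun k => (Lam K (φ k))⁻¹)
    (fun k => DeltaStar K (φ k) ^ (n - m) / (1 - DeltaStar K (φ k)) *
          ((DeltaStar K (φ k))⁻¹ - (Delta K (φ k))⁻¹) * Lam K (φ k) ^ m)
    (Lam_inv_inj hW le_rfl)
    (fun k hk => mul_ne_zero (mul_ne_zero (div_ne_zero (pow_ne_zero _ (hW.y_ne k hk))
      (hW.one_sub_y k hk)) (inv_sub_inv_ne_zero hW hk))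
      (pow_ne_zero _ (Lam_ne_zero hW hk))) ?_ ?_ ?_ ?_
  · intro i hi l hl
    rcases lt_or_ge i (n - m) with him | him
    · rw [hcup i hi him, hdeg0 _ _ (by omega), hdeg0 _ _ (by omega), sub_zero, ite_self]
    · rw [hclow i hi him, hdeg0 _ _ (by omega), hdeg0 _ _ (by omega), ite_self, ite_self, sub_zero]
  · intro i hi
    rcases lt_or_ge i (n - m) with him | him
    · rw [hcup i hi him, if_pos (by omega), hdeg0 (n - m - i - 1) _ (by omega), sub_zero,
        show n - m - i = (n - 1 - i - m) + 1 by omega, (hSym_coeff K _).1]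
      exact pow_ne_zero _ (neg_ne_zero.2 hK)
    · rw [hclow i hi him, if_pos le_rfl, if_neg (by omega), Nat.sub_self, hSym_coeff_zero]
      simp
  · intro i hi him i' hi' hii'
    rcases lt_or_ge i' (n - m) with him' | him'
    · rw [hcup i' hi' him', hdeg0 _ _ (by omega), hdeg0 _ _ (by omega), sub_zero, ite_self]
    · rw [hclow i' hi' him', hdeg0 _ _ (by omega), hdeg0 _ _ (by omega), ite_self, ite_self,
        sub_zero]
  · intro i hi him i' hii'
    rcases lt_or_ge i' (n - m) with him' | him'
    · rw [hcup i' (by omega) him', if_neg (by omega)]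
    · rw [hclow i' (by omega) him', if_neg (by omega), if_neg (by omega), sub_zero]

/-! ### Continuity in the amplitudes -/

theorem tendsto_tau {f : ℕ → ℕ → ℂ} {g : ℕ → ℂ} (m : ℕ) {j : ℕ}
    (hf : ∀ k < j, Tendsto (fun ν => f ν k) atTop (𝓝 (g k))) :
    Tendsto (fun ν => tau K φ m j (f ν)) atTop (𝓝 (tau K φ m j g)) := by
  induction j generalizing f g with
  | zero => exact tendsto_const_nhds
  | succ j ih =>
    simp only [tau]
    exact (ih fun k hk => hf k (by omega)).add (((hf j (by omega)).mul_const _).mul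
      (ih fun k hk => (hf k (by omega)).const_mul _))

theorem tendsto_amp {f : ℕ → ℕ → ℂ} {g : ℕ → ℂ} {k : ℕ} (j : ℕ)
    (hf : Tendsto (fun ν => f ν k) atTop (𝓝 (g k))) :
    Tendsto (fun ν => amp K φ (f ν) j k) atTop (𝓝 (amp K φ g j k)) := by
  simp only [amp]
  exact hf.mul_const _

theorem tendsto_Theta {f : ℕ → ℕ → ℂ} {g : ℕ → ℂ} (m : ℕ) {j : ℕ}
    (hf : ∀ k < j, Tendsto (fun ν => f ν k) atTop (𝓝 (g k))) :
    Tendsto (fun ν => Theta K φ m j (f ν)) atTop (𝓝 (Theta K φ m j g)) :=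
  tendsto_tau m fun k hk => (hf k hk).const_mul _

end Values

/-! ### The entries of the monodromy matrix of an open chain -/

section Chain
open Polynomial
variable {S O : Type*} [CommRing S] [Ring O] [Algebra S O]

/-- `G p = ℓ_p ℓ_{p+1} ⋯ ℓ_n` for `p ≤ n + 1`. -/
def IsChain (h κ : S) (u w : ℕ → O) (n : ℕ) (G : ℕ → Matrix (Fin 2) (Fin 2) O[X]) : Prop :=
  G (n + 1) = 1 ∧ ∀ p ≤ n, G p = laxPoly h κ (u p) (w p) * G (p + 1)

/-- The commutation relations of the Weyl pairs of a chain, together with inverses `v`, `wi`. -/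
structure WeylChain (h : S) (u v w wi : ℕ → O) (n : ℕ) : Prop where
  uw : ∀ p ≤ n, u p * w p = h ^ 2 • (w p * u p)
  uv : ∀ p ≤ n, u p * v p = 1
  vu : ∀ p ≤ n, v p * u p = 1
  wwi : ∀ p ≤ n, w p * wi p = 1
  wiw : ∀ p ≤ n, wi p * w p = 1
  vu_comm : ∀ p ≤ n, ∀ q ≤ n, p ≠ q → Commute (v p) (u q)
  vw_comm : ∀ p ≤ n, ∀ q ≤ n, p ≠ q → Commute (v p) (w q)
  uw_comm : ∀ p ≤ n, ∀ q ≤ n, p ≠ q → Commute (u p) (w q)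
  uu_comm : ∀ p ≤ n, ∀ q ≤ n, p ≠ q → Commute (u p) (u q)
  ww_comm : ∀ p ≤ n, ∀ q ≤ n, p ≠ q → Commute (w p) (w q)

variable {h κ : S} {u v w wi : ℕ → O} {n : ℕ} {G : ℕ → Matrix (Fin 2) (Fin 2) O[X]}

theorem IsChain.zero_row (hG : IsChain h κ u w n G) {p : ℕ} (hp : p ≤ n) (j : Fin 2) :
    G p 0 j = G (p + 1) 0 j + C (κ • (u p * w p)) * (X * G (p + 1) 0 j) -
      C (h • u p) * (X * G (p + 1) 1 j) := by
  rw [hG.2 p hp, Matrix.mul_apply, Fin.sum_univ_two]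
  simp only [laxPoly, Matrix.of_apply, Matrix.cons_val', Matrix.cons_val_zero, Matrix.cons_val_one,
    Matrix.cons_val_fin_one, add_mul, one_mul, neg_mul, mul_assoc, sub_eq_add_neg]

theorem IsChain.one_row (hG : IsChain h κ u w n G) {p : ℕ} (hp : p ≤ n) (j : Fin 2) :
    G p 1 j = C (w p) * G (p + 1) 0 j := by
  rw [hG.2 p hp, Matrix.mul_apply, Fin.sum_univ_two]
  simp [laxPoly]

theorem IsChain.last_zero (hG : IsChain h κ u w n G) (j : Fin 2) :
    G (n + 1) 0 j = if j = 0 then 1 else 0 := by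
  rw [hG.1]; fin_cases j <;> simp [Matrix.one_apply]

theorem IsChain.last_one (hG : IsChain h κ u w n G) (j : Fin 2) :
    G (n + 1) 1 j = if j = 0 then 0 else 1 := by
  rw [hG.1]; fin_cases j <;> simp [Matrix.one_apply]

theorem IsChain.coeff_zero_row (hG : IsChain h κ u w n G) {p : ℕ} (hp : p ≤ n) (j : Fin 2) (l : ℕ) :
    (G p 0 j).coeff (l + 1) = (G (p + 1) 0 j).coeff (l + 1) +
      κ • (u p * w p * (G (p + 1) 0 j).coeff l) - h • (u p * (G (p + 1) 1 j).coeff l) := by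
  rw [hG.zero_row hp, coeff_sub, coeff_add, coeff_C_mul, coeff_C_mul, coeff_X_mul, coeff_X_mul,
    smul_mul_assoc, smul_mul_assoc]

theorem IsChain.coeff_zero_row_zero (hG : IsChain h κ u w n G) {p : ℕ} (hp : p ≤ n) (j : Fin 2) :
    (G p 0 j).coeff 0 = (G (p + 1) 0 j).coeff 0 := by
  rw [hG.zero_row hp, coeff_sub, coeff_add, coeff_C_mul, coeff_C_mul, mul_coeff_zero,
    mul_coeff_zero]
  simp

theorem IsChain.constantCoeff (hG : IsChain h κ u w n G) {p : ℕ} (hp : p ≤ n + 1) :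
    (G p 0 0).coeff 0 = 1 := by
  induction hp using Nat.decreasingInduction with
  | self => rw [hG.last_zero]; simp
  | of_succ p hp ih => rw [hG.coeff_zero_row_zero (by omega), ih]

theorem IsChain.constantCoeff_one (hG : IsChain h κ u w n G) {p : ℕ} (hp : p ≤ n) :
    (G p 1 0).coeff 0 = w p := by
  rw [hG.one_row hp, coeff_C_mul, hG.constantCoeff (by omega), mul_one]

/-- The first row of `G p` has degree at most `n + 1 - p`, the second row a smaller degree. -/
theorem IsChain.coeff_eq_zero (hG : IsChain h κ u w n G) (j : Fin 2) {p : ℕ} (hp : p ≤ n) :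
    (∀ l, n + 1 < p + l → (G p 0 j).coeff l = 0) ∧
    (∀ l, n + 1 ≤ p + l → (G p 1 j).coeff l = 0) := by
  induction hp using Nat.decreasingInduction with
  | self =>
    constructor
    · intro l hl
      obtain ⟨l, rfl⟩ : ∃ l', l = l' + 1 := ⟨l - 1, by omega⟩
      have hl0 : l ≠ 0 := by omega
      rw [hG.coeff_zero_row le_rfl, hG.last_zero, hG.last_one]
      split_ifs <;> simp [coeff_one, hl0]
    · intro l hl
      have hl0 : l ≠ 0 := by omega
      rw [hG.one_row le_rfl, hG.last_zero, coeff_C_mul]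
      split_ifs <;> simp [coeff_one, hl0]
  | of_succ p hp ih =>
    constructor
    · intro l hl
      obtain ⟨l, rfl⟩ : ∃ l', l = l' + 1 := ⟨l - 1, by omega⟩
      rw [hG.coeff_zero_row hp.le, ih.1 _ (by omega), ih.1 _ (by omega), ih.2 _ (by omega)]
      simp
    · intro l hl
      rw [hG.one_row hp.le, coeff_C_mul, ih.1 _ (by omega), mul_zero]

/-- The top coefficient of the upper left entry of `G p`. -/
def topCoeff (G : ℕ → Matrix (Fin 2) (Fin 2) O[X]) (n p : ℕ) : O := (G p 0 0).coeff (n + 1 - p)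

theorem IsChain.topCoeff_last (hG : IsChain h κ u w n G) : topCoeff G n (n + 1) = 1 := by
  rw [topCoeff, Nat.sub_self, hG.constantCoeff le_rfl]

theorem IsChain.topCoeff_eq (hG : IsChain h κ u w n G) {p : ℕ} (hp : p ≤ n) :
    topCoeff G n p = κ • (u p * w p * topCoeff G n (p + 1)) := by
  rw [topCoeff, topCoeff, show n + 1 - p = (n - p) + 1 by omega, hG.coeff_zero_row hp,
    show n + 1 - (p + 1) = n - p by omega]
  rcases hp.lt_or_eq with hlt | rfl
  · rw [(hG.coeff_eq_zero 0 (p := p + 1) hlt).1 _ (by omega),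
      (hG.coeff_eq_zero 0 (p := p + 1) hlt).2 _ (by omega)]
    simp
  · rw [hG.last_zero, hG.last_one]
    simp [coeff_one]

/-- The top coefficient of the upper right entry: it yields the inverse of the last `w`. -/
theorem IsChain.topCoeff_right (hW : WeylChain h u v w wi n) (hG : IsChain h κ u w n G) {p : ℕ}
    (hp : p ≤ n) :
    κ • (G p 0 1).coeff (n + 1 - p) = -(h • (topCoeff G n p * wi n)) := by
  induction hp using Nat.decreasingInduction with
  | self =>
    rw [hG.topCoeff_eq le_rfl, hG.topCoeff_last, show n + 1 - n = 0 + 1 by omega,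
      hG.coeff_zero_row le_rfl, hG.last_zero, hG.last_one]
    simp only [mul_one, one_ne_zero, if_false, coeff_zero, mul_zero, smul_zero, add_zero,
      coeff_one_zero, zero_sub, smul_neg, smul_mul_assoc, mul_assoc, hW.wwi n le_rfl,
      zero_add]
    rw [smul_comm]
  | of_succ p hp ih =>
    rw [hG.topCoeff_eq hp.le, show n + 1 - p = (n - p) + 1 by omega, hG.coeff_zero_row hp.le,
      (hG.coeff_eq_zero 1 (p := p + 1) hp).1 _ (by omega),
      (hG.coeff_eq_zero 1 (p := p + 1) hp).2 _ (by omega), mul_zero, smul_zero, sub_zero, zero_add]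
    rw [show n + 1 - (p + 1) = n - p by omega] at ih
    rw [← mul_smul_comm, ih, smul_mul_assoc, mul_neg, smul_neg, mul_smul_comm, smul_comm κ h]
    simp only [mul_assoc]

/-- An element that commutes with all sites from `q` on commutes with `G q`. -/
theorem IsChain.commute (hG : IsChain h κ u w n G) {q : ℕ} {x : O} (hq : q ≤ n + 1)
    (hu : ∀ r, q ≤ r → r ≤ n → Commute x (u r)) (hw : ∀ r, q ≤ r → r ≤ n → Commute x (w r))
    (i j : Fin 2) : Commute (C x) (G q i j) := by
  revert hu hw i j
  induction hq using Nat.decreasingInduction with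
  | self =>
    intro _ _ i j
    rw [hG.1, Matrix.one_apply]
    split_ifs
    · exact Commute.one_right _
    · exact Commute.zero_right _
  | of_succ q hq ih =>
    intro hu hw i j
    have ih' := ih (fun r hr => hu r (by omega)) (fun r hr => hw r (by omega))
    have hX : Commute (C x) (X : O[X]) := (X_mul_C x).symm
    have hC : ∀ y, Commute x y → Commute (C x) (C y) := fun y hy => by
      simp only [Commute, SemiconjBy, ← C_mul, hy.eq]
    have hu' := hu q le_rfl (by omega)
    have hw' := hw q le_rfl (by omega)
    fin_cases i
    · simp only [Fin.zero_eta]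
      rw [hG.zero_row (by omega)]
      exact ((ih' 0 j).add_right ((hC _ ((hu'.mul_right hw').smul_right κ)).mul_right
        (hX.mul_right (ih' 0 j)))).sub_right
        ((hC _ (hu'.smul_right h)).mul_right (hX.mul_right (ih' 1 j)))
    · simp only [Fin.mk_one]
      rw [hG.one_row (by omega)]
      exact (hC _ hw').mul_right (ih' 0 j)

/-- `V p = v_0 v_1 ⋯ v_p`. -/
def cumV (v : ℕ → O) : ℕ → O
  | 0 => v 0
  | p + 1 => cumV v p * v (p + 1)

/-- `w_0 w_1 ⋯ w_{p-1}`. -/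
def cumW (w : ℕ → O) : ℕ → O
  | 0 => 1
  | p + 1 => cumW w p * w p

theorem cumV_commute {p : ℕ} {x : O} (hx : ∀ q ≤ p, Commute (v q) x) : Commute (cumV v p) x := by
  induction p with
  | zero => exact hx 0 le_rfl
  | succ p ih => exact (ih fun q hq => hx q (by omega)).mul_left (hx _ le_rfl)

/-- The product `V_p` in terms of coefficients of the monodromy matrix. -/
theorem IsChain.cumV_mul_topCoeff (hW : WeylChain h u v w wi n) (hG : IsChain h κ u w n G) {p : ℕ}
    (hp : p ≤ n) :
    cumV v p * topCoeff G n 0 = κ ^ (p + 1) • (cumW w (p + 1) * topCoeff G n (p + 1)) := by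
  -- `B p = u_0 w_0 ⋯ u_{p-1} w_{p-1}`
  obtain ⟨B, hB0, hBs⟩ : ∃ B : ℕ → O, B 0 = 1 ∧ ∀ p, B (p + 1) = B p * (u p * w p) :=
    ⟨fun p => Nat.rec 1 (fun p b => b * (u p * w p)) p, rfl, fun _ => rfl⟩
  have hBc : ∀ p, ∀ x : O, (∀ q < p, Commute x (u q) ∧ Commute x (w q)) → Commute x (B p) := by
    intro p x hx
    induction p with
    | zero => rw [hB0]; exact Commute.one_right _
    | succ p ih =>
      rw [hBs]
      exact (ih fun q hq => hx q (by omega)).mul_right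
        ((hx p (by omega)).1.mul_right (hx p (by omega)).2)
  have hT : ∀ p ≤ n + 1, topCoeff G n 0 = κ ^ p • (B p * topCoeff G n p) := by
    intro p
    induction p with
    | zero => intro _; simp [hB0]
    | succ p ih =>
      intro hp
      rw [ih (by omega), hG.topCoeff_eq (by omega), hBs, mul_smul_comm, smul_smul, ← pow_succ,
        mul_assoc (B p)]
  have hV : ∀ p ≤ n, cumV v p * B (p + 1) = cumW w (p + 1) := by
    intro p
    induction p with
    | zero =>
      intro _
      rw [hBs, hB0, one_mul, cumV, cumW, cumW, one_mul, ← mul_assoc, hW.vu 0 (by omega), one_mul]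
    | succ p ih =>
      intro hp
      have hc : Commute (v (p + 1)) (B (p + 1)) := hBc (p + 1) _ fun q hq =>
        ⟨hW.vu_comm _ hp _ (by omega) (by omega), hW.vw_comm _ hp _ (by omega) (by omega)⟩
      rw [hBs, cumV, cumW, ← ih (by omega)]
      calc cumV v p * v (p + 1) * (B (p + 1) * (u (p + 1) * w (p + 1)))
          = cumV v p * (v (p + 1) * B (p + 1)) * (u (p + 1) * w (p + 1)) := by
            simp only [mul_assoc]
        _ = cumV v p * B (p + 1) * ((v (p + 1) * u (p + 1)) * w (p + 1)) := by
            rw [hc.eq]; simp only [mul_assoc]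
        _ = _ := by rw [hW.vu _ hp, one_mul]
  rw [hT (p + 1) (by omega), mul_smul_comm, ← mul_assoc, hV p hp]

/-- The first `v` in terms of the top coefficient of the lower left entry. -/
theorem IsChain.topCoeff_mul_v (hW : WeylChain h u v w wi n) (hG : IsChain h κ u w n G) :
    topCoeff G n 0 * v 0 = (κ * h ^ 2) • (G 0 1 0).coeff n := by
  have hc : Commute (v 0) (topCoeff G n 1) := by
    have := hG.commute (q := 1) (x := v 0) (by omega)
      (fun r hr hr' => hW.vu_comm _ (by omega) _ hr' (by omega))
      (fun r hr hr' => hW.vw_comm _ (by omega) _ hr' (by omega)) 0 0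
    have := congrArg (fun P => P.coeff n) this.eq
    rw [coeff_C_mul, coeff_mul_C] at this
    exact this
  rw [hG.topCoeff_eq (by omega), hG.one_row (by omega), coeff_C_mul, zero_add, smul_mul_assoc,
    mul_assoc, ← hc.eq, hW.uw 0 (by omega), smul_mul_assoc, mul_assoc, ← mul_assoc (u 0),
    hW.uv 0 (by omega), one_mul, smul_smul]
  rfl

/-- The passage from `G p` to `G (p + 1)` in the lower left entry. -/
theorem IsChain.exchange (hW : WeylChain h u v w wi n) (hG : IsChain h κ u w n G) {p : ℕ}
    (hp : p ≤ n) :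
    h • G (p + 1) 1 0 = (κ * h ^ 2) • G p 1 0 - divX (G p 0 0 - G (p + 1) 0 0) * C (v p) := by
  ext l
  have hcm : ∀ i : Fin 2, ∀ l, v p * (G (p + 1) i 0).coeff l = (G (p + 1) i 0).coeff l * v p := by
    intro i l
    have := hG.commute (q := p + 1) (x := v p) (by omega)
      (fun r hr hr' => hW.vu_comm _ hp _ hr' (by omega))
      (fun r hr hr' => hW.vw_comm _ hp _ hr' (by omega)) i 0
    have := congrArg (fun P => P.coeff l) this.eq
    simpa only [coeff_C_mul, coeff_mul_C] using this
  rw [coeff_smul, coeff_sub, coeff_smul, coeff_mul_C, coeff_divX, coeff_sub, hG.coeff_zero_row hp,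
    hG.one_row hp, coeff_C_mul]
  have e1 : u p * w p * (G (p + 1) 0 0).coeff l * v p =
      h ^ 2 • (w p * (G (p + 1) 0 0).coeff l) := by
    rw [mul_assoc, ← hcm, hW.uw p hp, smul_mul_assoc, mul_assoc, ← mul_assoc (u p), hW.uv p hp,
      one_mul]
  have e2 : u p * (G (p + 1) 1 0).coeff l * v p = (G (p + 1) 1 0).coeff l := by
    rw [mul_assoc, ← hcm, ← mul_assoc, hW.uv p hp, one_mul]
  rw [add_sub_assoc, add_sub_cancel_left, sub_mul, smul_mul_assoc, smul_mul_assoc, e1, e2,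
    smul_smul]
  abel

/-- Quotients that measure how far the lower left entry of the monodromy matrix is from being
constant. -/
def chainQuot (hi : S) (wi : ℕ → O) (G : ℕ → Matrix (Fin 2) (Fin 2) O[X]) : ℕ → O[X]
  | 0 => divX (G 0 0 0 - G 1 0 0)
  | p + 1 => hi • (C (wi (p + 1)) *
      divX (chainQuot hi wi G p - C ((chainQuot hi wi G p).coeff 0) * G (p + 1) 0 0))

theorem divX_C_mul_left (c : O) (P : O[X]) : divX (C c * P) = C c * divX P := by
  ext l; simp only [coeff_divX, coeff_C_mul]

theorem divX_mul_C_right (c : O) (P : O[X]) : divX (P * C c) = divX P * C c := by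
  ext l; simp only [coeff_divX, coeff_mul_C]

theorem IsChain.chainQuot_mul_cumV {hi : S} (hhi : hi * h = 1) (hW : WeylChain h u v w wi n)
    (hG : IsChain h κ u w n G) {p : ℕ} (hp : p ≤ n) :
    chainQuot hi wi G p * C (cumV v p) = divX (G p 0 0 - G (p + 1) 0 0) * C (v p) := by
  induction p with
  | zero => rfl
  | succ p ih =>
    set D := chainQuot hi wi G p with hD
    have e1 : h • G (p + 1) 1 0 = (κ * h ^ 2) • G p 1 0 - D * C (cumV v p) := by
      rw [ih (by omega), hG.exchange hW (by omega)]
    have e2 : h • w (p + 1) = (κ * h ^ 2) • w p - D.coeff 0 * cumV v p := by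
      have := congrArg (fun P => P.coeff 0) e1
      simpa only [coeff_smul, coeff_sub, coeff_mul_C, hG.constantCoeff_one hp,
        hG.constantCoeff_one (show p ≤ n by omega)] using this
    have hcm : Commute (C (cumV v p)) (G (p + 1) 0 0) :=
      hG.commute (by omega)
        (fun r hr hr' => cumV_commute fun q hq => hW.vu_comm _ (by omega) _ hr' (by omega))
        (fun r hr hr' => cumV_commute fun q hq => hW.vw_comm _ (by omega) _ hr' (by omega)) 0 0
    have e3 : C (h • w (p + 1)) * (G (p + 1) 0 0 - G (p + 2) 0 0) =
        (D - C (D.coeff 0) * G (p + 1) 0 0) * C (cumV v p) := by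
      have l1 : C (h • w (p + 1)) * G (p + 2) 0 0 = h • G (p + 1) 1 0 := by
        rw [hG.one_row hp, ← smul_C, smul_mul_assoc]
      have l2 : C (h • w (p + 1)) * G (p + 1) 0 0 =
          (κ * h ^ 2) • G p 1 0 - C (D.coeff 0) * G (p + 1) 0 0 * C (cumV v p) := by
        rw [e2, C_sub, C_mul, sub_mul, mul_assoc, hcm.eq, ← smul_C, smul_mul_assoc,
          hG.one_row (show p ≤ n by omega), mul_assoc]
      rw [mul_sub, l1, l2, e1, sub_mul]
      abel
    have e4 := congrArg divX e3
    rw [divX_mul_C_right, divX_C_mul_left] at e4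
    rw [chainQuot, cumV, C_mul, ← mul_assoc, smul_mul_assoc, mul_assoc (C (wi (p + 1))), ← e4,
      ← smul_C]
    simp only [smul_mul_assoc, mul_smul_comm, smul_smul, hhi, one_smul]
    rw [← mul_assoc, ← C_mul, hW.wiw _ hp, C_1, one_mul]

/-- The lower left entries of the partial products agree up to multiples of `V_p`. As `G n 1 0` is
constant, this bounds the other coefficients of `G 0 1 0`. -/
theorem IsChain.lower_recursion {hi : S} (hhi : hi * h = 1) (hW : WeylChain h u v w wi n)
    (hG : IsChain h κ u w n G) {p : ℕ} (hp : p ≤ n) :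
    h • G (p + 1) 1 0 = (κ * h ^ 2) • G p 1 0 - chainQuot hi wi G p * C (cumV v p) := by
  rw [hG.chainQuot_mul_cumV hhi hW hp, hG.exchange hW hp]

end Chain

/-! ### Transporters of submodules -/

section Transporter
open Polynomial
variable {S O : Type*} [CommRing S] [Ring O] [Algebra S O]

/-- The elements that carry the submodule `P` into `P'` by right multiplication. -/
def transporter (P P' : Submodule S O) : Submodule S O where
  carrier := {y | ∀ p ∈ P, p * y ∈ P'}
  add_mem' ha hb p hp := by rw [mul_add]; exact P'.add_mem (ha p hp) (hb p hp)
  zero_mem' p _ := by rw [mul_zero]; exact P'.zero_mem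
  smul_mem' c y hy p hp := by rw [mul_smul_comm]; exact P'.smul_mem c (hy p hp)

variable {P P' P'' : Submodule S O}

theorem mul_mem_transporter {x y : O} (hx : x ∈ transporter P P') (hy : y ∈ transporter P' P'') :
    x * y ∈ transporter P P'' := fun p hp => by rw [← mul_assoc]; exact hy _ (hx p hp)

theorem one_mem_transporter : (1 : O) ∈ transporter P P := fun p hp => by rwa [mul_one]

theorem pow_mem_transporter {x : O} (hx : x ∈ transporter P P) (i : ℕ) :
    x ^ i ∈ transporter P P := by
  induction i with
  | zero => rw [pow_zero]; exact one_mem_transporter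
  | succ i ih => rw [pow_succ]; exact mul_mem_transporter ih hx

/-- All coefficients of the polynomial `A` lie in `Y`. -/
def CoeffsIn (Y : Submodule S O) (A : O[X]) : Prop := ∀ l, A.coeff l ∈ Y

variable {Y : Submodule S O} {A B : O[X]}

theorem CoeffsIn.add (hA : CoeffsIn Y A) (hB : CoeffsIn Y B) : CoeffsIn Y (A + B) := fun l => by
  rw [coeff_add]; exact Y.add_mem (hA l) (hB l)

theorem CoeffsIn.sub (hA : CoeffsIn Y A) (hB : CoeffsIn Y B) : CoeffsIn Y (A - B) := fun l => by
  rw [coeff_sub]; exact Y.sub_mem (hA l) (hB l)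

theorem CoeffsIn.neg (hA : CoeffsIn Y A) : CoeffsIn Y (-A) := fun l => by
  rw [coeff_neg]; exact Y.neg_mem (hA l)

theorem CoeffsIn.smul (c : S) (hA : CoeffsIn Y A) : CoeffsIn Y (c • A) := fun l => by
  rw [coeff_smul]; exact Y.smul_mem c (hA l)

theorem CoeffsIn.mul_X (hA : CoeffsIn Y A) : CoeffsIn Y (A * X) := fun l => by
  cases l with
  | zero => rw [coeff_mul_X_zero]; exact Y.zero_mem
  | succ l => rw [coeff_mul_X]; exact hA l

theorem CoeffsIn.divX (hA : CoeffsIn Y A) : CoeffsIn Y (divX A) := fun l => by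
  rw [coeff_divX]; exact hA _

theorem CoeffsIn.C {y : O} (hy : y ∈ Y) : CoeffsIn Y (C y) := fun l => by
  rw [coeff_C]; split_ifs; exacts [hy, Y.zero_mem]

theorem CoeffsIn.mul_C {y : O} (hA : CoeffsIn (transporter P P') A) (hy : y ∈ transporter P' P'') :
    CoeffsIn (transporter P P'') (A * Polynomial.C y) := fun l => by
  rw [coeff_mul_C]; exact mul_mem_transporter (hA l) hy

theorem CoeffsIn.C_mul {y : O} (hy : y ∈ transporter P P') (hA : CoeffsIn (transporter P' P'') A) :
    CoeffsIn (transporter P P'') (Polynomial.C y * A) := fun l => by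
  rw [coeff_C_mul]; exact mul_mem_transporter hy (hA l)

theorem coeff_one_sub_mul (lam : S) (l : ℕ) :
    ((1 - Polynomial.C (algebraMap S O lam) * X) * A).coeff (l + 1) =
      A.coeff (l + 1) - lam • A.coeff l := by
  rw [sub_mul, one_mul, mul_assoc, coeff_sub, coeff_C_mul, coeff_X_mul, Algebra.smul_def]

/-- Division by `1 - λ X` does not leave `Y`. -/
theorem CoeffsIn.of_one_sub_mul {lam : S}
    (hA : CoeffsIn Y ((1 - Polynomial.C (algebraMap S O lam) * X) * A)) :
      CoeffsIn Y A := fun l => by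
  induction l with
  | zero =>
    have := hA 0
    rwa [sub_mul, one_mul, mul_assoc, coeff_sub, coeff_C_mul, coeff_X_mul_zero, mul_zero,
      sub_zero] at this
  | succ l ih =>
    have := hA (l + 1)
    rw [coeff_one_sub_mul] at this
    have := Y.add_mem this (Y.smul_mem lam ih)
    rwa [sub_add_cancel] at this

theorem CoeffsIn.evalAt_mem (hA : CoeffsIn Y A) (x : S) : evalAt x A ∈ Y := by
  rw [evalAt_eq_sum x A (Nat.lt_succ_self _)]
  exact Submodule.sum_mem _ fun l _ => Y.smul_mem _ (hA l)

/-! ### Regularity along an open chain -/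

variable {h κ hi ki : S} {u v w wi : ℕ → O} {n N : ℕ} {G : ℕ → Matrix (Fin 2) (Fin 2) O[X]}

/-- If the first column of the monodromy matrix is regular for `P`, then the first columns of
all the partial monodromy matrices and the quotients `chainQuot` are so. -/
theorem IsChain.regular (hhi : hi * h = 1) (hW : WeylChain h u v w wi n) (hG : IsChain h κ u w n G)
    (hM : ∀ i, CoeffsIn (transporter P P) (G 0 i 0)) {ainv : O}
    (ha : topCoeff G n 0 * ainv = 1) (hai : ainv ∈ transporter P P) (s : ℕ → S)
    (hwi : ∀ p < n, wi p = s p • w p ^ (N - 1)) {p : ℕ} (hp : p ≤ n) :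
    (∀ i, CoeffsIn (transporter P P) (G p i 0)) ∧ cumW w p ∈ transporter P P ∧
      (p < n → CoeffsIn (transporter P P) (chainQuot hi wi G p)) := by
  have hwr : ∀ p ≤ n, CoeffsIn (transporter P P) (G p 1 0) → w p ∈ transporter P P :=
    fun p hp hc => hG.constantCoeff_one hp ▸ hc 0
  have hwir : ∀ p < n, CoeffsIn (transporter P P) (G p 1 0) → wi p ∈ transporter P P :=
    fun p hp hc => hwi p hp ▸ Submodule.smul_mem _ _ (pow_mem_transporter (hwr p hp.le hc) _)
  have hnext : ∀ p < n, CoeffsIn (transporter P P) (G p 1 0) →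
      CoeffsIn (transporter P P) (G (p + 1) 0 0) := fun p hp hc => by
    have : G (p + 1) 0 0 = C (wi p) * G p 1 0 := by
      rw [hG.one_row hp.le, ← mul_assoc, ← C_mul, hW.wiw p hp.le, C_1, one_mul]
    rw [this]
    exact CoeffsIn.C_mul (hwir p hp hc) hc
  induction p with
  | zero =>
    exact ⟨hM, one_mem_transporter, fun hn => ((hM 0).sub (hnext 0 hn (hM 1))).divX⟩
  | succ p ih =>
    obtain ⟨h1, h2, h3⟩ := ih (by omega)
    have h3 := h3 (by omega)
    have hc := hnext p (by omega) (h1 1)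
    have hcW : cumW w (p + 1) ∈ transporter P P := mul_mem_transporter h2 (hwr p (by omega) (h1 1))
    have hV : cumV v p ∈ transporter P P := by
      have := congrArg (· * ainv) (hG.cumV_mul_topCoeff hW (p := p) (by omega))
      simp only [mul_assoc, ha, mul_one] at this
      rw [this]
      rw [smul_mul_assoc]
      exact Submodule.smul_mem _ _ (mul_mem_transporter (mul_mem_transporter hcW (hc _)) hai)
    have hd : CoeffsIn (transporter P P) (G (p + 1) 1 0) := by
      have : G (p + 1) 1 0 = hi • (h • G (p + 1) 1 0) := by rw [smul_smul, hhi, one_smul]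
      rw [this, hG.lower_recursion hhi hW (by omega)]
      exact (((h1 1).smul _).sub (h3.mul_C hV)).smul _
    refine ⟨fun i => by fin_cases i; exacts [hc, hd], hcW, fun hlt => ?_⟩
    exact (CoeffsIn.C_mul (hwir _ hlt hd) (h3.sub (CoeffsIn.C_mul (h3 0) hc)).divX).smul _

/-- The coefficients of the lower left entry, apart from the constant one, are combinations of
`V_0, …, V_{n-1}` with regular coefficients. -/
theorem IsChain.lower_coeff_mem (hhi : hi * h = 1) (hki : ki * (κ * h ^ 2) = 1)
    (hW : WeylChain h u v w wi n)
    (hG : IsChain h κ u w n G) (hM : ∀ i, CoeffsIn (transporter P P) (G 0 i 0)) {ainv : O}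
    (ha : topCoeff G n 0 * ainv = 1) (hai : ainv ∈ transporter P P) (s : ℕ → S)
    (hwi : ∀ p < n, wi p = s p • w p ^ (N - 1))
    (hV : ∀ p < n, cumV v p ∈ transporter P P') {l : ℕ} (hl : l ≠ 0) :
    (G 0 1 0).coeff l ∈ transporter P P' := by
  suffices ∀ p ≤ n, (G p 1 0).coeff l ∈ transporter P P' from this 0 (Nat.zero_le n)
  intro p hp
  induction hp using Nat.decreasingInduction with
  | self =>
    rw [hG.one_row le_rfl, hG.last_zero, if_pos rfl, coeff_C_mul, coeff_one, if_neg hl, mul_zero]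
    exact Submodule.zero_mem _
  | of_succ p hp ih =>
    have e := congrArg (fun A => ki • A.coeff l) (hG.lower_recursion hhi hW (p := p) (by omega))
    simp only [coeff_sub, coeff_smul, coeff_mul_C, smul_sub, smul_smul, hki, one_smul] at e
    rw [eq_comm, sub_eq_iff_eq_add] at e
    rw [e]
    exact Submodule.add_mem _ (Submodule.smul_mem _ _ ih) (Submodule.smul_mem _ _
      (mul_mem_transporter ((hG.regular hhi hW hM ha hai s hwi hp.le).2.2 hp l) (hV p hp)))

end Transporter

/-! ### Regularity and negligibility across one operator of the product -/

section Step
open Polynomial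
variable {S O : Type*} [CommRing S] [Ring O] [Algebra S O]

/-- The span of the products `p Q V^i` with `p ∈ P`. -/
def nextPref (P : Submodule S O) (Q V : O) : Submodule S O :=
  Submodule.span S {y | ∃ p ∈ P, ∃ i : ℕ, y = p * (Q * V ^ i)}

variable {P P' : Submodule S O} {Q V : O}

theorem mul_mem_nextPref {p : O} (hp : p ∈ P) (i : ℕ) : p * (Q * V ^ i) ∈ nextPref P Q V :=
  Submodule.subset_span ⟨p, hp, i, rfl⟩

theorem mem_transporter_nextPref {z : O} :
    z ∈ transporter (nextPref P Q V) P' ↔ ∀ i : ℕ, Q * V ^ i * z ∈ transporter P P' := by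
  constructor
  · intro hz i p hp
    rw [← mul_assoc]
    exact hz _ (mul_mem_nextPref hp i)
  · intro hz y hy
    induction hy using Submodule.span_induction with
    | mem y hy =>
      obtain ⟨p, hp, i, rfl⟩ := hy
      rw [mul_assoc]
      exact hz i p hp
    | zero => rw [zero_mul]; exact P'.zero_mem
    | add a b _ _ ha hb => rw [add_mul]; exact P'.add_mem ha hb
    | smul c a _ ha => rw [smul_mul_assoc]; exact P'.smul_mem c ha

theorem mul_pow_mem_transporter (i : ℕ) : Q * V ^ i ∈ transporter P (nextPref P Q V) :=
  fun _ hp => mul_mem_nextPref hp i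

variable {h hi k lam ct ri rr : S} {π : O} {q : ℕ → O} {M M' : Matrix (Fin 2) (Fin 2) O[X]}

theorem exchange_mem {Y : Submodule S O} (hq : ∀ e, q e ∈ Y) (hπ : ∀ y ∈ Y, π * y ∈ Y) (e : ℕ) :
    exchangeR h k ct π q e ∈ Y ∧ exchangeS h k ct π q e ∈ Y := by
  have hR : ∀ e, exchangeR h k ct π q e ∈ Y := fun e =>
    Y.smul_mem _ (Y.add_mem (Y.smul_mem _ (hq e)) (Y.smul_mem _ (hπ _ (hq _))))
  refine ⟨hR e, ?_⟩
  cases e with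
  | zero => exact Y.smul_mem _ (hπ _ (hq _))
  | succ e => exact Y.sub_mem (Y.smul_mem _ (hR e)) (Y.smul_mem _ (hq e))

theorem coeffsIn_exchangeLPoly {Y : Submodule S O} (hq : ∀ e, q e ∈ Y) (hπ : ∀ y ∈ Y, π * y ∈ Y)
    (e : ℕ) (i r : Fin 2) : CoeffsIn Y (exchangeLPoly h hi k lam ct π q e i r) := by
  have h1 := exchange_mem (h := h) (k := k) (ct := ct) hq hπ e
  fin_cases i <;> fin_cases r <;> simp [exchangeLPoly]
  · exact (CoeffsIn.C h1.1).sub (CoeffsIn.C (Y.smul_mem _ (hq e))).mul_X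
  · exact (CoeffsIn.C (Y.smul_mem _ h1.2)).mul_X.neg
  · exact (CoeffsIn.C (Y.smul_mem _ (hq _))).neg
  · exact CoeffsIn.C (hq e)

theorem CoeffsIn.mul {A B : O[X]} (hA : CoeffsIn (transporter P P) A)
    (hB : CoeffsIn (transporter P P') B) : CoeffsIn (transporter P P') (A * B) := fun l => by
  rw [coeff_mul]
  exact Submodule.sum_mem _ fun x _ => mul_mem_transporter (hA _) (hB _)

/-- The recurrence expressing `q e` through the sums `h k q e + ct π q (e + 1)`. -/
theorem telescope_exchange (N : ℕ) (e : ℕ) :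
    ∑ i ∈ Finset.range N, ((h * k) ^ (N - 1 - i) * (-ct) ^ i) •
      (π ^ i * ((h * k) • q (e + i) + ct • (π * q (e + i + 1)))) =
    (h * k) ^ N • q e - (-ct) ^ N • (π ^ N * q (e + N)) := by
  have key : ∀ m ≤ N, ∑ i ∈ Finset.range m, ((h * k) ^ (N - 1 - i) * (-ct) ^ i) •
      (π ^ i * ((h * k) • q (e + i) + ct • (π * q (e + i + 1)))) =
      (h * k) ^ N • q e - ((h * k) ^ (N - m) * (-ct) ^ m) • (π ^ m * q (e + m)) := by
    intro m
    induction m with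
    | zero => intro _; simp
    | succ m ih =>
      intro hm
      rw [Finset.sum_range_succ, ih (by omega), mul_add, smul_add, mul_smul_comm, mul_smul_comm,
        smul_smul, smul_smul, ← mul_assoc (π ^ m), ← pow_succ π,
          show N - (m + 1) = N - 1 - m by omega,
        show N - m = (N - 1 - m) + 1 by omega, pow_succ (h * k), pow_succ (-ct), ← add_assoc e m 1]
      have e1 : (h * k) ^ (N - 1 - m) * (-ct) ^ m * (h * k) =
        (h * k) ^ (N - 1 - m) * (h * k) * (-ct) ^ m := by ring
      have e2 : (h * k) ^ (N - 1 - m) * ((-ct) ^ m * -ct) =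
        -((h * k) ^ (N - 1 - m) * (-ct) ^ m * ct) := by ring
      rw [e1, e2, neg_smul]
      abel
  rw [key N le_rfl, Nat.sub_self, pow_zero, one_mul]

/-- Regularity is inherited across one operator of the product. -/
theorem StepRel.regular {N : ℕ} {v pn γ : S} (hhi : hi * h = 1) (hrr : rr * ri = 1)
    (hq : ∀ e, q e = ri ^ e • (Q * V ^ e)) (hV : V ^ N = algebraMap S O v)
    (hπN : π ^ N = algebraMap S O pn)
    (hγ : γ * ((h * k) ^ N - (-ct) ^ N * pn * ri ^ N * v) = 1)
    (hs : StepRel h hi k lam ct π q M M') (hM : ∀ i j, CoeffsIn (transporter P P) (M i j))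
    (hπ : π ∈ transporter P P) (i j : Fin 2) :
    CoeffsIn (transporter (nextPref P Q V) (nextPref P Q V)) (M' i j) := by
  set W := transporter P (nextPref P Q V) with hW
  have hqW : ∀ e, q e ∈ W := fun e => hq e ▸ W.smul_mem _ (mul_pow_mem_transporter e)
  have hπW : ∀ y ∈ W, π * y ∈ W := fun y hy => mul_mem_transporter hπ hy
  have hL : ∀ e i r, CoeffsIn W (exchangeLPoly h hi k lam ct π q e i r) :=
    coeffsIn_exchangeLPoly hqW hπW
  have hCL : ∀ e i r, CoeffsIn W (C π * exchangeLPoly h hi k lam ct π q e i r) := fun e i r =>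
    CoeffsIn.C_mul hπ (hL e i r)
  have hsum : ∀ F : Fin 2 → O[X], (∀ r, CoeffsIn W (F r)) → CoeffsIn W (∑ r, F r) := fun F hF => by
    rw [Fin.sum_univ_two]; exact (hF 0).add (hF 1)
  have hR : ∀ e, CoeffsIn W (C (exchangeR h k ct π q e) * M' i j) := by
    intro e
    apply CoeffsIn.of_one_sub_mul (lam := lam)
    fin_cases j
    · refine (hs e i).1 ▸ hsum _ fun r => ?_
      exact ((hM r 0).mul (hL e i r)).add (((hM r 1).mul (hL _ i r)).smul _)
    · refine (hs e i).2 ▸ hsum _ fun r => ?_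
      exact ((((hM r 0).mul (hCL e i r)).mul_X).smul _).add
        (((((hM r 1).mul (hL e i r)).smul _).sub ((((hM r 1).mul (hL e i r)).mul_X).smul _)).add
          (((hM r 1).mul (hCL _ i r)).smul _))
  intro l
  set z := (M' i j).coeff l with hz
  obtain ⟨δ, hδ⟩ : ∃ δ, δ = (h * k) ^ N - (-ct) ^ N * pn * ri ^ N * v := ⟨_, rfl⟩
  rw [← hδ] at hγ
  have hr : ∀ e, ((h * k) • q e + ct • (π * q (e + 1))) * z ∈ W := by
    intro e
    have h1 := W.smul_mem ((hi ^ 2) ^ e) (hR e l)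
    rwa [coeff_C_mul, exchangeR, smul_mul_assoc, smul_smul, ← mul_pow, ← mul_pow, hhi, one_pow,
      one_pow, one_smul] at h1
  have hqz : ∀ e, q e * z ∈ W := by
    intro e
    have h1 : (h * k) ^ N • q e - (-ct) ^ N • (π ^ N * q (e + N)) =
        δ • q e := by
      rw [hδ, hπN, ← Algebra.smul_def, hq (e + N), hq e, pow_add V, hV, pow_add ri, ← mul_assoc,
        ← Algebra.commutes, ← Algebra.smul_def, sub_smul]
      simp only [smul_smul]
      congr 2
      ring
    have h2 : q e * z = γ • ∑ i ∈ Finset.range N, ((h * k) ^ (N - 1 - i) * (-ct) ^ i) •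
        (π ^ i * (((h * k) • q (e + i) + ct • (π * q (e + i + 1))) * z)) := by
      have h3 := telescope_exchange (h := h) (k := k) (ct := ct) (π := π) (q := q) N e
      rw [h1] at h3
      have h4 := congrArg (fun y => γ • (y * z)) h3
      simp only [smul_mul_assoc, smul_smul, hγ, one_smul, Finset.sum_mul, mul_assoc] at h4
      rw [← h4]
    rw [h2]
    refine W.smul_mem _ (Submodule.sum_mem _ fun i _ => W.smul_mem _ ?_)
    exact mul_mem_transporter (pow_mem_transporter hπ i) (hr _)
  rw [mem_transporter_nextPref]
  intro e
  have h1 := W.smul_mem (rr ^ e) (hqz e)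
  rwa [hq, smul_mul_assoc, smul_smul, ← mul_pow, hrr, one_pow, one_smul] at h1

/-- The lower left entries on both sides of an operator of the product. -/
theorem StepRel.lower_left (hs : StepRel h hi k lam ct π q M M') (hq0 : q 0 = Q) :
    M 1 0 * C Q = (1 - C (algebraMap S O lam) * X) * (C (exchangeR h k ct π q 0) * M' 1 0) +
      (lam * hi) • (M 0 0 * C (q 1) + (lam * hi) • (M 0 1 * C (q 2)) - M 1 1 * C (q 1)) := by
  rw [(hs 0 1).1, Fin.sum_univ_two]
  simp only [exchangeLPoly, Matrix.of_apply, Matrix.cons_val', Matrix.cons_val_zero,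
    Matrix.cons_val_one, Matrix.cons_val_fin_one, zero_add, hq0, ← smul_C, mul_neg,
    mul_smul_comm, smul_neg, smul_sub, smul_add]
  rw [show (1 : ℕ) + 1 = 2 from rfl]
  abel

theorem q_succ_mem (hq : ∀ e, q e = ri ^ e • (Q * V ^ e))
    (hV : V ∈ transporter (nextPref P Q V) P') (e : ℕ) : q (e + 1) ∈ transporter P P' := by
  rw [hq, pow_succ V, ← mul_assoc]
  exact Submodule.smul_mem _ _ (mul_mem_transporter (mul_pow_mem_transporter e) hV)

theorem error_mem (hq : ∀ e, q e = ri ^ e • (Q * V ^ e))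
    (hM : ∀ i j, CoeffsIn (transporter P P) (M i j))
    (hV : V ∈ transporter (nextPref P Q V) P') :
    CoeffsIn (transporter P P')
    ((lam * hi) • (M 0 0 * C (q 1) + (lam * hi) • (M 0 1 * C (q 2)) - M 1 1 * C (q 1))) :=
  ((((hM 0 0).mul_C (q_succ_mem hq hV 0)).add (((hM 0 1).mul_C (q_succ_mem hq hV 1)).smul _)).sub
    ((hM 1 1).mul_C (q_succ_mem hq hV 0))).smul _

/-- Negligibility of the coefficients of the lower left entry descends across one operator, at the
cost of one coefficient. -/
theorem StepRel.descend_coeff (hs : StepRel h hi k lam ct π q M M')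
    (hq : ∀ e, q e = ri ^ e • (Q * V ^ e))
    (hM : ∀ i j, CoeffsIn (transporter P P) (M i j))
    (hπ : π ∈ transporter P P)
    (hV : V ∈ transporter (nextPref P Q V) P') {L : ℕ}
    (hc : ∀ l, L ≤ l → (M' 1 0).coeff l ∈ transporter (nextPref P Q V) P') {l : ℕ}
    (hl : L + 1 ≤ l) : (M 1 0).coeff l * Q ∈ transporter P P' := by
  have e := congrArg (fun A => A.coeff l) (hs.lower_left (by rw [hq]; simp : q 0 = Q))
  obtain ⟨l, rfl⟩ : ∃ l', l = l' + 1 := ⟨l - 1, by omega⟩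
  simp only [coeff_mul_C, coeff_add, coeff_one_sub_mul, coeff_C_mul] at e
  rw [e]
  have hR : exchangeR h k ct π q 0 ∈ transporter P (nextPref P Q V) :=
    (exchange_mem (fun e => hq e ▸ Submodule.smul_mem _ _ (mul_pow_mem_transporter e))
      (fun y hy => mul_mem_transporter hπ hy) 0).1
  exact Submodule.add_mem _ (Submodule.sub_mem _ (mul_mem_transporter hR (hc _ (by omega)))
    (Submodule.smul_mem _ _ (mul_mem_transporter hR (hc _ (by omega)))))
    (error_mem hq hM hV _)

/-- Negligibility of a value of the lower left entry descends across one operator, and arises at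
its own spectral parameter. -/
theorem StepRel.descend_eval (hs : StepRel h hi k lam ct π q M M')
    (hq : ∀ e, q e = ri ^ e • (Q * V ^ e))
    (hM : ∀ i j, CoeffsIn (transporter P P) (M i j))
    (hπ : π ∈ transporter P P)
    (hV : V ∈ transporter (nextPref P Q V) P') {μ : S}
    (hc : 1 - lam * μ = 0 ∨ evalAt μ (M' 1 0) ∈ transporter (nextPref P Q V) P') :
    evalAt μ (M 1 0) * Q ∈ transporter P P' := by
  have e := congrArg (evalAt μ) (hs.lower_left (by rw [hq]; simp : q 0 = Q))
  rw [map_mul, evalAt_C, map_add, map_mul, map_sub, map_one, evalAt_mul_X, evalAt_C, map_mul,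
    evalAt_C] at e
  have hR : exchangeR h k ct π q 0 ∈ transporter P (nextPref P Q V) :=
    (exchange_mem (fun e => hq e ▸ Submodule.smul_mem _ _ (mul_pow_mem_transporter e))
      (fun y hy => mul_mem_transporter hπ hy) 0).1
  rw [e, Algebra.smul_def, ← map_mul, ← map_one (algebraMap S O), ← map_sub, ← Algebra.smul_def,
    mul_comm μ]
  refine Submodule.add_mem _ ?_ ((error_mem hq hM hV).evalAt_mem μ)
  rcases hc with hc | hc
  · rw [hc, zero_smul]
    exact Submodule.zero_mem _
  · exact Submodule.smul_mem _ _ (mul_mem_transporter hR hc)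

end Step

/-! ### Ladders of exchange relations -/

section Ladder
open Polynomial
variable {S O : Type*} [CommRing S] [Ring O] [Algebra S O]

/-- Operators `Q 0, …, Q (n-1)` that connect the monodromy matrices `M 0, …, M n` by the relations
`StepRel`. The operators `V j` and `π j` are expressed through the extreme coefficients of the
monodromy matrices, and the element `γ` makes the relations solvable for the `q j e`. -/
structure Ladder (N n : ℕ) (h hi : S) (k lam ct ri : ℕ → S) (π Q V : ℕ → O) (q : ℕ → ℕ → O)
    (M : ℕ → Matrix (Fin 2) (Fin 2) O[X]) : Prop where
  hi_mul : hi * h = 1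
  q_eq : ∀ j < n, ∀ e, q j e = ri j ^ e • (Q j * V j ^ e)
  step : ∀ j < n, StepRel h hi (k j) (lam j) (ct j) (π j) (q j) (M j) (M (j + 1))
  ri_unit : ∀ j < n, ∃ rr, rr * ri j = 1
  solvable : ∀ j < n, ∃ v pn γ : S, V j ^ N = algebraMap S O v ∧ π j ^ N = algebraMap S O pn ∧
    γ * ((h * k j) ^ N - (-ct j) ^ N * pn * ri j ^ N * v) = 1
  pi_eq : ∀ j < n, ∃ s : S,
    π j = s • ((M j 0 0).coeff (n + 1) ^ (N - 1) * (M j 0 1).coeff (n + 1))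
  V_eq : ∀ j < n, ∃ s : S,
    V j = s • ((M (j + 1) 0 0).coeff (n + 1) ^ (N - 1) * (M (j + 1) 1 0).coeff n)

/-- The span of the products `p Q_0 V_0^{i_0} ⋯ Q_{j-1} V_{j-1}^{i_{j-1}}` with `p ∈ P`. -/
def pref (P : Submodule S O) (Q V : ℕ → O) : ℕ → Submodule S O
  | 0 => P
  | j + 1 => nextPref (pref P Q V j) (Q j) (V j)

/-- `Q_0 Q_1 ⋯ Q_{j-1}`. -/
def prodQ (Q : ℕ → O) : ℕ → O
  | 0 => 1
  | j + 1 => prodQ Q j * Q j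

/-- The products `Q_0 V_0^{i_0} ⋯ Q_{j-1} V_{j-1}^{i_{j-1}}` with `i < N`. -/
def gens (N : ℕ) (Q V : ℕ → O) : ℕ → List O
  | 0 => [1]
  | j + 1 => (gens N Q V j).flatMap fun g => (List.range N).map fun i => g * (Q j * V j ^ i)

variable {N n : ℕ} {h hi : S} {k lam ct ri : ℕ → S} {π Q V : ℕ → O} {q : ℕ → ℕ → O}
  {M : ℕ → Matrix (Fin 2) (Fin 2) O[X]} {P : Submodule S O} {𝒩 : ℕ → Submodule S O}

theorem Ladder.pi_mem (hL : Ladder N n h hi k lam ct ri π Q V q M) {j : ℕ} (hj : j < n)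
    {P' : Submodule S O} (hM : ∀ i r, CoeffsIn (transporter P' P') (M j i r)) :
    π j ∈ transporter P' P' := by
  obtain ⟨s, hs⟩ := hL.pi_eq j hj
  rw [hs]
  exact Submodule.smul_mem _ _ (mul_mem_transporter (pow_mem_transporter (hM 0 0 _) _) (hM 0 1 _))

/-- The coefficients of the `j`-th monodromy matrix carry the span of the products of the first
`j` operators with powers of the `V` into itself. -/
theorem Ladder.regular (hL : Ladder N n h hi k lam ct ri π Q V q M)
    (hM : ∀ i r, CoeffsIn (transporter P P) (M 0 i r)) {j : ℕ} (hj : j ≤ n) (i r : Fin 2) :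
    CoeffsIn (transporter (pref P Q V j) (pref P Q V j)) (M j i r) := by
  induction j generalizing i r with
  | zero => exact hM i r
  | succ j ih =>
    obtain ⟨v, pn, γ, h1, h2, h3⟩ := hL.solvable j (by omega)
    obtain ⟨rr, hrr⟩ := hL.ri_unit j (by omega)
    have ih' := ih (by omega)
    exact (hL.step j (by omega)).regular hL.hi_mul hrr (hL.q_eq j (by omega)) h1 h2 h3 ih'
      (hL.pi_mem (by omega) ih') i r

/-- `V_j` is as small as the coefficient of the lower left entry through which it is expressed. -/
theorem Ladder.V_mem (hL : Ladder N n h hi k lam ct ri π Q V q M)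
    (hM : ∀ i r, CoeffsIn (transporter P P) (M 0 i r)) {j : ℕ} (hj : j < n) {P' : Submodule S O}
    (hc : (M (j + 1) 1 0).coeff n ∈ transporter (pref P Q V (j + 1)) P') :
    V j ∈ transporter (pref P Q V (j + 1)) P' := by
  obtain ⟨s, hs⟩ := hL.V_eq j hj
  rw [hs]
  exact Submodule.smul_mem _ _ (mul_mem_transporter
    (pow_mem_transporter (hL.regular hM (j := j + 1) hj 0 0 _) _) hc)

/-- If, at the end of the ladder, all the coefficients of the lower left entry except the constant
one are negligible, then at level `j` the top `j` coefficients are. -/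
theorem Ladder.negligible (hL : Ladder N n h hi k lam ct ri π Q V q M)
    (hM : ∀ i r, CoeffsIn (transporter P P) (M 0 i r))
    (h𝒩 : ∀ j < n, ∀ y, y ∈ 𝒩 j ↔ y * Q j ∈ 𝒩 (j + 1))
    (hn : ∀ l, 1 ≤ l → (M n 1 0).coeff l ∈ transporter (pref P Q V n) (𝒩 n)) {j : ℕ} (hj : j ≤ n) :
    ∀ l, n - j + 1 ≤ l → (M j 1 0).coeff l ∈ transporter (pref P Q V j) (𝒩 j) := by
  induction hj using Nat.decreasingInduction with
  | self => intro l hl; exact hn l (by omega)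
  | of_succ j hj ih =>
    intro l hl p hp
    rw [h𝒩 j hj, mul_assoc]
    have hr := hL.regular hM (j := j) hj.le
    exact (hL.step j hj).descend_coeff (hL.q_eq j hj) hr (hL.pi_mem hj hr)
      (hL.V_mem hM hj (ih n (by omega))) ih (l := l) (by omega) p hp

theorem Ladder.V_negligible (hL : Ladder N n h hi k lam ct ri π Q V q M)
    (hM : ∀ i r, CoeffsIn (transporter P P) (M 0 i r))
    (h𝒩 : ∀ j < n, ∀ y, y ∈ 𝒩 j ↔ y * Q j ∈ 𝒩 (j + 1))
    (hn : ∀ l, 1 ≤ l → (M n 1 0).coeff l ∈ transporter (pref P Q V n) (𝒩 n)) {j : ℕ} (hj : j < n) :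
    V j ∈ transporter (pref P Q V (j + 1)) (𝒩 (j + 1)) :=
  hL.V_mem hM hj (hL.negligible hM h𝒩 hn (j := j + 1) hj n (by omega))

/-- At the inverse of each of the spectral parameters the lower left entry at the bottom of the
ladder is negligible. -/
theorem Ladder.eval_negligible (hL : Ladder N n h hi k lam ct ri π Q V q M)
    (hM : ∀ i r, CoeffsIn (transporter P P) (M 0 i r))
    (h𝒩 : ∀ j < n, ∀ y, y ∈ 𝒩 j ↔ y * Q j ∈ 𝒩 (j + 1))
    (hn : ∀ l, 1 ≤ l → (M n 1 0).coeff l ∈ transporter (pref P Q V n) (𝒩 n)) {m : ℕ} (hm : m < n)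
    {μ : S} (hμ : 1 - lam m * μ = 0) {j : ℕ} (hj : j ≤ m) :
    evalAt μ (M j 1 0) ∈ transporter (pref P Q V j) (𝒩 j) := by
  have key : ∀ j, j < n → (1 - lam j * μ = 0 ∨
      evalAt μ (M (j + 1) 1 0) ∈ transporter (pref P Q V (j + 1)) (𝒩 (j + 1))) →
      evalAt μ (M j 1 0) ∈ transporter (pref P Q V j) (𝒩 j) := by
    intro j hj hc p hp
    rw [h𝒩 j hj, mul_assoc]
    have hr := hL.regular hM (j := j) hj.le
    exact (hL.step j hj).descend_eval (hL.q_eq j hj) hr (hL.pi_mem hj hr)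
      (hL.V_negligible hM h𝒩 hn hj) hc p hp
  induction hj using Nat.decreasingInduction with
  | self => exact key m hm (Or.inl hμ)
  | of_succ j hj ih => exact key j (by omega) (Or.inr ih)

theorem gens_mem_pref (h1 : (1 : O) ∈ P) {j : ℕ} {g : O} (hg : g ∈ gens N Q V j) :
    g ∈ pref P Q V j := by
  induction j generalizing g with
  | zero => rw [gens, List.mem_singleton] at hg; rw [hg]; exact h1
  | succ j ih =>
    simp only [gens, List.mem_flatMap, List.mem_map] at hg
    obtain ⟨g', hg', i, _, rfl⟩ := hg
    exact mul_mem_nextPref (ih hg') i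

/-- All the generators but the product of the `Q` themselves are negligible. -/
theorem gens_eq_or_mem (h1 : (1 : O) ∈ P) (h𝒩 : ∀ j < n, ∀ y, y ∈ 𝒩 j ↔ y * Q j ∈ 𝒩 (j + 1))
    (hV : ∀ j < n, V j ∈ transporter (pref P Q V (j + 1)) (𝒩 (j + 1))) {j : ℕ} (hj : j ≤ n) {g : O}
    (hg : g ∈ gens N Q V j) : g = prodQ Q j ∨ g ∈ 𝒩 j := by
  induction j generalizing g with
  | zero => rw [gens, List.mem_singleton] at hg; exact Or.inl hg
  | succ j ih =>
    simp only [gens, List.mem_flatMap, List.mem_map] at hg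
    obtain ⟨g', hg', i, _, rfl⟩ := hg
    cases i with
    | zero =>
      rw [pow_zero, mul_one]
      rcases ih (by omega) hg' with rfl | h2
      · exact Or.inl rfl
      · exact Or.inr ((h𝒩 j (by omega) _).1 h2)
    | succ i =>
      right
      rw [pow_succ, ← mul_assoc (Q j), ← mul_assoc g']
      exact hV j (by omega) _ (mul_mem_nextPref (gens_mem_pref h1 hg') i)

/-- As `V_j ^ N` is a scalar, finitely many products suffice to span `pref P Q V j`. -/
theorem pref_le_span_gens (hN : 0 < N) (hV : ∀ j < n, ∃ v : S, V j ^ N = algebraMap S O v) {j : ℕ}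
    (hj : j ≤ n) : pref P Q V j ≤ Submodule.span S {y | ∃ b ∈ P, ∃ g ∈ gens N Q V j,
      y = b * g} := by
  induction j with
  | zero =>
    intro p hp
    exact Submodule.subset_span ⟨p, hp, 1, by simp [gens], by rw [mul_one]⟩
  | succ j ih =>
    refine Submodule.span_le.2 ?_
    rintro _ ⟨p, hp, i, rfl⟩
    have hp' := ih (by omega) hp
    clear hp
    induction hp' using Submodule.span_induction with
    | mem y hy =>
      obtain ⟨b, hb, g, hg, rfl⟩ := hy
      obtain ⟨v, hv⟩ := hV j (by omega)
      have e : V j ^ i = v ^ (i / N) • V j ^ (i % N) := by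
        conv_lhs => rw [← Nat.div_add_mod i N, pow_add, pow_mul, hv, ← map_pow, ← Algebra.smul_def]
      rw [e, mul_smul_comm, mul_smul_comm]
      refine Submodule.smul_mem _ _ (Submodule.subset_span ⟨b, hb, g * (Q j * V j ^ (i % N)), ?_,
        ?_⟩)
      · simp only [gens, List.mem_flatMap, List.mem_map]
        exact ⟨g, hg, i % N, List.mem_range.2 (Nat.mod_lt _ hN), rfl⟩
      · rw [mul_assoc]
    | zero => rw [zero_mul]; exact Submodule.zero_mem _
    | add a b _ _ ha hb => rw [add_mul]; exact Submodule.add_mem _ ha hb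
    | smul c a _ ha => rw [smul_mul_assoc]; exact Submodule.smul_mem _ c ha

end Ladder

/-! ### Ladders of sequences of operators -/

section Asymptotic
open Polynomial Asymptotics

/-- The bounded sequences of complex numbers. -/
def BddSeq : Subalgebra ℂ (ℕ → ℂ) where
  carrier := {f | ∃ C, ∀ ν, ‖f ν‖ ≤ C}
  mul_mem' := by
    rintro f g ⟨C, hC⟩ ⟨D, hD⟩
    refine ⟨C * D, fun ν => ?_⟩
    rw [Pi.mul_apply, norm_mul]
    exact mul_le_mul (hC ν) (hD ν) (norm_nonneg _) ((norm_nonneg _).trans (hC ν))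
  add_mem' := by
    rintro f g ⟨C, hC⟩ ⟨D, hD⟩
    exact ⟨C + D, fun ν => (norm_add_le _ _).trans (add_le_add (hC ν) (hD ν))⟩
  algebraMap_mem' r := ⟨‖r‖, fun ν => by simp⟩

variable {A : Type*} [NormedRing A] [NormedAlgebra ℂ A]

theorem bddSeq_smul_apply (c : BddSeq) (x : ℕ → A) (ν : ℕ) : (c • x) ν = c.1 ν • x ν := rfl

theorem BddSeq.isBigO (c : BddSeq) : (c.1) =O[atTop] (fun _ => (1 : ℝ)) := by
  obtain ⟨C, hC⟩ := c.2
  exact IsBigO.of_bound C (Eventually.of_forall fun ν => by simpa using hC ν)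

variable (A) in
/-- The bounded sequences in `A`. -/
def bddOps : Submodule BddSeq (ℕ → A) where
  carrier := {x | ∃ C, ∀ ν, ‖x ν‖ ≤ C}
  add_mem' := by
    rintro f g ⟨C, hC⟩ ⟨D, hD⟩
    exact ⟨C + D, fun ν => (norm_add_le _ _).trans (add_le_add (hC ν) (hD ν))⟩
  zero_mem' := ⟨0, fun ν => by simp⟩
  smul_mem' := by
    rintro ⟨c, C, hC⟩ x ⟨D, hD⟩
    refine ⟨C * D, fun ν => ?_⟩
    rw [bddSeq_smul_apply, norm_smul]
    exact mul_le_mul (hC ν) (hD ν) (norm_nonneg _) ((norm_nonneg _).trans (hC ν))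

theorem bddOps_regular {x : ℕ → A} (hx : x ∈ bddOps A) :
    x ∈ transporter (bddOps A) (bddOps A) := by
  rintro p ⟨C, hC⟩
  obtain ⟨D, hD⟩ := hx
  refine ⟨C * D, fun ν => (norm_mul_le _ _).trans ?_⟩
  exact mul_le_mul (hC ν) (hD ν) (norm_nonneg _) ((norm_nonneg _).trans (hC ν))

variable (A) in
/-- The sequences in `A` that are negligible with respect to `Φ`. -/
def littleOps (Φ : ℕ → ℝ) : Submodule BddSeq (ℕ → A) where
  carrier := {x | x =o[atTop] Φ}
  add_mem' hx hy := IsLittleO.add hx hy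
  zero_mem' := isLittleO_zero _ _
  smul_mem' c x hx := by
    have := (BddSeq.isBigO c).smul_isLittleO hx
    simp only [smul_eq_mul, one_mul] at this
    exact this

variable (A) in
/-- The sequences in `A` that are dominated by `Φ`. -/
def bigOps (Φ : ℕ → ℝ) : Submodule BddSeq (ℕ → A) where
  carrier := {x | x =O[atTop] Φ}
  add_mem' hx hy := IsBigO.add hx hy
  zero_mem' := isBigO_zero _ _
  smul_mem' c x hx := by
    have := (BddSeq.isBigO c).smul hx
    simp only [smul_eq_mul, one_mul] at this
    exact this

theorem tendsto_zero_mem_transporter {Φ : ℕ → ℝ} {P : Submodule BddSeq (ℕ → A)}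
    (hP : P ≤ bigOps A Φ) {x : ℕ → A} (hx : Tendsto x atTop (𝓝 0)) :
    x ∈ transporter P (littleOps A Φ) := by
  intro p hp
  have h1 : p =O[atTop] Φ := hP hp
  have h2 : x =o[atTop] (fun _ => (1 : ℝ)) := (isLittleO_one_iff ℝ).2 hx
  have := h1.mul_isLittleO h2
  simp only [mul_one] at this
  exact this

/-- A sequence is dominated by a part of a list of sequences if the rest of the list is
negligible with respect to the sum of the norms. -/
theorem isBigO_sum_norm_of_eq_or_littleO {A : Type*} [NormedRing A] {l : List (ℕ → A)} {T : ℕ → A}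
    (h : ∀ g ∈ l, g = T ∨ g =o[atTop] fun ν => (l.map fun g => ‖g ν‖).sum) :
    (fun ν => (l.map fun g => ‖g ν‖).sum) =O[atTop] T := by
  set Φ : ℕ → ℝ := fun ν => (l.map fun g => ‖g ν‖).sum with hΦ
  have hΦ0 : ∀ ν, 0 ≤ Φ ν := fun ν => List.sum_nonneg (by
    intro x hx
    obtain ⟨g, _, rfl⟩ := List.mem_map.1 hx
    exact norm_nonneg _)
  set ε : ℝ := 1 / (2 * (l.length + 1)) with hε
  have hε0 : 0 < ε := by positivity
  have h1 : ∀ g ∈ l, ∀ᶠ ν in atTop, ‖g ν‖ ≤ ‖T ν‖ + ε * Φ ν := by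
    intro g hg
    rcases h g hg with rfl | hgo
    · exact Eventually.of_forall fun ν => le_add_of_nonneg_right (mul_nonneg hε0.le (hΦ0 ν))
    · filter_upwards [hgo.bound hε0] with ν hν
      rw [Real.norm_of_nonneg (hΦ0 ν)] at hν
      exact hν.trans (le_add_of_nonneg_left (norm_nonneg _))
  have h2 : ∀ᶠ ν in atTop, ∀ g ∈ l, ‖g ν‖ ≤ ‖T ν‖ + ε * Φ ν := by
    have := (Filter.eventually_all_finset (l := atTop) (p := fun (g : ℕ → A) ν =>
      ‖g ν‖ ≤ ‖T ν‖ + ε * Φ ν) (@List.toFinset _ (Classical.decEq _) l)).2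
      (fun g hg => h1 g (by simpa using hg))
    filter_upwards [this] with ν hν g hg
    exact hν g (by simpa using hg)
  refine IsBigO.of_bound (2 * l.length) ?_
  filter_upwards [h2] with ν hν
  have h3 : Φ ν ≤ l.length • (‖T ν‖ + ε * Φ ν) := by
    have := List.sum_le_card_nsmul (l.map fun g => ‖g ν‖) (‖T ν‖ + ε * Φ ν) (by
      intro x hx
      obtain ⟨g, hg, rfl⟩ := List.mem_map.1 hx
      exact hν g hg)
    rwa [List.length_map] at this
  rw [nsmul_eq_mul] at h3
  have h4 : (l.length : ℝ) * ε ≤ 1 / 2 := by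
    rw [hε, mul_one_div, div_le_div_iff₀ (by positivity) (by norm_num)]
    nlinarith
  rw [Real.norm_of_nonneg (hΦ0 ν)]
  nlinarith [mul_le_mul_of_nonneg_right h4 (hΦ0 ν)]

variable {N n : ℕ} {h hi : BddSeq} {k lam ct ri : ℕ → BddSeq} {π Q V : ℕ → ℕ → A}
  {q : ℕ → ℕ → ℕ → A} {M : ℕ → Matrix (Fin 2) (Fin 2) (ℕ → A)[X]}

/-- Let the last monodromy matrix of a ladder be such that the coefficients of the lower left
entry are negligible, as soon as sequences with limit zero are. Then the value of the lower left
entry of the first monodromy matrix at the inverse of a spectral parameter annihilates the product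
of the operators up to terms of smaller order. -/
theorem Ladder.eval_mul_prodQ_isLittleO [NormOneClass A] (hN : 0 < N)
    (hL : Ladder N n h hi k lam ct ri π Q V q M)
    (hM : ∀ i r, CoeffsIn (bddOps A) (M 0 i r))
    (hn : ∀ P P' : Submodule BddSeq (ℕ → A), (∀ i r, CoeffsIn (transporter P P) (M n i r)) →
      (∀ x : ℕ → A, Tendsto x atTop (𝓝 0) → x ∈ transporter P P') →
      ∀ l, 1 ≤ l → (M n 1 0).coeff l ∈ transporter P P')
    {m : ℕ} (hm : m < n) {μ : BddSeq} (hμ : 1 - lam m * μ = 0) :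
    (evalAt μ (M 0 1 0) * prodQ Q n) =o[atTop] prodQ Q n := by
  set Φ : ℕ → ℝ := fun ν => ((gens N Q V n).map fun g => ‖g ν‖).sum with hΦ
  have hM' : ∀ i r, CoeffsIn (transporter (bddOps A) (bddOps A)) (M 0 i r) :=
    fun i r l => bddOps_regular (hM i r l)
  have h1 : (1 : ℕ → A) ∈ bddOps A := ⟨1, fun ν => by simp⟩
  have hVN : ∀ j < n, ∃ v : BddSeq, V j ^ N = algebraMap BddSeq (ℕ → A) v := fun j hj => by
    obtain ⟨v, _, _, hv, _⟩ := hL.solvable j hj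
    exact ⟨v, hv⟩
  have hΦ0 : ∀ ν, 0 ≤ Φ ν := fun ν => List.sum_nonneg (by
    intro x hx
    obtain ⟨g, _, rfl⟩ := List.mem_map.1 hx
    exact norm_nonneg _)
  have hpref : pref (bddOps A) Q V n ≤ bigOps A Φ := by
    refine (pref_le_span_gens hN hVN le_rfl).trans (Submodule.span_le.2 ?_)
    rintro _ ⟨b, ⟨C, hC⟩, g, hg, rfl⟩
    refine IsBigO.of_bound C (Eventually.of_forall fun ν => ?_)
    rw [Real.norm_of_nonneg (hΦ0 ν)]
    refine (norm_mul_le _ _).trans (mul_le_mul (hC ν) ?_ (norm_nonneg _)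
      ((norm_nonneg _).trans (hC ν)))
    refine List.single_le_sum (l := (gens N Q V n).map fun g => ‖g ν‖) ?_ _
      (List.mem_map.2 ⟨g, hg, rfl⟩)
    intro x hx
    obtain ⟨g, _, rfl⟩ := List.mem_map.1 hx
    exact norm_nonneg _
  -- `tail i = Q_{n-i} ⋯ Q_{n-1}`
  obtain ⟨tail, ht0, hts⟩ : ∃ tail : ℕ → (ℕ → A), tail 0 = 1 ∧
      ∀ i, tail (i + 1) = Q (n - (i + 1)) * tail i :=
    ⟨fun i => Nat.rec 1 (fun i t => Q (n - (i + 1)) * t) i, rfl, fun _ => rfl⟩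
  let 𝒩 : ℕ → Submodule BddSeq (ℕ → A) := fun j =>
    (littleOps A Φ).comap (LinearMap.mulRight BddSeq (tail (n - j)))
  have hmem : ∀ j y, y ∈ 𝒩 j ↔ y * tail (n - j) ∈ littleOps A Φ := fun j y => by
    rw [Submodule.mem_comap, LinearMap.mulRight_apply]
  have h𝒩 : ∀ j < n, ∀ y, y ∈ 𝒩 j ↔ y * Q j ∈ 𝒩 (j + 1) := by
    intro j hj y
    rw [hmem, hmem, show n - j = (n - (j + 1)) + 1 by omega, hts,
      show n - (n - (j + 1) + 1) = j by omega, mul_assoc]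
  have h𝒩n : 𝒩 n = littleOps A Φ := by
    ext y
    rw [hmem, Nat.sub_self, ht0, mul_one]
  have hcoef : ∀ l, 1 ≤ l →
      (M n 1 0).coeff l ∈ transporter (pref (bddOps A) Q V n) (𝒩 n) := by
    refine hn _ _ (hL.regular hM' le_rfl) fun x hx => ?_
    rw [h𝒩n]
    exact tendsto_zero_mem_transporter hpref hx
  have hprod : ∀ j ≤ n, prodQ Q j * tail (n - j) = prodQ Q n := by
    intro j hj
    induction hj using Nat.decreasingInduction with
    | self => rw [Nat.sub_self, ht0, mul_one]
    | of_succ j hj ih =>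
      rw [← ih, prodQ, show n - j = (n - (j + 1)) + 1 by omega, hts,
        show n - (n - (j + 1) + 1) = j by omega, mul_assoc]
  have hev := hL.eval_negligible hM' h𝒩 hcoef hm hμ (Nat.zero_le m) 1 h1
  rw [one_mul, hmem] at hev
  have hp0 := hprod 0 (Nat.zero_le n)
  rw [prodQ, one_mul] at hp0
  rw [hp0] at hev
  refine IsLittleO.trans_isBigO (hev : (_ =o[atTop] Φ)) ?_
  refine isBigO_sum_norm_of_eq_or_littleO fun g hg => ?_
  rcases gens_eq_or_mem h1 h𝒩 (fun j hj => hL.V_negligible hM' h𝒩 hcoef hj) le_rfl hg with h2 | h2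
  · exact Or.inl h2
  · rw [h𝒩n] at h2
    exact Or.inr h2

end Asymptotic

/-! ### The parameters of solitonic states -/

/-- The sites of a chain in the order in which they occur in the rotated monodromy matrix, which
starts with the last site. -/
def rotSite (m p : ℕ) : Fin (m + 2) := Fin.ofNat (m + 2) (p + (m + 1))

theorem rotSite_zero (m : ℕ) : rotSite m 0 = Fin.last (m + 1) := by
  ext; simp [rotSite]

theorem rotSite_succ {m p : ℕ} (hp : p ≤ m) : (rotSite m (p + 1)).val = p := by
  simp only [rotSite, Fin.val_ofNat]
  rw [show p + 1 + (m + 1) = p + (m + 2) by ring, Nat.add_mod_right, Nat.mod_eq_of_lt (by omega)]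

theorem rotSite_succ_eq {m : ℕ} (p : Fin (m + 1)) : rotSite m (p.val + 1) = p.castSucc :=
  Fin.ext (by rw [rotSite_succ (by omega), Fin.val_castSucc])

theorem rotSite_ne {m p q : ℕ} (hp : p ≤ m + 1) (hq : q ≤ m + 1) (h : p ≠ q) :
    rotSite m p ≠ rotSite m q := by
  intro e
  have e' := congrArg Fin.val e
  cases p with
  | zero =>
    cases q with
    | zero => exact h rfl
    | succ q => rw [rotSite_zero, rotSite_succ (by omega), Fin.val_last] at e'; omega
  | succ p =>
    cases q with
    | zero => rw [rotSite_zero, rotSite_succ (by omega), Fin.val_last] at e'; omega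
    | succ q => rw [rotSite_succ (by omega), rotSite_succ (by omega)] at e'; omega

section Soliton
variable {N m : ℕ} {K : ℂ} {φ : ℕ → ℝ} {j : ℕ} {f : ℕ → ℂ} {u w : Fin (m + 2) → ℂ}

theorem isSolitonState_zero : IsSolitonState N (m + 2) K φ 0 f (uHom N) wHom :=
  ⟨fun _ => 1, fun _ => 1, fun _ => ⟨rfl, rfl⟩, fun _ => ⟨one_ne_zero, one_ne_zero⟩,
    fun _ => ⟨by simp [tau], by simp [Theta, tau]⟩, fun _ => ⟨by simp [uHom], by simp [wHom]⟩⟩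

theorem IsSolitonState.ne_zero (hS : IsSolitonState N (m + 2) K φ j f u w) :
    (∀ i, u i ≠ 0) ∧ ∀ i, w i ≠ 0 := by
  obtain ⟨t, θ, _, hne, _, huw⟩ := hS
  refine ⟨fun i => ?_, fun i => ?_⟩
  · rw [(huw i).1]
    exact mul_ne_zero (neg_ne_zero.2 (inv_ne_zero (omegaHalf_ne_zero N)))
      (div_ne_zero (hne _).1 (hne _).1)
  · rw [(huw i).2]
    exact neg_ne_zero.2 (div_ne_zero (hne _).2 (hne _).2)

theorem IsSolitonState.tau_ne_zero (hS : IsSolitonState N (m + 2) K φ j f u w) (p : ℕ) :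
    tau K φ p j f ≠ 0 ∧ Theta K φ p j f ≠ 0 := by
  obtain ⟨t, θ, _, hne, hpow, _⟩ := hS
  exact ⟨(hpow p).1 ▸ pow_ne_zero _ (hne p).1, (hpow p).2 ▸ pow_ne_zero _ (hne p).2⟩

theorem IsSolitonState.tau_period (hS : IsSolitonState N (m + 2) K φ j f u w) :
    tau K φ (m + 2) j f = tau K φ 0 j f ∧ Theta K φ (m + 2) j f = Theta K φ 0 j f := by
  obtain ⟨t, θ, hper, _, hpow, _⟩ := hS
  have h := hper 0
  rw [zero_add] at h
  exact ⟨by rw [← (hpow _).1, ← (hpow _).1, h.1], by rw [← (hpow _).2, ← (hpow _).2, h.2]⟩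

theorem IsSolitonState.u_inv_pow [NeZero N] (hS : IsSolitonState N (m + 2) K φ j f u w)
    (i : Fin (m + 2)) :
    (u i)⁻¹ ^ N = -(-1) ^ N * (tau K φ (i.val + 1) j f / tau K φ i.val j f) := by
  obtain ⟨t, θ, _, _, hpow, huw⟩ := hS
  rw [(huw i).1, ← (hpow _).1, ← (hpow _).1, mul_inv, inv_div, inv_neg, inv_inv, mul_pow, div_pow,
    neg_pow, omegaHalf_pow, mul_neg_one]

theorem IsSolitonState.w_inv_pow (hS : IsSolitonState N (m + 2) K φ j f u w) (i : Fin (m + 2)) :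
    (w i)⁻¹ ^ N = (-1) ^ N * (Theta K φ i.val j f / Theta K φ (i.val + 1) j f) := by
  obtain ⟨t, θ, _, _, hpow, huw⟩ := hS
  rw [(huw i).2, ← (hpow _).2, ← (hpow _).2, inv_neg, inv_div, neg_pow, div_pow]

theorem IsSolitonState.prod_u_inv_pow [NeZero N] (hS : IsSolitonState N (m + 2) K φ j f u w) {p : ℕ}
    (hp : p ≤ m + 1) :
    ∏ q ∈ Finset.range (p + 1), (u (rotSite m q))⁻¹ ^ N =
      (-(-1) ^ N) ^ (p + 1) * (tau K φ p j f / tau K φ (m + 1) j f) := by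
  induction p with
  | zero =>
    rw [Finset.prod_range_one, hS.u_inv_pow, rotSite_zero, Fin.val_last, hS.tau_period.1, zero_add,
      pow_one]
  | succ p ih =>
    have h1 := (hS.tau_ne_zero p).1
    rw [Finset.prod_range_succ, ih (by omega), hS.u_inv_pow, rotSite_succ (by omega),
      pow_succ _ (p + 1)]
    field_simp

theorem IsSolitonState.prod_uw_pow [NeZero N] (hS : IsSolitonState N (m + 2) K φ j f u w) :
    ∏ q ∈ Finset.range (m + 2), (u (rotSite m q) * w (rotSite m q)) ^ N = (-1) ^ (m + 2) := by
  have h1 : ∏ q ∈ Finset.range (m + 2), (u (rotSite m q) * w (rotSite m q)) ^ N =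
      ∏ i : Fin (m + 2), (u i * w i) ^ N := by
    rw [Finset.prod_range_succ', Fin.prod_univ_castSucc, rotSite_zero, ← Fin.prod_univ_eq_prod_range
      (fun q => (u (rotSite m (q + 1)) * w (rotSite m (q + 1))) ^ N)]
    simp only [rotSite_succ_eq]
  rw [h1]
  obtain ⟨t, θ, hper, hne, _, huw⟩ := hS
  have h2 : ∀ i : Fin (m + 2), (u i * w i) ^ N =
      -(((t i.val / t (i.val + 1)) * (θ (i.val + 1) / θ i.val)) ^ N) := by
    intro i
    rw [(huw i).1, (huw i).2]
    have : -(omegaHalf N)⁻¹ * (t i.val / t (i.val + 1)) * -(θ (i.val + 1) / θ i.val) =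
      (omegaHalf N)⁻¹ * ((t i.val / t (i.val + 1)) * (θ (i.val + 1) / θ i.val)) := by ring
    rw [this, mul_pow, inv_pow, omegaHalf_pow, inv_neg, inv_one, neg_one_mul]
  simp only [h2]
  rw [Fin.prod_univ_eq_prod_range
    (fun i => -((t i / t (i + 1) * (θ (i + 1) / θ i)) ^ N)) (m + 2),
    Finset.prod_neg, Finset.prod_pow, Finset.prod_mul_distrib, Finset.card_range]
  have htel : ∀ r, (∏ i ∈ Finset.range r, t i / t (i + 1) = t 0 / t r) ∧
      ∏ i ∈ Finset.range r, θ (i + 1) / θ i = θ r / θ 0 := by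
    intro r
    induction r with
    | zero => simp [(hne 0).1, (hne 0).2]
    | succ r ih =>
      rw [Finset.prod_range_succ, Finset.prod_range_succ, ih.1, ih.2]
      have h1 := (hne r).1
      have h2 := (hne r).2
      constructor <;> field_simp
  have h := hper 0
  rw [zero_add] at h
  rw [(htel _).1, (htel _).2]
  rw [h.1, h.2, div_self (hne 0).1, div_self (hne 0).2, one_mul, one_pow, mul_one]

end Soliton

/-! ### The top coefficient of the monodromy matrix -/

section Top
open Polynomial
variable {N : ℕ}

theorem exists_weyl_mul_pow [NeZero N] (r : ℕ) :
    ∃ ε : ℂ, ε ≠ 0 ∧ (weylX N * weylZ N) ^ r = ε • (weylX N ^ r * weylZ N ^ r) := by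
  have hω := omega_ne_zero N
  have hZX : weylZ N * weylX N = (omega N)⁻¹ • (weylX N * weylZ N) := by
    rw [weylX_mul_weylZ, smul_smul, inv_mul_cancel₀ hω, one_smul]
  have hZrX : ∀ r, weylZ N ^ r * weylX N = (omega N)⁻¹ ^ r • (weylX N * weylZ N ^ r) := by
    intro r
    induction r with
    | zero => simp
    | succ r ih =>
      rw [pow_succ', mul_assoc, ih, mul_smul_comm, ← mul_assoc, hZX, smul_mul_assoc, smul_smul,
        mul_assoc, ← pow_succ', ← pow_succ]
  induction r with
  | zero => exact ⟨1, one_ne_zero, by simp⟩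
  | succ r ih =>
    obtain ⟨ε, hε, h⟩ := ih
    refine ⟨ε * (omega N)⁻¹ ^ r, mul_ne_zero hε (pow_ne_zero _ (inv_ne_zero hω)), ?_⟩
    rw [pow_succ, h, smul_mul_assoc, mul_assoc, ← mul_assoc (weylZ N ^ r), hZrX, smul_mul_assoc,
      mul_smul_comm, smul_smul, mul_assoc (weylX N), ← pow_succ, ← mul_assoc, ← pow_succ]

theorem exists_siteUW_pow (N : ℕ) [NeZero N] :
    ∃ ε : ℂ, ε ≠ 0 ∧ ∀ (M : ℕ) (i : Fin M) (a b : ℂ),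
      (siteU i a * siteW i b : Op N M) ^ N = (ε * (a * b) ^ N) • 1 := by
  obtain ⟨ε, hε, h⟩ := exists_weyl_mul_pow (N := N) N
  refine ⟨ε, hε, fun M i a b => ?_⟩
  rw [siteU, siteW, smul_mul_smul_comm, ← atSiteHom_apply, ← atSiteHom_apply, ← map_mul,
    _root_.smul_pow,
    ← map_pow, h, weylX_pow, weylZ_pow, one_mul, map_smul, map_one, smul_smul, mul_comm ε]

theorem IsChain.topCoeff_pow {S O : Type*} [CommRing S] [Ring O] [Algebra S O] {h κ : S}
    {u v w wi : ℕ → O} {n : ℕ} {G : ℕ → Matrix (Fin 2) (Fin 2) O[X]}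
    (hW : WeylChain h u v w wi n) (hG : IsChain h κ u w n G) (e : ℕ → S)
    (he : ∀ p ≤ n, (u p * w p) ^ N = e p • 1) :
    topCoeff G n 0 ^ N = (∏ p ∈ Finset.range (n + 1), (κ ^ N * e p)) • 1 := by
  have key : ∀ r ≤ n + 1, topCoeff G n (n + 1 - r) ^ N =
      (∏ p ∈ Finset.Ico (n + 1 - r) (n + 1), (κ ^ N * e p)) • 1 := by
    intro r
    induction r with
    | zero => intro _; rw [Nat.sub_zero, hG.topCoeff_last]; simp
    | succ r ih =>
      intro hr
      obtain ⟨p, hp⟩ : ∃ p, p = n + 1 - (r + 1) := ⟨_, rfl⟩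
      have hp' : n + 1 - r = p + 1 := by omega
      have hpn : p ≤ n := by omega
      rw [← hp]
      have hc : Commute (u p * w p) (topCoeff G n (p + 1)) := by
        have := hG.commute (q := p + 1) (x := u p * w p) (by omega)
          (fun r hr hr' => (hW.uu_comm _ hpn _ hr' (by omega)).mul_left
            (hW.uw_comm _ hr' _ hpn (by omega)).symm)
          (fun r hr hr' => (hW.uw_comm _ hpn _ hr' (by omega)).mul_left
            (hW.ww_comm _ hpn _ hr' (by omega))) 0 0
        have := congrArg (fun P => P.coeff (n + 1 - (p + 1))) this.eq
        rw [coeff_C_mul, coeff_mul_C] at this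
        exact this
      have ih' := ih (by omega)
      rw [hp'] at ih'
      rw [hG.topCoeff_eq hpn, _root_.smul_pow, hc.mul_pow, he p hpn, ih', smul_mul_smul_comm,
        mul_one,
        smul_smul, Finset.prod_eq_prod_Ico_succ_bot (by omega : p < n + 1), mul_assoc]
  have := key (n + 1) le_rfl
  rwa [Nat.sub_self, ← Finset.range_eq_Ico] at this

end Top

/-! ### Sequences of chains -/

section Sequences
open Polynomial

/-- The product `ℓ_p ℓ_{p+1} ⋯ ℓ_{p+l-1}`. -/
def chainProd {S O : Type*} [CommRing S] [Ring O] [Algebra S O] (h κ : S) (u w : ℕ → O) :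
    ℕ → ℕ → Matrix (Fin 2) (Fin 2) O[X]
  | 0, _ => 1
  | l + 1, p => laxPoly h κ (u p) (w p) * chainProd h κ u w l (p + 1)

theorem isChain_chainProd {S O : Type*} [CommRing S] [Ring O] [Algebra S O] (h κ : S)
    (u w : ℕ → O) (n : ℕ) :
    IsChain h κ u w n fun p => chainProd h κ u w (n + 1 - p) p := by
  refine ⟨by simp [chainProd], fun p hp => ?_⟩
  dsimp only
  rw [show n + 1 - p = (n - p) + 1 by omega, show n + 1 - (p + 1) = n - p by omega, chainProd]

theorem prod_ofFn_eq_chainProd {S O : Type*} [CommRing S] [Ring O] [Algebra S O] (h κ : S)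
    (u w : ℕ → O) (l p : ℕ) :
    (List.ofFn fun r : Fin l => laxPoly h κ (u (p + r)) (w (p + r))).prod =
      chainProd h κ u w l p := by
  induction l generalizing p with
  | zero => simp [chainProd]
  | succ l ih =>
    rw [List.ofFn_succ, List.prod_cons, chainProd, ← ih (p + 1)]
    simp only [Fin.val_zero, add_zero, Fin.val_succ, add_assoc, add_comm 1]

variable {A : Type*} [Ring A]

/-- The polynomial of the `ν`-th members of the coefficients of a polynomial over a ring of
sequences. -/
def seqEval (ν : ℕ) : (ℕ → A)[X] →+* A[X] := mapRingHom (Pi.evalRingHom (fun _ => A) ν)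

theorem coeff_seqEval (ν : ℕ) (P : (ℕ → A)[X]) (l : ℕ) : (seqEval ν P).coeff l = P.coeff l ν := by
  rw [seqEval, coe_mapRingHom, coeff_map]; rfl

theorem seqEval_ext {P P' : (ℕ → A)[X]} (h : ∀ ν, seqEval ν P = seqEval ν P') : P = P' := by
  ext l ν
  rw [← coeff_seqEval, ← coeff_seqEval, h]

theorem seqEval_C (ν : ℕ) (a : ℕ → A) : seqEval ν (C a) = C (a ν) := by
  rw [seqEval, coe_mapRingHom, map_C]; rfl

theorem seqEval_X (ν : ℕ) : seqEval ν (X : (ℕ → A)[X]) = X := by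
  rw [seqEval, coe_mapRingHom, map_X]

variable [Algebra ℂ A]

theorem seqEval_smul (ν : ℕ) (c : BddSeq) (P : (ℕ → A)[X]) :
    seqEval ν (c • P) = c.1 ν • seqEval ν P := by
  ext l
  rw [coeff_seqEval, coeff_smul, coeff_smul, coeff_seqEval]
  rfl

theorem laxPoly_seqEval (ν : ℕ) (h κ : BddSeq) (u w : ℕ → A) :
    (laxPoly h κ u w).map (seqEval ν) = laxPoly (h.1 ν) (κ.1 ν) (u ν) (w ν) := by
  ext1 i j
  fin_cases i <;> fin_cases j <;>
    simp [laxPoly, seqEval_C, seqEval_X, -map_mul, RingHom.map_mul] <;> rfl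

theorem chainProd_seqEval (ν : ℕ) (h κ : BddSeq) (u w : ℕ → ℕ → A) (l p : ℕ) :
    (chainProd h κ u w l p).map (seqEval ν) =
      chainProd (h.1 ν) (κ.1 ν) (fun p => u p ν) (fun p => w p ν) l p := by
  induction l generalizing p with
  | zero => exact Matrix.map_one _ (map_zero _) (map_one _)
  | succ l ih => rw [chainProd, Matrix.map_mul, laxPoly_seqEval, ih, chainProd]

theorem exchangeS_seq (ν : ℕ) (h k ct : BddSeq) (π : ℕ → A) (q : ℕ → ℕ → A) (e : ℕ) :
    exchangeS h k ct π q e ν =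
      exchangeS (h.1 ν) (k.1 ν) (ct.1 ν) (π ν) (fun e => q e ν) e := by
  cases e <;> rfl

theorem exchangeLPoly_seqEval (ν : ℕ) (h hi k lam ct : BddSeq) (π : ℕ → A) (q : ℕ → ℕ → A) (e : ℕ)
    (i r : Fin 2) :
    seqEval ν (exchangeLPoly h hi k lam ct π q e i r) =
      exchangeLPoly (h.1 ν) (hi.1 ν) (k.1 ν) (lam.1 ν) (ct.1 ν) (π ν) (fun e => q e ν) e i r := by
  fin_cases i <;> fin_cases r
  · simp only [exchangeLPoly, Fin.zero_eta, Matrix.of_apply, Matrix.cons_val', Matrix.cons_val_zero,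
      Matrix.cons_val_fin_one, map_sub, map_mul, seqEval_C, seqEval_X]
    rfl
  · simp only [exchangeLPoly, Fin.zero_eta, Fin.mk_one, Matrix.of_apply, Matrix.cons_val',
      Matrix.cons_val_zero, Matrix.cons_val_one, Matrix.cons_val_fin_one, map_neg, map_mul,
      seqEval_C, seqEval_X]
    rw [← exchangeS_seq]
    rfl
  · simp only [exchangeLPoly, Fin.zero_eta, Fin.mk_one, Matrix.of_apply, Matrix.cons_val',
      Matrix.cons_val_zero, Matrix.cons_val_one, Matrix.cons_val_fin_one, map_neg, seqEval_C]
    rfl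
  · simp only [exchangeLPoly, Fin.mk_one, Matrix.of_apply, Matrix.cons_val', Matrix.cons_val_one,
      Matrix.cons_val_fin_one, seqEval_C]

/-- The relations `StepRel` for sequences hold if they hold for all the members. -/
theorem StepRel.of_seqEval {h hi k lam ct : BddSeq} {π : ℕ → A} {q : ℕ → ℕ → A}
    {M M' : Matrix (Fin 2) (Fin 2) (ℕ → A)[X]}
    (H : ∀ ν, StepRel (h.1 ν) (hi.1 ν) (k.1 ν) (lam.1 ν) (ct.1 ν) (π ν) (fun e => q e ν)
      (M.map (seqEval ν)) (M'.map (seqEval ν))) :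
    StepRel h hi k lam ct π q M M' := by
  intro e i
  constructor <;> refine seqEval_ext fun ν => ?_
  · have h1 := (H ν e i).1
    simp only [Fin.sum_univ_two, map_mul, map_add, map_sub, map_one, seqEval_smul, seqEval_C,
      seqEval_X, exchangeLPoly_seqEval, Matrix.map_apply] at h1 ⊢
    exact h1
  · have h1 := (H ν e i).2
    simp only [Fin.sum_univ_two, map_mul, map_add, map_sub, map_one, seqEval_smul, seqEval_C,
      seqEval_X, exchangeLPoly_seqEval, Matrix.map_apply] at h1 ⊢
    exact h1

variable {N : ℕ} [NeZero N]

/-- The rotated monodromy matrix in terms of the rotated order of the sites. -/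
theorem rotMono_eq_chainProd {m : ℕ} (κ : ℂ) (u w : Fin (m + 2) → ℂ) :
    rotMono (N := N) κ u w = chainProd (omegaHalf N) κ
      (fun p => siteU (rotSite m p) (u (rotSite m p)))
      (fun p => siteW (rotSite m p) (w (rotSite m p))) (m + 2) 0 := by
  rw [rotMono, chainProd, ← prod_ofFn_eq_chainProd]
  simp only [rotSite_zero, zero_add, add_comm 1, rotSite_succ_eq]

/-- The Weyl relations for sequences of chains. -/
theorem weylChain_seq {m : ℕ} (h : BddSeq) (hh : ∀ ν, h.1 ν = omegaHalf N)
    {u w : ℕ → Fin (m + 2) → ℂ} (hu : ∀ ν i, u ν i ≠ 0) (hw : ∀ ν i, w ν i ≠ 0) :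
    WeylChain (O := ℕ → Op N (m + 2)) h
      (fun p ν => siteU (rotSite m p) (u ν (rotSite m p)))
      (fun p ν => siteUInv (rotSite m p) (u ν (rotSite m p)))
      (fun p ν => siteW (rotSite m p) (w ν (rotSite m p)))
      (fun p ν => siteWInv (rotSite m p) (w ν (rotSite m p))) (m + 1) where
  uw p _ := funext fun ν => by
    change (siteU _ _ * siteW _ _ : Op N (m + 2)) = (h.1 ν) ^ 2 • (siteW _ _ * siteU _ _)
    rw [siteU_mul_siteW, hh]
  uv p _ := funext fun ν => siteU_mul_inv _ (hu ν _)
  vu p _ := funext fun ν => siteUInv_mul _ (hu ν _)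
  wwi p _ := funext fun ν => siteW_mul_inv _ (hw ν _)
  wiw p _ := funext fun ν => siteWInv_mul _ (hw ν _)
  vu_comm p hp q hq hpq := funext fun ν =>
    ((commute_atSite (rotSite_ne hp hq hpq) _ _).smul_left _).smul_right _
  vw_comm p hp q hq hpq := funext fun ν =>
    ((commute_atSite (rotSite_ne hp hq hpq) _ _).smul_left _).smul_right _
  uw_comm p hp q hq hpq := funext fun ν =>
    ((commute_atSite (rotSite_ne hp hq hpq) _ _).smul_left _).smul_right _
  uu_comm p hp q hq hpq := funext fun ν =>
    ((commute_atSite (rotSite_ne hp hq hpq) _ _).smul_left _).smul_right _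
  ww_comm p hp q hq hpq := funext fun ν =>
    ((commute_atSite (rotSite_ne hp hq hpq) _ _).smul_left _).smul_right _

end Sequences

/-! ### The ladder of soliton-creating operators -/

section SeqChain
open Polynomial
variable {N m : ℕ} [NeZero N]

/-- A constant sequence. -/
abbrev constSeq (c : ℂ) : BddSeq := algebraMap ℂ BddSeq c

/-- The partial rotated monodromy matrices of a sequence of chains. -/
def seqMono (N : ℕ) [NeZero N] {m : ℕ} (κ : ℂ) (u w : ℕ → Fin (m + 2) → ℂ) (p : ℕ) :
    Matrix (Fin 2) (Fin 2) (ℕ → Op N (m + 2))[X] :=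
  chainProd (constSeq (omegaHalf N)) (constSeq κ)
    (fun p ν => siteU (rotSite m p) (u ν (rotSite m p)))
    (fun p ν => siteW (rotSite m p) (w ν (rotSite m p))) (m + 1 + 1 - p) p

variable {κ : ℂ} {u w : ℕ → Fin (m + 2) → ℂ}

theorem isChain_seqMono (κ : ℂ) (u w : ℕ → Fin (m + 2) → ℂ) :
    IsChain (constSeq (omegaHalf N)) (constSeq κ)
      (fun p ν => siteU (rotSite m p) (u ν (rotSite m p)))
      (fun p ν => siteW (rotSite m p) (w ν (rotSite m p))) (m + 1) (seqMono N κ u w) :=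
  isChain_chainProd _ _ _ _ _

theorem seqMono_seqEval (κ : ℂ) (u w : ℕ → Fin (m + 2) → ℂ) (ν : ℕ) :
    (seqMono N κ u w 0).map (seqEval ν) = rotMono κ (u ν) (w ν) := by
  rw [seqMono, chainProd_seqEval, rotMono_eq_chainProd]
  rfl

/-- The `N`-th power of the top coefficient is a scalar that depends on the states only through
the product of their parameters. -/
theorem exists_seqMono_topCoeff_pow (hκ : κ ≠ 0) :
    ∃ a : ℂ, a ≠ 0 ∧ ∀ u w : ℕ → Fin (m + 2) → ℂ, (∀ ν i, u ν i ≠ 0) → (∀ ν i, w ν i ≠ 0) →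
      (∀ ν, ∏ q ∈ Finset.range (m + 2), (u ν (rotSite m q) * w ν (rotSite m q)) ^ N =
        (-1) ^ (m + 2)) →
      topCoeff (seqMono N κ u w) (m + 1) 0 ^ N = constSeq a • 1 := by
  obtain ⟨ε, hε, hpow⟩ := exists_siteUW_pow N
  refine ⟨(κ ^ N * ε) ^ (m + 2) * (-1) ^ (m + 2), mul_ne_zero (pow_ne_zero _ (mul_ne_zero
    (pow_ne_zero _ hκ) hε)) (pow_ne_zero _ (neg_ne_zero.2 one_ne_zero)), fun u w hu hw huw => ?_⟩
  funext ν
  have hG := isChain_chainProd (omegaHalf N) κ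
    (fun p => (siteU (rotSite m p) (u ν (rotSite m p)) : Op N (m + 2)))
    (fun p => siteW (rotSite m p) (w ν (rotSite m p))) (m + 1)
  have hW : WeylChain (omegaHalf N)
      (fun p => (siteU (rotSite m p) (u ν (rotSite m p)) : Op N (m + 2)))
      (fun p => siteUInv (rotSite m p) (u ν (rotSite m p)))
      (fun p => siteW (rotSite m p) (w ν (rotSite m p)))
      (fun p => siteWInv (rotSite m p) (w ν (rotSite m p))) (m + 1) := by
    have h := weylChain_seq (N := N) (constSeq (omegaHalf N)) (fun _ => rfl) hu hw
    exact ⟨fun p hp => congrFun (h.uw p hp) ν, fun p hp => congrFun (h.uv p hp) ν,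
      fun p hp => congrFun (h.vu p hp) ν, fun p hp => congrFun (h.wwi p hp) ν,
      fun p hp => congrFun (h.wiw p hp) ν,
      fun p hp q hq hpq => congrFun (h.vu_comm p hp q hq hpq).eq ν,
      fun p hp q hq hpq => congrFun (h.vw_comm p hp q hq hpq).eq ν,
      fun p hp q hq hpq => congrFun (h.uw_comm p hp q hq hpq).eq ν,
      fun p hp q hq hpq => congrFun (h.uu_comm p hp q hq hpq).eq ν,
      fun p hp q hq hpq => congrFun (h.ww_comm p hp q hq hpq).eq ν⟩
  have h1 := hG.topCoeff_pow (N := N) hW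
    (fun p => ε * (u ν (rotSite m p) * w ν (rotSite m p)) ^ N) (fun p _ => hpow _ _ _ _)
  have h2 : topCoeff (seqMono N κ u w) (m + 1) 0 ν = topCoeff (fun p => chainProd (omegaHalf N) κ
      (fun p => (siteU (rotSite m p) (u ν (rotSite m p)) : Op N (m + 2)))
      (fun p => siteW (rotSite m p) (w ν (rotSite m p))) (m + 1 + 1 - p) p) (m + 1) 0 := by
    rw [topCoeff, topCoeff, ← coeff_seqEval]
    congr 1
    rw [← Matrix.map_apply (f := seqEval ν), seqMono, chainProd_seqEval]
    rfl
  rw [Pi.pow_apply, h2, h1]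
  simp only [← mul_assoc]
  rw [Finset.prod_mul_distrib, Finset.prod_const, Finset.card_range, huw ν]
  rfl

variable {a : ℂ}

/-- An element with an invertible scalar `N`-th power is invertible. -/
theorem topCoeff_mul_inv {S O : Type*} [CommRing S] [Ring O] [Algebra S O] {A : O} {a ai : S}
    (hai : ai * a = 1) (hA : A ^ N = a • 1) :
    A * (ai • A ^ (N - 1)) = 1 ∧ (ai • A ^ (N - 1)) * A = 1 := by
  have hN : N - 1 + 1 = N := Nat.sub_add_cancel (Nat.one_le_iff_ne_zero.2 (NeZero.ne N))
  constructor
  · rw [mul_smul_comm, ← pow_succ', hN, hA, smul_smul, hai, one_smul]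
  · rw [smul_mul_assoc, ← pow_succ, hN, hA, smul_smul, hai, one_smul]

theorem constSeq_inv_mul {c : ℂ} (hc : c ≠ 0) : constSeq c⁻¹ * constSeq c = 1 := by
  rw [constSeq, constSeq, ← map_mul, inv_mul_cancel₀ hc, map_one]

/-- The inverse of `w` at the last but one site in terms of coefficients of the monodromy
matrix. -/
theorem exists_siteWInv_eq (ha : a ≠ 0)
    (hu : ∀ ν i, u ν i ≠ 0) (hw : ∀ ν i, w ν i ≠ 0)
    (hA : topCoeff (seqMono N κ u w) (m + 1) 0 ^ N = constSeq a • 1) :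
    ∃ s : BddSeq, (fun ν => (siteWInv (Fin.last m).castSucc (w ν (Fin.last m).castSucc) :
        Op N (m + 2))) =
      s • ((seqMono N κ u w 0 0 0).coeff (m + 2) ^ (N - 1) *
        (seqMono N κ u w 0 0 1).coeff (m + 2)) := by
  have hG := isChain_seqMono (N := N) κ u w
  have hW := weylChain_seq (N := N) (constSeq (omegaHalf N)) (fun _ => rfl) hu hw
  have h1 := hG.topCoeff_right hW (p := 0) (Nat.zero_le _)
  have h2 := (topCoeff_mul_inv (N := N) (constSeq_inv_mul ha) hA).2
  have hlast : rotSite m (m + 1) = (Fin.last m).castSucc := rotSite_succ_eq (Fin.last m)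
  have hh := omegaHalf_ne_zero N
  refine ⟨-(constSeq (omegaHalf N)⁻¹ * constSeq κ * constSeq a⁻¹), ?_⟩
  have h3 := congrArg (fun y => (constSeq a⁻¹ • topCoeff (seqMono N κ u w) (m + 1) 0 ^ (N - 1)) * y)
    h1
  simp only [mul_neg, mul_smul_comm] at h3
  rw [← mul_assoc, h2, one_mul, hlast] at h3
  have h4 := congrArg (fun y => -(constSeq (omegaHalf N)⁻¹ • y)) h3
  simp only [smul_neg, neg_neg, smul_smul, constSeq_inv_mul hh, one_smul] at h4
  rw [← h4, smul_mul_assoc, smul_smul, neg_smul]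
  rfl

/-- The inverse of `u` at the last site in terms of coefficients of the monodromy matrix. -/
theorem exists_siteUInv_eq (ha : a ≠ 0)
    (hu : ∀ ν i, u ν i ≠ 0) (hw : ∀ ν i, w ν i ≠ 0)
    (hA : topCoeff (seqMono N κ u w) (m + 1) 0 ^ N = constSeq a • 1) :
    ∃ s : BddSeq, (fun ν => (siteUInv (Fin.last (m + 1)) (u ν (Fin.last (m + 1))) :
        Op N (m + 2))) =
      s • ((seqMono N κ u w 0 0 0).coeff (m + 2) ^ (N - 1) *
        (seqMono N κ u w 0 1 0).coeff (m + 1)) := by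
  have hG := isChain_seqMono (N := N) κ u w
  have hW := weylChain_seq (N := N) (constSeq (omegaHalf N)) (fun _ => rfl) hu hw
  have h1 := hG.topCoeff_mul_v hW
  have h2 := (topCoeff_mul_inv (N := N) (constSeq_inv_mul ha) hA).2
  refine ⟨constSeq κ * constSeq (omegaHalf N) ^ 2 * constSeq a⁻¹, ?_⟩
  have h3 := congrArg (fun y => (constSeq a⁻¹ • topCoeff (seqMono N κ u w) (m + 1) 0 ^ (N - 1)) * y)
    h1
  simp only [mul_smul_comm] at h3
  rw [← mul_assoc, h2, one_mul, rotSite_zero] at h3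
  rw [h3, smul_mul_assoc, smul_smul]
  rfl

theorem cumV_seq (u : ℕ → Fin (m + 2) → ℂ) (p ν : ℕ) :
    cumV (fun p ν => (siteUInv (rotSite m p) (u ν (rotSite m p)) : Op N (m + 2))) p ν =
      (∏ q ∈ Finset.range (p + 1), (u ν (rotSite m q))⁻¹) •
        cumV (fun p => (atSite (rotSite m p) (weylX N ^ (N - 1)) : Op N (m + 2))) p := by
  induction p with
  | zero => rw [Finset.prod_range_one]; rfl
  | succ p ih =>
    rw [cumV, Pi.mul_apply, ih, siteUInv, smul_mul_smul_comm, ← Finset.prod_range_succ, cumV]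

/-- At the end of the ladder the coefficients of the lower left entry are negligible, as soon as
sequences with limit zero are. -/
theorem seqMono_lower_coeff_mem (hκ : κ ≠ 0) (ha : a ≠ 0)
    (hu : ∀ ν i, u ν i ≠ 0) (hw : ∀ ν i, w ν i ≠ 0)
    (hA : topCoeff (seqMono N κ u w) (m + 1) 0 ^ N = constSeq a • 1)
    (hwb : ∀ p < m + 1, ∃ s : BddSeq, ∀ ν, s.1 ν = (w ν (rotSite m p))⁻¹ ^ N)
    {P P' : Submodule BddSeq (ℕ → Op N (m + 2))}
    (hM : ∀ i r, CoeffsIn (transporter P P) (seqMono N κ u w 0 i r))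
    (hV : ∀ p < m + 1, cumV (fun p ν => (siteUInv (rotSite m p) (u ν (rotSite m p)) :
      Op N (m + 2))) p ∈ transporter P P') (l : ℕ) (hl : 1 ≤ l) :
    (seqMono N κ u w 0 1 0).coeff l ∈ transporter P P' := by
  have hG := isChain_seqMono (N := N) κ u w
  have hW := weylChain_seq (N := N) (constSeq (omegaHalf N)) (fun _ => rfl) hu hw
  have hh := omegaHalf_ne_zero N
  have h2 := topCoeff_mul_inv (N := N) (constSeq_inv_mul ha) hA
  choose! s hs using hwb
  refine hG.lower_coeff_mem (N := N) (hi := constSeq (omegaHalf N)⁻¹)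
    (ki := constSeq (κ * omegaHalf N ^ 2)⁻¹)
    (constSeq_inv_mul hh) ?_ hW (fun i => hM i 0) h2.1
    (Submodule.smul_mem _ _ (pow_mem_transporter (hM 0 0 _) _)) s ?_ hV (by omega)
  · have := constSeq_inv_mul (mul_ne_zero hκ (pow_ne_zero 2 hh))
    rwa [constSeq, constSeq, map_mul, map_pow] at this
  · intro p hp
    funext ν
    have hc := hw ν (rotSite m p)
    have e1 : (w ν (rotSite m p))⁻¹ = (w ν (rotSite m p))⁻¹ ^ N * w ν (rotSite m p) ^ (N - 1) := by
      obtain ⟨N', hN'⟩ : ∃ N', N = N' + 1 := ⟨N - 1, by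
        have := Nat.one_le_iff_ne_zero.2 (NeZero.ne N); omega⟩
      rw [hN', Nat.add_sub_cancel, pow_succ, mul_right_comm, ← mul_pow, inv_mul_cancel₀ hc, one_pow,
        one_mul]
    change (siteWInv _ _ : Op N (m + 2)) = (s p).1 ν • (siteW _ _) ^ (N - 1)
    rw [hs p hp, siteWInv, siteW, _root_.smul_pow, smul_smul, ← e1, ← atSiteHom_apply,
      ← atSiteHom_apply, ← map_pow]

end SeqChain

/-! ### The limit of the soliton-creating operators -/

section Bounds

/-- A convergent sequence as an element of `BddSeq`. -/
theorem exists_bddSeq_of_tendsto {g : ℕ → ℂ} {c : ℂ} (hg : Tendsto g atTop (𝓝 c)) :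
    ∃ s : BddSeq, ∀ ν, s.1 ν = g ν := by
  obtain ⟨C, hC⟩ := (Metric.isBounded_range_of_tendsto g hg).exists_norm_le
  exact ⟨⟨g, C, fun ν => hC _ ⟨ν, rfl⟩⟩, fun _ => rfl⟩

/-- A sequence with constant `N`-th powers as an element of `BddSeq`. -/
theorem exists_bddSeq_of_pow {N : ℕ} (hN : N ≠ 0) {g : ℕ → ℂ} {c : ℂ} (hg : ∀ ν, g ν ^ N = c) :
    ∃ s : BddSeq, ∀ ν, s.1 ν = g ν := by
  refine ⟨⟨g, 1 + ‖c‖, fun ν => ?_⟩, fun _ => rfl⟩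
  by_contra! h
  have h1 : 1 ≤ ‖g ν‖ := by linarith [norm_nonneg c]
  have h2 := le_self_pow₀ h1 hN
  rw [← norm_pow, hg] at h2
  linarith

theorem tendsto_zero_of_pow {N : ℕ} {g : ℕ → ℂ}
    (hg : Tendsto (fun ν => g ν ^ N) atTop (𝓝 0)) : Tendsto g atTop (𝓝 0) := by
  rw [Metric.tendsto_atTop] at hg ⊢
  intro ε hε
  obtain ⟨ν0, h⟩ := hg (ε ^ N) (pow_pos hε N)
  refine ⟨ν0, fun ν hν => ?_⟩
  have h1 := h ν hν
  rw [dist_zero_right, norm_pow] at h1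
  rw [dist_zero_right]
  exact lt_of_pow_lt_pow_left₀ N hε.le h1

end Bounds

section Final
open Polynomial
variable {N m : ℕ} [NeZero N] {κ : ℂ} {φ : ℕ → ℝ} {lam : ℕ → ℂ}

/-- Up to sign, the scalar that has to be inverted in order to solve the exchange relations of the
`j`-th operator. -/
def solvDet (K : ℂ) (φ : ℕ → ℝ) (m j : ℕ) (f : ℕ → ℂ) : ℂ :=
  K / Delta K (φ j) + Lam K (φ j) / Delta K (φ j) ^ 2 *
    (Theta K φ m j (amp K φ f j) / Theta K φ (m + 1) j (amp K φ f j)) *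
    (tau K φ 0 (j + 1) (amp K φ f (j + 1)) / tau K φ (m + 1) (j + 1) (amp K φ f (j + 1)))

section Limits
variable {K : ℂ} {f : ℕ → ℕ → ℂ}

theorem tendsto_tau_amp (hf : ∀ k < m + 1, Tendsto (fun ν => f ν k) atTop (𝓝 (-1)))
    (p : ℕ) {j : ℕ} (hj : j ≤ m + 1) :
    Tendsto (fun ν => tau K φ p j (amp K φ (f ν) j)) atTop
      (𝓝 (tau K φ p j (amp K φ (fun _ => -1) j))) :=
  tendsto_tau p fun k hk => tendsto_amp j (g := fun _ => -1) (hf k (by omega))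

theorem tendsto_Theta_amp (hf : ∀ k < m + 1, Tendsto (fun ν => f ν k) atTop (𝓝 (-1)))
    (p : ℕ) {j : ℕ} (hj : j ≤ m + 1) :
    Tendsto (fun ν => Theta K φ p j (amp K φ (f ν) j)) atTop
      (𝓝 (Theta K φ p j (amp K φ (fun _ => -1) j))) :=
  tendsto_Theta p fun k hk => tendsto_amp j (g := fun _ => -1) (hf k (by omega))

/-- The ratios of tau-functions that make the `V` of the ladder tend to zero. -/
theorem tendsto_tau_ratio (hK : K ≠ 0) (hW : GenericWaves K φ (m + 1))
    (hper : ∀ k < m + 1, (Delta K (φ k) / DeltaStar K (φ k)) ^ (m + 2) = 1)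
    (hf : ∀ k < m + 1, Tendsto (fun ν => f ν k) atTop (𝓝 (-1))) {p j : ℕ} (hj : j ≤ m + 1)
    (hp : p < j) :
    Tendsto (fun ν => tau K φ p j (amp K φ (f ν) j) / tau K φ (m + 1) j (amp K φ (f ν) j)) atTop
      (𝓝 0) := by
  have h := (tendsto_tau_amp (K := K) (φ := φ) hf p hj).div (tendsto_tau_amp hf (m + 1) hj)
    (tau_amp_ne_zero hK hW hper hj)
  rwa [tau_amp_eq_zero hW hj hp, zero_div] at h

theorem tendsto_Theta_ratio (hK : K ≠ 0) (hW : GenericWaves K φ (m + 1))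
    (hper : ∀ k < m + 1, (Delta K (φ k) / DeltaStar K (φ k)) ^ (m + 2) = 1)
    (hf : ∀ k < m + 1, Tendsto (fun ν => f ν k) atTop (𝓝 (-1))) (p : ℕ) {j : ℕ}
    (hj : j ≤ m + 1) :
    ∃ c, Tendsto (fun ν => Theta K φ p j (amp K φ (f ν) j) /
      Theta K φ (m + 1) j (amp K φ (f ν) j)) atTop (𝓝 c) :=
  ⟨_, (tendsto_Theta_amp hf p hj).div (tendsto_Theta_amp hf (m + 1) hj)
    (Theta_amp_ne_zero hK hW hper hj)⟩

theorem tendsto_Theta_ratio_full (hK : K ≠ 0) (hW : GenericWaves K φ (m + 1))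
    (hper : ∀ k < m + 1, (Delta K (φ k) / DeltaStar K (φ k)) ^ (m + 2) = 1)
    (hf : ∀ k < m + 1, Tendsto (fun ν => f ν k) atTop (𝓝 (-1))) (p' : ℕ) {p : ℕ} (hp : p < m + 1) :
    ∃ c, Tendsto (fun ν => Theta K φ p' (m + 1) (amp K φ (f ν) (m + 1)) /
      Theta K φ p (m + 1) (amp K φ (f ν) (m + 1))) atTop (𝓝 c) :=
  ⟨_, (tendsto_Theta_amp hf p' le_rfl).div (tendsto_Theta_amp hf p le_rfl)
    (Theta_amp_full_ne_zero hK hW hper hp)⟩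

theorem tendsto_solvDet (hK : K ≠ 0) (hW : GenericWaves K φ (m + 1))
    (hper : ∀ k < m + 1, (Delta K (φ k) / DeltaStar K (φ k)) ^ (m + 2) = 1)
    (hf : ∀ k < m + 1, Tendsto (fun ν => f ν k) atTop (𝓝 (-1))) {j : ℕ} (hj : j < m + 1) :
    Tendsto (fun ν => solvDet K φ m j (f ν)) atTop (𝓝 (K / Delta K (φ j))) := by
  obtain ⟨c, hc⟩ := tendsto_Theta_ratio hK hW hper hf m (j := j) hj.le
  have h := tendsto_tau_ratio hK hW hper hf (p := 0) (j := j + 1) hj (by omega)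
  have := ((hc.const_mul (Lam K (φ j) / Delta K (φ j) ^ 2)).mul h).const_add (K / Delta K (φ j))
  rwa [mul_zero, add_zero] at this

end Limits

theorem evalAt_seqEval {A : Type*} [Ring A] [Algebra ℂ A] (x : ℂ) (P : (ℕ → A)[X]) (ν : ℕ) :
    evalAt (constSeq x) P ν = evalAt x (seqEval ν P) := by
  have hd : (seqEval ν P).natDegree < P.natDegree + 1 := Nat.lt_succ_of_le natDegree_map_le
  rw [evalAt_eq_sum _ P (Nat.lt_succ_self _), evalAt_eq_sum _ _ hd, Finset.sum_apply]
  refine Finset.sum_congr rfl fun l _ => ?_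
  rw [coeff_seqEval]
  rfl

theorem prodQ_apply {A : Type*} [Ring A] (Q : ℕ → ℕ → A) (j ν : ℕ) :
    prodQ Q j ν = (List.ofFn fun i : Fin j => Q i ν).prod := by
  induction j with
  | zero => rfl
  | succ j ih => rw [prodQ, Pi.mul_apply, ih, prod_ofFn_succ_last]; rfl

/-- If the soliton-creating operators are normalized so as to converge, the limit is annihilated by
the values of the lower left entry of the rotated monodromy matrix of the homogeneous chain at the
spectral parameters. -/
theorem lower_left_mul_limit_eq_zero (hκ : κ ≠ 0) (hW : GenericWaves (κ ^ N) φ (m + 1))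
    (hper : ∀ k < m + 1, (Delta (κ ^ N) (φ k) / DeltaStar (κ ^ N) (φ k)) ^ (m + 2) = 1)
    (hlam : ∀ k < m + 1, lam k ^ N = Lam (κ ^ N) (φ k)) {f : ℕ → ℕ → ℂ}
    (hf : ∀ k < m + 1, Tendsto (fun ν => f ν k) atTop (𝓝 (-1)))
    (hD : ∀ ν, ∀ j < m + 1, solvDet (κ ^ N) φ m j (f ν) ≠ 0)
    {T : ℕ → Op N (m + 2)} (hT : ∀ ν, IsSolitonOperator N (m + 2) κ φ lam (f ν) (T ν))
    {c : ℕ → ℂ} {S : Op N (m + 2)} (hS : Tendsto (fun ν => c ν • T ν) atTop (𝓝 S))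
    {k : ℕ} (hk : k < m + 1) :
    evalAt (lam k)⁻¹ (rotMono κ (uHom N) wHom 1 0) * S = 0 := by
  have hK : κ ^ N ≠ 0 := pow_ne_zero N hκ
  have hN : N ≠ 0 := NeZero.ne N
  have hh := omegaHalf_ne_zero N
  have hlam0 : ∀ j < m + 1, lam j ≠ 0 := fun j hj h0 => by
    have := hlam j hj
    rw [h0, zero_pow hN] at this
    exact Lam_ne_zero hW hj this.symm
  choose u w Q hu0 hw0 hst hQ hTeq using hT
  have hst' : ∀ ν, ∀ j ≤ m + 1,
      IsSolitonState N (m + 2) (κ ^ N) φ j (amp (κ ^ N) φ (f ν) j) (u ν j) (w ν j) := by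
    intro ν j hj
    cases j with
    | zero =>
      rw [hu0, hw0]
      exact isSolitonState_zero
    | succ j => exact hst ν j (by omega)
  have hstep : ∀ ν j, j < m + 1 → ∃ k : ℂ, ∃ q : ℕ → Op N (m + 2),
      k ^ N = κ ^ N / Delta (κ ^ N) (φ j) ∧ q 0 = Q ν j ∧
      (∀ e, q (e + 1) = (k / κ) • (q e * siteUInv (Fin.last _) (u ν (j + 1) (Fin.last _)))) ∧
      StepRel (omegaHalf N) (omegaHalf N)⁻¹ k (lam j) (-(omegaHalf N * lam j * k / κ))
        (siteWInv (Fin.last m).castSucc (w ν j (Fin.last m).castSucc)) q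
        (rotMono κ (u ν j) (w ν j)) (rotMono κ (u ν (j + 1)) (w ν (j + 1))) := by
    intro ν j hj
    obtain ⟨k, hk, q, h1, h2, h3⟩ := modifiedQ_stepRel hκ (hlam0 j hj) (hst' ν j hj.le).ne_zero.1
      (hst' ν j hj.le).ne_zero.2 (hst' ν (j + 1) hj).ne_zero.1 (hst' ν (j + 1) hj).ne_zero.2
      (hQ ν j (by omega))
    exact ⟨k, q, hk, h1, h2, h3⟩
  choose! kφ q hkφ hq0 hqs hstep using hstep
  have hkφ0 : ∀ ν j, j < m + 1 → kφ ν j ≠ 0 := fun ν j hj h0 => by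
    have := hkφ ν j hj
    rw [h0, zero_pow hN] at this
    exact div_ne_zero hK (hW.x_ne j hj) this.symm
  have hkb : ∀ j < m + 1, ∃ s : BddSeq, ∀ ν, s.1 ν = kφ ν j := fun j hj =>
    exists_bddSeq_of_pow hN fun ν => hkφ ν j hj
  have hkib : ∀ j < m + 1, ∃ s : BddSeq, ∀ ν, s.1 ν = (kφ ν j)⁻¹ := fun j hj =>
    exists_bddSeq_of_pow hN (c := (κ ^ N / Delta (κ ^ N) (φ j))⁻¹) fun ν => by
      rw [inv_pow, hkφ ν j hj]
  choose! kk hkk using hkb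
  obtain ⟨a, ha, hA⟩ := exists_seqMono_topCoeff_pow (N := N) (m := m) hκ
  have hA' : ∀ j ≤ m + 1, topCoeff (seqMono N κ (fun ν => u ν j) (fun ν => w ν j)) (m + 1) 0 ^ N =
      constSeq a • 1 := fun j hj => hA _ _ (fun ν => (hst' ν j hj).ne_zero.1)
    (fun ν => (hst' ν j hj).ne_zero.2) (fun ν => (hst' ν j hj).prod_uw_pow)
  let V : ℕ → ℕ → Op N (m + 2) := fun j ν =>
    siteUInv (Fin.last (m + 1)) (u ν (j + 1) (Fin.last (m + 1)))
  let π : ℕ → ℕ → Op N (m + 2) := fun j ν =>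
    siteWInv (Fin.last m).castSucc (w ν j (Fin.last m).castSucc)
  let ct : ℕ → BddSeq := fun j => constSeq (-(omegaHalf N * lam j / κ)) * kk j
  let ri : ℕ → BddSeq := fun j => constSeq κ⁻¹ * kk j
  have hct : ∀ ν, ∀ j < m + 1, (ct j).1 ν = -(omegaHalf N * lam j * kφ ν j / κ) := by
    intro ν j hj
    change -(omegaHalf N * lam j / κ) * (kk j).1 ν = _
    rw [hkk j hj]
    ring
  have hri : ∀ ν, ∀ j < m + 1, (ri j).1 ν = kφ ν j / κ := by
    intro ν j hj
    change κ⁻¹ * (kk j).1 ν = _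
    rw [hkk j hj]
    ring
  have hL : Ladder N (m + 1) (constSeq (omegaHalf N)) (constSeq (omegaHalf N)⁻¹) kk
      (fun j => constSeq (lam j)) ct ri π (fun j ν => Q ν j) V (fun j e ν => q ν j e)
      (fun j => seqMono N κ (fun ν => u ν j) (fun ν => w ν j) 0) := by
    constructor
    · exact constSeq_inv_mul hh
    · intro j hj e
      funext ν
      change q ν j e = (ri j).1 ν ^ e • (Q ν j * V j ν ^ e)
      rw [hri ν j hj]
      induction e with
      | zero => rw [hq0 ν j hj, pow_zero, pow_zero, one_smul, mul_one]
      | succ e ih =>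
        rw [hqs ν j hj, ih, smul_mul_assoc, smul_smul, pow_succ', pow_succ (V j ν), mul_assoc]
    · intro j hj
      refine StepRel.of_seqEval fun ν => ?_
      rw [seqMono_seqEval, seqMono_seqEval, hct ν j hj, hkk j hj]
      exact hstep ν j hj
    · intro j hj
      obtain ⟨s, hs⟩ := hkib j hj
      refine ⟨constSeq κ * s, Subtype.ext (funext fun ν => ?_)⟩
      change κ * s.1 ν * (ri j).1 ν = 1
      have := hkφ0 ν j hj
      rw [hs, hri ν j hj]
      field_simp
    · intro j hj
      obtain ⟨cΘ, hcΘ⟩ := tendsto_Theta_ratio hK hW hper hf m (j := j) hj.le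
      have hcτ := tendsto_tau_ratio hK hW hper hf (p := 0) (j := j + 1) hj (by omega)
      obtain ⟨pn, hpn⟩ := exists_bddSeq_of_tendsto (hcΘ.const_mul ((-1) ^ N))
      obtain ⟨v, hv⟩ := exists_bddSeq_of_tendsto (hcτ.const_mul (-(-1) ^ N))
      obtain ⟨γ, hγ⟩ := exists_bddSeq_of_tendsto ((tendsto_solvDet hK hW hper hf hj).neg.inv₀
        (neg_ne_zero.2 (div_ne_zero hK (hW.x_ne j hj))))
      refine ⟨v, pn, γ, ?_, ?_, ?_⟩
      · funext ν
        have h1 := (hst' ν (j + 1) hj).u_inv_pow (Fin.last (m + 1))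
        rw [Fin.val_last, (hst' ν (j + 1) hj).tau_period.1] at h1
        change (siteUInv _ _ : Op N (m + 2)) ^ N = algebraMap ℂ _ (v.1 ν)
        rw [hv, ← h1, siteUInv, _root_.smul_pow, ← atSiteHom_apply, ← map_pow, ← pow_mul,
          mul_comm (N - 1), pow_mul, weylX_pow, one_pow, map_one, Algebra.algebraMap_eq_smul_one]
      · funext ν
        have h1 := (hst' ν j hj.le).w_inv_pow (Fin.last m).castSucc
        rw [Fin.val_castSucc, Fin.val_last] at h1
        change (siteWInv _ _ : Op N (m + 2)) ^ N = algebraMap ℂ _ (pn.1 ν)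
        rw [hpn, ← h1, siteWInv, _root_.smul_pow, ← atSiteHom_apply, ← map_pow, ← pow_mul,
          mul_comm (N - 1), pow_mul, weylZ_pow, one_pow, map_one, Algebra.algebraMap_eq_smul_one]
      · refine Subtype.ext (funext fun ν => ?_)
        change γ.1 ν * ((omegaHalf N * (kk j).1 ν) ^ N -
          (-(ct j).1 ν) ^ N * pn.1 ν * (ri j).1 ν ^ N * v.1 ν) = 1
        have hx := hW.x_ne j hj
        have e1 : (omegaHalf N * (kk j).1 ν) ^ N = -(κ ^ N / Delta (κ ^ N) (φ j)) := by
          rw [hkk j hj, mul_pow, omegaHalf_pow, hkφ ν j hj, neg_one_mul]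
        have e2 : (-(ct j).1 ν) ^ N = -(Lam (κ ^ N) (φ j) / Delta (κ ^ N) (φ j)) := by
          rw [hct ν j hj, neg_neg, div_pow, mul_pow, mul_pow, omegaHalf_pow, hlam j hj, hkφ ν j hj]
          field_simp
        have e3 : (ri j).1 ν ^ N = 1 / Delta (κ ^ N) (φ j) := by
          rw [hri ν j hj, div_pow, hkφ ν j hj]
          field_simp
        have e4 : ((-1 : ℂ) ^ N) * (-1) ^ N = 1 := by rw [← mul_pow]; norm_num
        have e5 : (omegaHalf N * (kk j).1 ν) ^ N -
            (-(ct j).1 ν) ^ N * pn.1 ν * (ri j).1 ν ^ N * v.1 ν =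
            -solvDet (κ ^ N) φ m j (f ν) := by
          rw [e1, e2, e3, hpn, hv, solvDet]
          generalize Theta (κ ^ N) φ m j (amp (κ ^ N) φ (f ν) j) /
            Theta (κ ^ N) φ (m + 1) j (amp (κ ^ N) φ (f ν) j) = A
          generalize tau (κ ^ N) φ 0 (j + 1) (amp (κ ^ N) φ (f ν) (j + 1)) /
            tau (κ ^ N) φ (m + 1) (j + 1) (amp (κ ^ N) φ (f ν) (j + 1)) = B
          have e6 : Lam (κ ^ N) (φ j) / Delta (κ ^ N) (φ j) ^ 2 =
              Lam (κ ^ N) (φ j) / Delta (κ ^ N) (φ j) * (1 / Delta (κ ^ N) (φ j)) := by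
            rw [div_mul_div_comm, mul_one, sq]
          rw [e6]
          linear_combination (-(Lam (κ ^ N) (φ j) / Delta (κ ^ N) (φ j) *
            (1 / Delta (κ ^ N) (φ j)) * A * B)) * e4
        rw [e5, hγ]
        exact inv_mul_cancel₀ (neg_ne_zero.2 (hD ν j hj))
    · intro j hj
      exact exists_siteWInv_eq ha (fun ν => (hst' ν j hj.le).ne_zero.1)
        (fun ν => (hst' ν j hj.le).ne_zero.2) (hA' j hj.le)
    · intro j hj
      exact exists_siteUInv_eq ha (fun ν => (hst' ν (j + 1) hj).ne_zero.1)
        (fun ν => (hst' ν (j + 1) hj).ne_zero.2) (hA' (j + 1) hj)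
  let _ : NormedRing (Op N (m + 2)) := Matrix.linftyOpNormedRing
  let _ : NormedAlgebra ℂ (Op N (m + 2)) := Matrix.linftyOpNormedAlgebra
  have : NormOneClass (Op N (m + 2)) := Matrix.linfty_opNormOneClass
  have hM0 : ∀ ν, (seqMono N κ (fun ν => u ν 0) (fun ν => w ν 0) 0).map (seqEval ν) =
      rotMono κ (uHom N) wHom := fun ν => by
    rw [seqMono_seqEval, hu0, hw0]
  have hM : ∀ i r, CoeffsIn (bddOps (Op N (m + 2)))
      (seqMono N κ (fun ν => u ν 0) (fun ν => w ν 0) 0 i r) := by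
    intro i r l
    refine ⟨‖(rotMono (N := N) κ (uHom N) (wHom : Fin (m + 2) → ℂ) i r).coeff l‖, fun ν => ?_⟩
    rw [← coeff_seqEval, ← hM0 ν, Matrix.map_apply]
  have hn : ∀ P P' : Submodule BddSeq (ℕ → Op N (m + 2)),
      (∀ i r, CoeffsIn (transporter P P)
        (seqMono N κ (fun ν => u ν (m + 1)) (fun ν => w ν (m + 1)) 0 i r)) →
      (∀ x : ℕ → Op N (m + 2), Tendsto x atTop (𝓝 0) → x ∈ transporter P P') →
      ∀ l, 1 ≤ l → (seqMono N κ (fun ν => u ν (m + 1)) (fun ν => w ν (m + 1)) 0 1 0).coeff l ∈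
        transporter P P' := by
    intro P P' hreg hlim l hl
    refine seqMono_lower_coeff_mem hκ ha (fun ν => (hst' ν _ le_rfl).ne_zero.1)
      (fun ν => (hst' ν _ le_rfl).ne_zero.2) (hA' _ le_rfl) ?_ hreg ?_ l hl
    · intro p hp
      cases p with
      | zero =>
        obtain ⟨c', hc'⟩ := tendsto_Theta_ratio_full hK hW hper hf (m + 1) (p := 0) (by omega)
        obtain ⟨s, hs⟩ := exists_bddSeq_of_tendsto (hc'.const_mul ((-1) ^ N))
        refine ⟨s, fun ν => ?_⟩
        rw [hs, (hst' ν _ le_rfl).w_inv_pow, rotSite_zero, Fin.val_last,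
          (hst' ν _ le_rfl).tau_period.2]
      | succ p =>
        obtain ⟨c', hc'⟩ := tendsto_Theta_ratio_full hK hW hper hf p (p := p + 1) hp
        obtain ⟨s, hs⟩ := exists_bddSeq_of_tendsto (hc'.const_mul ((-1) ^ N))
        refine ⟨s, fun ν => ?_⟩
        rw [hs, (hst' ν _ le_rfl).w_inv_pow, rotSite_succ (by omega)]
    · intro p hp
      apply hlim
      have h1 : Tendsto (fun ν => ∏ q ∈ Finset.range (p + 1), (u ν (m + 1) (rotSite m q))⁻¹) atTop
          (𝓝 0) := by
        apply tendsto_zero_of_pow (N := N)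
        have h2 := (tendsto_tau_ratio hK hW hper hf (p := p) (j := m + 1) le_rfl hp).const_mul
          ((-(-1) ^ N) ^ (p + 1))
        rw [mul_zero] at h2
        refine h2.congr fun ν => ?_
        rw [← (hst' ν _ le_rfl).prod_u_inv_pow hp.le, Finset.prod_pow]
      have h2 := h1.smul_const
        (cumV (fun p => (atSite (rotSite m p) (weylX N ^ (N - 1)) : Op N (m + 2))) p)
      rw [zero_smul] at h2
      refine h2.congr fun ν => ?_
      rw [cumV_seq]
  have hfin := hL.eval_mul_prodQ_isLittleO (Nat.pos_of_ne_zero hN) hM hn hk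
    (μ := constSeq (lam k)⁻¹) (by
      rw [constSeq, constSeq, ← map_mul, mul_inv_cancel₀ (hlam0 k hk), map_one, sub_self])
  set E := evalAt (lam k)⁻¹ (rotMono (N := N) κ (uHom N) (wHom : Fin (m + 2) → ℂ) 1 0) with hE
  have hET : (fun ν => E * T ν) =o[atTop] T := by
    have e1 : prodQ (fun j ν => Q ν j) (m + 1) = T := by
      funext ν
      rw [prodQ_apply, hTeq]
      rfl
    rw [e1] at hfin
    refine hfin.congr_left fun ν => ?_
    rw [Pi.mul_apply, evalAt_seqEval, ← Matrix.map_apply (f := seqEval ν), hM0]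
  have hS' : Tendsto (fun ν => c ν • T ν) atTop (𝓝 S) := hS
  have h1 : Tendsto (fun ν => c ν • (E * T ν)) atTop (𝓝 (E * S)) := by
    simpa only [mul_smul_comm] using hS'.const_mul E
  have h2 : (fun ν => c ν • (E * T ν)) =o[atTop] (fun _ => (1 : ℝ)) :=
    ((Asymptotics.isBigO_refl c atTop).smul_isLittleO hET).trans_isBigO (hS'.isBigO_one ℝ)
  exact tendsto_nhds_unique h1 ((Asymptotics.isLittleO_one_iff ℝ).1 h2)

end Final

/-! ### From the annihilation property to the eigenvalue equation -/

section Interpolation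
open Polynomial

/-- If a polynomial with matrix coefficients, of degree at most `n` and with constant term `1`,
annihilates `S` at `n` distinct points `1 / μ_k`, then it acts on `S` by the scalar polynomial with
these zeros. -/
theorem evalAt_mul_eq_prod_smul {I : Type} [Fintype I] [DecidableEq I] {P : (Matrix I I ℂ)[X]}
    {S : Matrix I I ℂ} {n : ℕ} {μ : ℕ → ℂ} (hdeg : P.natDegree < n + 1) (hone : P.coeff 0 = 1)
    (hμ : ∀ k < n, μ k ≠ 0) (hinj : ∀ j < n, ∀ k < n, μ j = μ k → j = k)
    (hzero : ∀ k < n, evalAt (μ k)⁻¹ P * S = 0) (x : ℂ) :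
    evalAt x P * S = (∏ k ∈ Finset.range n, (1 - μ k * x)) • S := by
  ext i j
  set p : ℂ[X] := ∑ r ∈ Finset.range (n + 1), monomial r ((P.coeff r * S) i j) with hp
  set q : ℂ[X] := (∏ k ∈ Finset.range n, (1 - C (μ k) * X)) * C (S i j) with hq
  have hev : ∀ y, p.eval y = (evalAt y P * S) i j := by
    intro y
    rw [evalAt_eq_sum y P hdeg, hp, eval_finsetSum, Finset.sum_mul, Matrix.sum_apply]
    refine Finset.sum_congr rfl fun r _ => ?_
    rw [eval_monomial, smul_mul_assoc, Matrix.smul_apply, smul_eq_mul, mul_comm]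
  have hev' : ∀ y, q.eval y = (∏ k ∈ Finset.range n, (1 - μ k * y)) * S i j := by
    intro y
    simp [hq, eval_prod]
  have hdp : p.degree < (Finset.range (n + 1)).card := by
    rw [Finset.card_range]
    refine (degree_sum_le _ _).trans_lt ((Finset.sup_lt_iff (WithBot.bot_lt_coe _)).2
      fun r hr => ?_)
    exact (degree_monomial_le _ _).trans_lt (by exact_mod_cast Finset.mem_range.1 hr)
  have hdq : q.degree < (Finset.range (n + 1)).card := by
    rw [Finset.card_range]
    refine lt_of_le_of_lt (b := ((n : ℕ) : WithBot ℕ)) ?_ (by exact_mod_cast Nat.lt_succ_self n)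
    rw [← natDegree_le_iff_degree_le]
    refine (natDegree_mul_C_le _ _).trans ((natDegree_prod_le _ _).trans ?_)
    calc ∑ k ∈ Finset.range n, (1 - C (μ k) * X : ℂ[X]).natDegree ≤ ∑ _k ∈ Finset.range n, 1 := by
          refine Finset.sum_le_sum fun k _ => ?_
          refine (natDegree_sub_le _ _).trans ?_
          rw [natDegree_one]
          exact max_le (by omega) ((natDegree_C_mul_le _ _).trans natDegree_X_le)
      _ = n := by simp
  have hpq : p = q := by
    refine eq_of_degrees_lt_of_eval_index_eq (v := fun k => if k < n then (μ k)⁻¹ else 0)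
      (Finset.range (n + 1)) ?_ hdp hdq ?_
    · intro a ha b hb hab
      have ha' : a < n + 1 := by simpa using ha
      have hb' : b < n + 1 := by simpa using hb
      dsimp only at hab
      split_ifs at hab with h1 h2 h2
      · exact hinj a h1 b h2 (inv_injective hab)
      · exact absurd hab (inv_ne_zero (hμ a h1))
      · exact absurd hab.symm (inv_ne_zero (hμ b h2))
      · omega
    · intro k _
      split_ifs with hk
      · rw [hev, hev', hzero k hk, Finset.prod_eq_zero (Finset.mem_range.2 hk), zero_mul]
        · rfl
        · rw [mul_inv_cancel₀ (hμ k hk), sub_self]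
      · have h0 : evalAt (0 : ℂ) P = 1 := by
          rw [evalAt_eq_sum 0 P hdeg, Finset.sum_range_succ', Finset.sum_eq_zero]
          · simp [hone]
          · intro l _
            rw [pow_succ, mul_zero, zero_smul]
        rw [hev, hev', h0]
        simp
  rw [← hev, hpq, hev', Matrix.smul_apply, smul_eq_mul]

end Interpolation

theorem siteProj_eq_atSite {N M : ℕ} (i : Fin M) (a : ZMod N) :
    siteProj i a = atSite i (Matrix.diagonal fun b : ZMod N => if b = a then (1 : ℂ) else 0) := by
  ext α β
  simp only [siteProj, atSite, Matrix.diagonal_apply, Matrix.of_apply]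
  by_cases h : α = β
  · simp [h]
  · rw [if_neg h]
    split_ifs with h1 h2 h3
    · exact absurd (funext fun j => by
        by_cases hj : j = i
        · rw [hj, h2]
        · exact h1 j hj) h
    · rfl
    · rfl
    · rfl

variable {N : ℕ} [NeZero N]

section Bulk
variable {m : ℕ} (κ : ℂ) (u w : Fin (m + 2) → ℂ)

/-- The polynomial in `x = 1 / l` whose values are the upper left entry of `bulkLax`. -/
def bulkPoly : Polynomial (Op N (m + 2)) :=
  (List.ofFn fun i : Fin (m + 1) => laxPoly (omegaHalf N) κ (siteU i.castSucc (u i.castSucc))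
    (siteW i.castSucc (w i.castSucc))).prod 0 0

theorem bulkPoly_evalAt (x : ℂ) :
    evalAt x (bulkPoly (N := N) κ u w) = bulkLax κ x⁻¹ u w 0 0 := by
  rw [bulkPoly, ← Matrix.map_apply (f := evalAt x), bulkLax]
  refine congrFun (congrFun ?_ 0) 0
  change (evalAt x : Polynomial (Op N (m + 2)) →+* _).mapMatrix _ = _
  rw [map_list_prod, List.map_ofFn]
  congr 2
  funext i
  exact laxPoly_evalAt _ _ _ _ _

theorem rotMono_one_zero :
    rotMono (N := N) κ u w 1 0 =
      Polynomial.C (siteW (Fin.last (m + 1)) (w (Fin.last (m + 1)))) * bulkPoly κ u w := by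
  rw [rotMono, Matrix.mul_apply, Fin.sum_univ_two, bulkPoly]
  simp [laxPoly]

theorem bulkPoly_eq_chainProd :
    bulkPoly (N := N) κ u w = chainProd (omegaHalf N) κ
      (fun p => siteU (rotSite m p) (u (rotSite m p)))
      (fun p => siteW (rotSite m p) (w (rotSite m p))) (m + 1) 1 0 0 := by
  rw [bulkPoly, ← prod_ofFn_eq_chainProd]
  simp only [add_comm 1, rotSite_succ_eq]

theorem bulkPoly_natDegree_lt : (bulkPoly (N := N) κ u w).natDegree < m + 1 + 1 := by
  rw [Nat.lt_succ_iff, Polynomial.natDegree_le_iff_coeff_eq_zero]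
  intro l hl
  rw [bulkPoly_eq_chainProd]
  exact ((isChain_chainProd (omegaHalf N) κ (fun p => (siteU (rotSite m p) (u (rotSite m p)) :
    Op N (m + 2))) (fun p => siteW (rotSite m p) (w (rotSite m p))) (m + 1)).coeff_eq_zero 0
    (p := 1) (by omega)).1 l (by omega)

theorem bulkPoly_coeff_zero : (bulkPoly (N := N) κ u w).coeff 0 = 1 := by
  rw [bulkPoly_eq_chainProd]
  exact (isChain_chainProd (omegaHalf N) κ (fun p => (siteU (rotSite m p) (u (rotSite m p)) :
    Op N (m + 2))) (fun p => siteW (rotSite m p) (w (rotSite m p))) (m + 1)).constantCoeff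
    (p := 1) (by omega)

theorem commute_bulkLax_atSite_last (l : ℂ) (A : Matrix (ZMod N) (ZMod N) ℂ) (i j : Fin 2) :
    Commute (atSite (Fin.last (m + 1)) A) (bulkLax (N := N) κ l u w i j) :=
  commute_list_prod_entry _ _ (fun k p q => by
    rw [siteLax_apply]
    exact commute_atSite (Fin.castSucc_lt_last k).ne' _ _) i j

end Bulk

/-- As `d` of the last site vanishes, `b` is the upper left entry of the other sites times the
upper right entry of the last one. -/
theorem bHom_eq {m : ℕ} (κ l : ℂ) :
    bHom N (m + 2) κ l =
      l⁻¹ • (atSite (Fin.last (m + 1)) (weylX N) * bulkLax κ l (uHom N) wHom 0 0) := by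
  have hh : omegaHalf N ≠ 0 := Complex.exp_ne_zero _
  have h1 : bHom N (m + 2) κ l = (bulkLax (N := N) κ l (uHom N) (wHom : Fin (m + 2) → ℂ) *
      siteLax (N := N) κ l (uHom N) wHom (Fin.last (m + 1)) :
      Matrix (Fin 2) (Fin 2) (Op N (m + 2))) 0 1 := by
    rw [bulkLax, ← prod_ofFn_succ_last (fun i => siteLax (N := N) κ l (uHom N) wHom i)]
    rfl
  have h2 : siteLax (N := N) κ l (uHom N) (wHom : Fin (m + 2) → ℂ) (Fin.last (m + 1)) 0 1 =
      l⁻¹ • atSite (Fin.last (m + 1)) (weylX N) := by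
    simp only [siteLax, lax, siteU, uHom, Matrix.of_apply, Matrix.cons_val', Matrix.cons_val_zero,
      Matrix.cons_val_one, Matrix.cons_val_fin_one, smul_smul, ← neg_smul]
    congr 1
    field_simp
  have h3 : siteLax (N := N) κ l (uHom N) (wHom : Fin (m + 2) → ℂ) (Fin.last (m + 1)) 1 1 = 0 := by
    simp [siteLax, lax]
  rw [h1, Matrix.mul_apply, Fin.sum_univ_two, h2, h3, mul_zero, add_zero, mul_smul_comm,
    (commute_bulkLax_atSite_last κ _ _ l _ 0 0).eq]

theorem atSite_weylX_mul_siteProj {M : ℕ} (i : Fin M) (a : ZMod N) :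
    atSite i (weylX N) * siteProj i a = omega N ^ a.val • siteProj i a := by
  rw [siteProj_eq_atSite, ← atSiteHom_apply, ← atSiteHom_apply, ← map_mul, ← map_smul]
  congr 1
  rw [weylX, Matrix.diagonal_mul_diagonal, ← Matrix.diagonal_smul]
  congr 1
  funext b
  by_cases hb : b = a <;> simp [hb]

/-- Every value of the operator at `f = -1` is annihilated by the upper left entry of the product
of all Lax matrices but the last, at the spectral parameters of all the solitons. -/
theorem bulkPoly_mul_eq_zero {m : ℕ} {κ : ℂ} (hκ : κ ≠ 0) {φ : ℕ → ℝ} {lam : ℕ → ℂ}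
    (hW : GenericWaves (κ ^ N) φ (m + 1))
    (hper : ∀ k < m + 1, (Delta (κ ^ N) (φ k) / DeltaStar (κ ^ N) (φ k)) ^ (m + 2) = 1)
    (hlam : ∀ k < m + 1, lam k ^ N = Lam (κ ^ N) (φ k)) {S : Op N (m + 2)}
    (hS : IsSolitonOperatorAt N (m + 2) κ φ lam (fun _ => -1) S) {k : ℕ} (hk : k < m + 1) :
    evalAt (lam k)⁻¹ (bulkPoly κ (uHom N) wHom) * S = 0 := by
  obtain ⟨f, c, T, hf, hT, hcT⟩ := hS
  have hf' : ∀ k < m + 1, Tendsto (fun ν => f ν k) atTop (𝓝 (-1)) := fun k hk => hf k (by omega)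
  have hK : κ ^ N ≠ 0 := pow_ne_zero _ hκ
  have hev : ∀ᶠ ν in atTop, ∀ j ∈ Finset.range (m + 1), solvDet (κ ^ N) φ m j (f ν) ≠ 0 := by
    rw [Filter.eventually_all_finset]
    intro j hj
    exact (tendsto_solvDet hK hW hper hf' (Finset.mem_range.1 hj)).eventually_ne
      (div_ne_zero hK (hW.x_ne j (Finset.mem_range.1 hj)))
  obtain ⟨a, ha⟩ := Filter.eventually_atTop.1 hev
  have hsh := tendsto_add_atTop_nat a
  have h := lower_left_mul_limit_eq_zero hκ hW hper hlam (f := fun ν => f (ν + a))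
    (T := fun ν => T (ν + a)) (c := fun ν => c (ν + a)) (fun k hk => (hf' k hk).comp hsh)
    (fun ν j hj => ha _ (Nat.le_add_left _ _) j (Finset.mem_range.2 hj)) (fun ν => hT _)
    (hcT.comp hsh) hk
  rw [rotMono_one_zero, map_mul, evalAt_C] at h
  have h2 := congrArg (siteWInv (Fin.last (m + 1)) (-1) * ·) h
  have h3 : (siteWInv (Fin.last (m + 1)) (-1) : Op N (m + 2)) *
      siteW (Fin.last (m + 1)) (wHom (Fin.last (m + 1))) = 1 := siteWInv_mul _ (by norm_num)
  rwa [mul_zero, mul_assoc, ← mul_assoc, h3, one_mul] at h2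

end RelToda

end

theorem mainTheorem5 (N M : ℕ) [NeZero N] (hM : 2 ≤ M) (κ : ℂ) (hκ : κ ≠ 0)
    (hgen : ∀ p < M, (Real.cos (p * Real.pi / M) : ℂ) ^ 2 + κ ^ N ≠ 0)
    (φ : ℕ → ℝ)
    (hφ : ∀ k < M - 1, ∃ p : ℕ, 1 ≤ p ∧ p ≤ M - 1 ∧ φ k = p * Real.pi / M)
    (hφ_inj : ∀ j < M - 1, ∀ k < M - 1, φ j = φ k → j = k)
    (lam : ℕ → ℂ) (hlam : ∀ k < M - 1, lam k ^ N = RelToda.Lam (κ ^ N) (φ k))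
    (S : RelToda.Op N M)
    (hS : RelToda.IsSolitonOperatorAt N M κ φ lam (fun _ => -1) S) :
    (∀ n < M - 1, RelToda.bHom N M κ (lam n) * S = 0) ∧
    ∀ l : ℂ, l ≠ 0 → ∀ a : ZMod N,
      RelToda.bHom N M κ l * (RelToda.siteProj ⟨M - 1, by omega⟩ a * S) =
        (RelToda.omega N ^ a.val * l⁻¹ * ∏ k ∈ Finset.range (M - 1), (1 - lam k / l)) •
          (RelToda.siteProj ⟨M - 1, by omega⟩ a * S) := by
  obtain ⟨m, rfl⟩ : ∃ m, M = m + 2 := ⟨M - 2, by omega⟩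
  have hK : κ ^ N ≠ 0 := pow_ne_zero _ hκ
  obtain ⟨hW, hper⟩ := RelToda.genericWaves hK hgen hφ hφ_inj
  change RelToda.GenericWaves (κ ^ N) φ (m + 1) at hW
  have hzero := fun k (hk : k < m + 1) =>
    RelToda.bulkPoly_mul_eq_zero hκ hW hper hlam hS hk
  have hlam0 : ∀ k < m + 1, lam k ≠ 0 := fun k hk h0 =>
    RelToda.Lam_ne_zero hW hk (by rw [← hlam k hk, h0, zero_pow (NeZero.ne N)])
  have hinj : ∀ j < m + 1, ∀ k < m + 1, lam j = lam k → j = k := fun j hj k hk h =>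
    hW.Lam_inj j hj k hk (by rw [← hlam j hj, ← hlam k hk, h])
  refine ⟨fun n hn => ?_, fun l hl a => ?_⟩
  · have h := hzero n hn
    rw [RelToda.bulkPoly_evalAt, inv_inv] at h
    rw [RelToda.bHom_eq, smul_mul_assoc, mul_assoc, h, mul_zero, smul_zero]
  · have h := RelToda.evalAt_mul_eq_prod_smul
      (RelToda.bulkPoly_natDegree_lt κ (RelToda.uHom N) RelToda.wHom)
      (RelToda.bulkPoly_coeff_zero κ _ _) hlam0 hinj hzero l⁻¹
    rw [RelToda.bulkPoly_evalAt, inv_inv] at h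
    have hc := (RelToda.commute_bulkLax_atSite_last (m := m) κ (RelToda.uHom N) RelToda.wHom l
      (Matrix.diagonal fun b : ZMod N => if b = a then (1 : ℂ) else 0) 0 0).eq
    rw [← RelToda.siteProj_eq_atSite] at hc
    change RelToda.bHom N (m + 2) κ l * (RelToda.siteProj (Fin.last (m + 1)) a * S) =
      (RelToda.omega N ^ a.val * l⁻¹ * ∏ k ∈ Finset.range (m + 1), (1 - lam k / l)) •
        (RelToda.siteProj (Fin.last (m + 1)) a * S)
    rw [RelToda.bHom_eq, smul_mul_assoc, mul_assoc, ← mul_assoc (RelToda.bulkLax _ _ _ _ _ _), ← hc,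
      mul_assoc (RelToda.siteProj _ _), h, mul_smul_comm, mul_smul_comm, ← mul_assoc,
      RelToda.atSite_weylX_mul_siteProj, smul_mul_assoc, smul_smul, smul_smul]
    simp only [div_eq_mul_inv]
    congr 1
    ring
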